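/- Let $G$ be a (finite-dimensional, real) Lie group with Lie algebra $\mathfrak g$, let $\mathfrak g$ act linearly on $\mathbb R^n$, and let $P$ be a connected (nonempty) Hausdorff smooth manifold with a smooth right action of $G$. For $\xi\in\mathfrak g$ write $\bar\xi$ for the fundamental vector field $\bar\xi_p=\frac{d}{dt}\big|_{t=0}\,p\cdot\exp(t\xi)$. Let $\varpi=\omega\oplus\alpha$ be a $\mathfrak g\ltimes\mathbb R^n$-valued generalised Cartan connection on $P$, i.e. a smooth $\mathfrak g\ltimes\mathbb R^n$-valued $1$-form such that every $\varpi_p:T_pP\to\mathfrak g\ltimes\mathbb R^n$ is a linear isomorphism and, for all $\xi\in\mathfrak g$, $$\varpi(\bar\xi)=\xi,\qquad \mathcal L_{\bar\xi}\varpi+\operatorname{ad}_\xi\varpi=0 .$$ Assume that the action of $G$ on $P$ is proper (preimages of compact sets under $P\times G\to P\times P$, $(p,g)\mapsto(p,p\cdot g)$, are compact) and has a single orbit type (any two isotropy groups are conjugate in $G$). Then all isotropy groups are finite. Assume furthermore that the isotropy groups are normal subgroups of $G$. Then they are all equal to one normal subgroup $K$. The quotient group $K\backslash G$ carries a Lie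 group structure for which $G\to K\backslash G$ is a local diffeomorphism, and the action of $G$ on $P$ factors to a free and effective right action of $K\backslash G$. The orbit space $M=P/(K\backslash G)$, with its quotient topology, is Hausdorff (and second countable if $P$ is) and carries the structure of a smooth $n$-manifold for which the projection $\pi:P\to M$ is a submersion and a smooth, locally trivial principal $K\backslash G$-bundle. If in addition $G$ is connected, then: (i) under the identification of $\mathfrak g$ with the Lie algebra of $K\backslash G$ given by the differential of $G\to K\backslash G$, the form $\omega$ is a principal $K\backslash G$-connection form on $P$: it is smooth, $\omega(\bar\xi)=\xi$ for all $\xi$, and $R_h^*\omega=\operatorname{Ad}_{h^{-1}}\omega$ for all $h\in K\backslash G$; (ii) there is a smooth representation $\sigma$ of $K\backslash G$ on $\mathbb R^n$ whose composition with $G\to K\backslash G$ has the given action of $\mathfrak g$ as its differential, and $\alpha$ is a solder form for it: $\alpha$ is smooth, $\ker\alpha=\ker d\pi$, and $R_h^*\alpha=\sigma(h)^{-1}\alpha$ for all $h\in K\backslash G$. -/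

import Mathlib

open scoped Manifold ContDiff RightActions Topology

noncomputable section

namespace GenCartan

/-- A real Lie group of class `C^∞` is a Lie group of the class that Mathlib asks for when it
equips the tangent space at the identity with its Lie algebra structure. -/
instance lieGroup_minSmoothness {F : Type*} [NormedAddCommGroup F] [NormedSpace ℝ F]
    {G : Type*} [TopologicalSpace G] [ChartedSpace F G] [Group G] [h : LieGroup 𝓘(ℝ, F) ∞ G] :
    LieGroup 𝓘(ℝ, F) (minSmoothness ℝ 3) G :=
  LieGroup.of_le (m := minSmoothness ℝ 3) (n := ∞) (by
    rw [minSmoothness_of_isRCLikeNormedField]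
    exact ENat.LEInfty.out)

/-! ### Right actions

A right action of `G` on `P` is an action of `Gᵐᵒᵖ`; `p <• g` is the result of acting by `g`
on `p`, so that `p <• (g * h) = (p <• g) <• h`. -/

section Actions

variable (G P : Type*) [Group G] [MulAction Gᵐᵒᵖ P]

variable {P} in
/-- The isotropy group `{g | p · g = p}` of a point, as a subgroup of `G`. -/
def isotropy (p : P) : Subgroup G := (MulAction.stabilizer Gᵐᵒᵖ p).unop

/-- The isotropy groups of any two points are conjugate, i.e. all orbits have the same type. -/
def HasSingleOrbitType : Prop :=
  ∀ p q : P, ∃ g : G, isotropy G q = (isotropy G p).map (MulAut.conj g).toMonoidHom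

/-- Preimages of compact sets under `(p, g) ↦ (p, p · g)` are compact. -/
def IsProperAction [TopologicalSpace G] [TopologicalSpace P] : Prop :=
  ∀ C : Set (P × P), IsCompact C → IsCompact ((fun x : P × G => (x.1, x.1 <• x.2)) ⁻¹' C)

/-- All isotropy groups are trivial. -/
def IsFreeAction : Prop := ∀ (p : P) (g : G), p <• g = p → g = 1

end Actions

section Manifolds

/- `E` and `F` are the model spaces of the manifold `P` and of the Lie group `G`. -/
variable {E : Type*} [NormedAddCommGroup E] [NormedSpace ℝ E]
  {F : Type*} [NormedAddCommGroup F] [NormedSpace ℝ F]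
  {G : Type*} [TopologicalSpace G] [ChartedSpace F G] [Group G]
  {P : Type*} [TopologicalSpace P] [ChartedSpace E P] [MulAction Gᵐᵒᵖ P]

variable (E F G P) in
/-- The action map `P × G → P` is smooth. -/
def IsSmoothAction : Prop :=
  ContMDiff (𝓘(ℝ, E).prod 𝓘(ℝ, F)) 𝓘(ℝ, E) ∞ (fun x : P × G => x.1 <• x.2)

variable (E) in
/-- The fundamental vector field of `ξ`: its value at `p` is the derivative of `g ↦ p · g`
at the identity in the direction `ξ`. -/
def fundamentalField (ξ : GroupLieAlgebra 𝓘(ℝ, F) G) (p : P) : TangentSpace 𝓘(ℝ, E) p :=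
  mfderiv 𝓘(ℝ, F) 𝓘(ℝ, E) (fun g : G => p <• g) 1 ξ

/-- The adjoint action of `g`: the derivative at the identity of `x ↦ g x g⁻¹`. -/
def Ad (g : G) : GroupLieAlgebra 𝓘(ℝ, F) G → GroupLieAlgebra 𝓘(ℝ, F) G :=
  fun ξ => mfderiv 𝓘(ℝ, F) 𝓘(ℝ, F) (fun x : G => g * x * g⁻¹) 1 ξ

variable (E) in
/-- The derivative at `p` of the right translation `q ↦ q · g`. -/
def rightTranslate (g : G) (p : P) (v : TangentSpace 𝓘(ℝ, E) p) :
    TangentSpace 𝓘(ℝ, E) (p <• g) :=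
  mfderiv 𝓘(ℝ, E) 𝓘(ℝ, E) (fun q : P => q <• g) p v

/-! ### Vector-valued one-forms -/

variable [IsManifold 𝓘(ℝ, E) ∞ P] {W : Type*} [NormedAddCommGroup W] [NormedSpace ℝ W]

/-- A `W`-valued one-form is smooth if it is smooth as a function on the tangent bundle. -/
def IsSmoothForm (θ : ∀ p : P, TangentSpace 𝓘(ℝ, E) p →L[ℝ] W) : Prop :=
  ContMDiff 𝓘(ℝ, E).tangent 𝓘(ℝ, W) ∞
    (fun x : TangentBundle 𝓘(ℝ, E) P => θ x.proj x.snd)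

/-- The Lie derivative of a one-form along a vector field `X`, evaluated on a vector field `Y`:
`(L_X θ)(Y) = X(θ(Y)) - θ([X, Y])`. -/
def lieDerivForm (X : ∀ p : P, TangentSpace 𝓘(ℝ, E) p)
    (θ : ∀ p : P, TangentSpace 𝓘(ℝ, E) p →L[ℝ] W)
    (Y : ∀ p : P, TangentSpace 𝓘(ℝ, E) p) (p : P) : W :=
  let dθY : TangentSpace 𝓘(ℝ, E) p →L[ℝ] W := mfderiv 𝓘(ℝ, E) 𝓘(ℝ, W) (fun q => θ q (Y q)) p
  dθY (X p) - θ p (VectorField.mlieBracket 𝓘(ℝ, E) X Y p)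

/-! ### Generalised Cartan connections

The Lie algebra `𝔤` of `G` is its tangent space at the identity, which Mathlib realises as the
model space `F`. The vector space underlying `𝔤 ⋉ ℝⁿ` is therefore `F × ℝⁿ` as a normed
space; forms with values in it are written with this type. -/

variable [FiniteDimensional ℝ F] [LieGroup 𝓘(ℝ, F) ∞ G] {n : ℕ}
  [LieRingModule (GroupLieAlgebra 𝓘(ℝ, F) G) (EuclideanSpace ℝ (Fin n))]

variable (G) in
/-- The bracket of the semidirect product `𝔤 ⋉ ℝⁿ` defined by a representation of `𝔤`
on `ℝⁿ`: `[(ξ, v), (η, w)] = ([ξ, η], ξ · w - η · v)`. -/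
def semidirectBracket (x y : F × EuclideanSpace ℝ (Fin n)) : F × EuclideanSpace ℝ (Fin n) :=
  let ξ : GroupLieAlgebra 𝓘(ℝ, F) G := x.1
  let η : GroupLieAlgebra 𝓘(ℝ, F) G := y.1
  let ξη : GroupLieAlgebra 𝓘(ℝ, F) G := ⁅ξ, η⁆
  (ξη, ⁅ξ, y.2⁆ - ⁅η, x.2⁆)

variable (G) in
/-- A `𝔤 ⋉ ℝⁿ`-valued generalised Cartan connection on the right `G`-manifold `P`. -/
structure IsGeneralisedCartanConnection
    (ϖ : ∀ p : P, TangentSpace 𝓘(ℝ, E) p →L[ℝ] (F × EuclideanSpace ℝ (Fin n))) : Prop where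
  smooth : IsSmoothForm ϖ
  nondegenerate : ∀ p : P, Function.Bijective (ϖ p)
  normalised : ∀ (ξ : F) (p : P), ϖ p (fundamentalField E (G := G) ξ p) = (ξ, 0)
  /-- `L_ξ̄ ϖ + ad_ξ ϖ = 0`, evaluated on smooth vector fields defined on open sets. -/
  equivariant : ∀ (ξ : F) (U : Set P)
    (Y : ∀ p : P, TangentSpace 𝓘(ℝ, E) p), IsOpen U →
    ContMDiffOn 𝓘(ℝ, E) 𝓘(ℝ, E).tangent ∞ (fun q => (⟨q, Y q⟩ : TangentBundle 𝓘(ℝ, E) P)) U →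
    ∀ p ∈ U, lieDerivForm (fundamentalField E (G := G) ξ) ϖ Y p
      + semidirectBracket G (ξ, 0) (ϖ p (Y p)) = 0

/-- The `𝔤`-component of a `𝔤 ⋉ ℝⁿ`-valued form. -/
def connectionPart (ϖ : ∀ p : P, TangentSpace 𝓘(ℝ, E) p →L[ℝ] (F × EuclideanSpace ℝ (Fin n))) :
    ∀ p : P, TangentSpace 𝓘(ℝ, E) p →L[ℝ] F :=
  fun p => (ContinuousLinearMap.fst ℝ F (EuclideanSpace ℝ (Fin n))).comp (ϖ p)

/-- The `ℝⁿ`-component of a `𝔤 ⋉ ℝⁿ`-valued form. -/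
def solderPart (ϖ : ∀ p : P, TangentSpace 𝓘(ℝ, E) p →L[ℝ] (F × EuclideanSpace ℝ (Fin n))) :
    ∀ p : P, TangentSpace 𝓘(ℝ, E) p →L[ℝ] EuclideanSpace ℝ (Fin n) :=
  fun p => (ContinuousLinearMap.snd ℝ F (EuclideanSpace ℝ (Fin n))).comp (ϖ p)

end Manifolds

/-! ### Principal bundles, solder forms, principal connections -/

section Bundles

variable {E : Type*} [NormedAddCommGroup E] [NormedSpace ℝ E]
  {F : Type*} [NormedAddCommGroup F] [NormedSpace ℝ F]
  {B : Type*} [NormedAddCommGroup B] [NormedSpace ℝ B]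
  (H : Type*) [TopologicalSpace H] [ChartedSpace F H] [Group H]
  {P : Type*} [TopologicalSpace P] [ChartedSpace E P] [IsManifold 𝓘(ℝ, E) ∞ P] [MulAction Hᵐᵒᵖ P]
  {M : Type*} [TopologicalSpace M] [ChartedSpace B M]

variable (E F B) in
/-- `π : P → M` is a smooth principal `H`-bundle for the given right action of the Lie group `H`
on `P`: the action and the projection are smooth, and `M` is covered by open sets `U` with an
`H`-equivariant diffeomorphism `π⁻¹(U) ≃ U × H` over `U`. -/
structure IsPrincipalBundle (π : P → M) : Prop where
  smooth_action : IsSmoothAction E F H P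
  smooth_proj : ContMDiff 𝓘(ℝ, E) 𝓘(ℝ, B) ∞ π
  invariant : ∀ (p : P) (h : H), π (p <• h) = π p
  locally_trivial : ∀ m : M, ∃ (U : Set M) (Φ : OpenPartialHomeomorph P (M × H)),
    IsOpen U ∧ m ∈ U ∧ Φ.source = π ⁻¹' U ∧ Φ.target = U ×ˢ Set.univ ∧
    ContMDiffOn 𝓘(ℝ, E) (𝓘(ℝ, B).prod 𝓘(ℝ, F)) ∞ Φ Φ.source ∧
    ContMDiffOn (𝓘(ℝ, B).prod 𝓘(ℝ, F)) 𝓘(ℝ, E) ∞ Φ.symm Φ.target ∧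
    (∀ p ∈ Φ.source, (Φ p).1 = π p) ∧
    (∀ p ∈ Φ.source, ∀ h : H, Φ (p <• h) = ((Φ p).1, (Φ p).2 * h))

variable {H} in
/-- `α` is a solder form on the principal `H`-bundle `π : P → M` for the representation `σ` of `H`:
a smooth form, whose kernel is the vertical tangent bundle, with `R_h^* α = σ(h)⁻¹ α`. -/
structure IsSolderForm {n : ℕ} (π : P → M)
    (σ : H →* (EuclideanSpace ℝ (Fin n) →L[ℝ] EuclideanSpace ℝ (Fin n)))
    (α : ∀ p : P, TangentSpace 𝓘(ℝ, E) p →L[ℝ] EuclideanSpace ℝ (Fin n)) : Prop where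
  smooth : IsSmoothForm α
  kernel : ∀ (p : P) (v : TangentSpace 𝓘(ℝ, E) p),
    α p v = 0 ↔ mfderiv 𝓘(ℝ, E) 𝓘(ℝ, B) π p v = 0
  equivariant : ∀ (h : H) (p : P) (v : TangentSpace 𝓘(ℝ, E) p),
    α (p <• h) (rightTranslate E h p v) = σ h⁻¹ (α p v)

/-- `θ` is a principal `H`-connection form: a smooth form with values in the Lie algebra of `H`
(realised as the model space `F`), normalised on the fundamental fields, with
`R_h^* θ = Ad_{h⁻¹} θ`. -/
structure IsPrincipalConnection
    (θ : ∀ p : P, TangentSpace 𝓘(ℝ, E) p →L[ℝ] F) : Prop where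
  smooth : IsSmoothForm θ
  normalised : ∀ (ξ : F) (p : P), θ p (fundamentalField E (G := H) ξ p) = ξ
  equivariant : ∀ (h : H) (p : P) (v : TangentSpace 𝓘(ℝ, E) p),
    θ (p <• h) (rightTranslate E h p v) = Ad (F := F) h⁻¹ (θ p v)

end Bundles

/-! ### The quotient group -/

section QuotientGroup

variable {F : Type*} [NormedAddCommGroup F] [NormedSpace ℝ F]
  {G : Type*} [TopologicalSpace G] [ChartedSpace F G] [Group G]

variable (F) in
/-- The derivative at the identity of the projection `G → G ⧸ K`, as a map from the Lie algebra of
`G` to that of `G ⧸ K`, both realised as the model space `F`. -/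
def lieQuotient (K : Subgroup G) [ChartedSpace F (G ⧸ K)] : F →L[ℝ] F :=
  mfderiv 𝓘(ℝ, F) 𝓘(ℝ, F) (QuotientGroup.mk : G → G ⧸ K) 1

/-- The derivative at the identity of a family of operators indexed by `G`. -/
def infinitesimalRep {V : Type*} [NormedAddCommGroup V] [NormedSpace ℝ V]
    (σ : G → V →L[ℝ] V) (ξ : GroupLieAlgebra 𝓘(ℝ, F) G) : V →L[ℝ] V :=
  mfderiv 𝓘(ℝ, F) 𝓘(ℝ, V →L[ℝ] V) σ 1 ξ

end QuotientGroup

end GenCartan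

end

/-! The form `ϖ` identifies every tangent space with `𝔤 ⋉ ℝⁿ` and sends `ξ̄` to `ξ`, so the action
is infinitesimally free: the tangent space at `p` splits into the orbit directions and an
`n`-dimensional horizontal complement (`bijective_coprod`). By the inverse function theorem an
affine slice in the complementary direction, moved by the group, is a local diffeomorphism near `(0,
1)`. Hence isotropy groups are discrete; properness makes them compact, so they are finite. When
they are normal, conjugacy means equality, and the common group `K` is a discrete normal subgroup:
charts of `G` descend to `G ⧸ K` (`exists_lieGroup_quotient`).

The induced action of `G ⧸ K` is free and still proper. Properness and freeness turn the local slice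
into a tube `V × (G ⧸ K) ≃ π⁻¹(U)` (`exists_slice`). The slice parameters are charts of the orbit
space, and the tubes are the local trivialisations (`exists_isPrincipalBundle_orbitSpace`).

For the equivariance of `ω` and `α`, right translation by `g` is read in the coframe `ϖ` as an
operator `A_p(g) = ϖ_{p·g} ∘ dR_g ∘ ϖ_p⁻¹` on `𝔤 ⋉ ℝⁿ` (`transport`). The chain rule gives the
cocycle identity `A_p(gh) = A_{p·g}(h) A_p(g)`. Its derivative at `g = 1` is the Lie derivative of
`ϖ` (`exists_mfderiv_pullbackForm_eq_lieDerivForm`), which the Cartan condition makes equal to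
`-ad_ξ`, whatever the point `p`. Thus every `A_p` solves one and the same linear equation along
left-invariant fields with `A_p(1) = 1`, and on a connected group the solution is unique
(`transport_eq`). So `A = A_p` does not depend on `p` and reverses products.

On `𝔤` the operator `A(g)` is `Ad_{g⁻¹}`, because right translations permute fundamental fields in
this way. The block from `ℝⁿ` to `𝔤` satisfies the same linear equation as the `𝔤`-block and
vanishes at `1`, hence everywhere (`fst_transport_inr`). The block on `ℝⁿ`, evaluated at `g⁻¹`, is a
representation with differential the given action of `𝔤`. It is trivial on `K`, which acts trivially
on `P`, and so descends to `σ`. -/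

noncomputable section

namespace GenCartan

/-! ### The inverse function theorem on manifolds -/

section InverseFunction

variable {E : Type*} [NormedAddCommGroup E] [NormedSpace ℝ E] [CompleteSpace E]
  {E' : Type*} [NormedAddCommGroup E'] [NormedSpace ℝ E'] [CompleteSpace E']
  {H : Type*} [TopologicalSpace H] {I : ModelWithCorners ℝ E H} [I.Boundaryless]
  {H' : Type*} [TopologicalSpace H'] {J : ModelWithCorners ℝ E' H'} [J.Boundaryless]
  {X : Type*} [TopologicalSpace X] [ChartedSpace H X]
  {Y : Type*} [TopologicalSpace Y] [ChartedSpace H' Y]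
  {n : WithTop ℕ∞}

variable (I) in
/-- The extended chart of a boundaryless manifold as an open partial homeomorphism. -/
def openExtChart (x : X) : OpenPartialHomeomorph X E :=
  (chartAt H x).transHomeomorph I.toHomeomorph

omit [CompleteSpace E] in
theorem openExtChart_target (x : X) : (openExtChart I x).target = (extChartAt I x).target := by
  rw [extChartAt_target, I.range_eq_univ, Set.inter_univ]; rfl

/-- The Banach-space inverse function theorem, applied to `f` read in charts. The inverse must be
smooth on a whole neighbourhood and not only at the image of `x`, so the neighbourhood is shrunk
until the derivative is invertible at each of its points. -/
theorem isLocalDiffeomorphAt_of_bijective_mfderiv [IsManifold I n X] [IsManifold J n Y]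
    {f : X → Y} {U : Set X} {x : X} (hU : IsOpen U) (hx : x ∈ U) (hf : ContMDiffOn I J n f U)
    (hn : n ≠ 0) (hb : Function.Bijective (mfderiv I J f x)) : IsLocalDiffeomorphAt I J n f x := by
  set φ : OpenPartialHomeomorph X E := openExtChart I x with hφ
  set ψ : OpenPartialHomeomorph Y E' := openExtChart J (f x) with hψ
  have hφs : ContMDiffOn 𝓘(ℝ, E) I n φ.symm φ.target := by
    rw [hφ, openExtChart_target]
    exact contMDiffOn_extChartAt_symm (I := I) (n := n) x
  have hφc : ContMDiffOn I 𝓘(ℝ, E) n φ φ.source := contMDiffOn_extChartAt (I := I) (n := n) (x := x)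
  have hψs : ContMDiffOn 𝓘(ℝ, E') J n ψ.symm ψ.target := by
    rw [hψ, openExtChart_target]
    exact contMDiffOn_extChartAt_symm (I := J) (n := n) (f x)
  have hψc : ContMDiffOn J 𝓘(ℝ, E') n ψ ψ.source :=
    contMDiffOn_extChartAt (I := J) (n := n) (x := f x)
  have hxφ : x ∈ φ.source := mem_chart_source H x
  have hfx : f x ∈ ψ.source := mem_chart_source H' (f x)
  have hfc : ∀ y ∈ U, ContMDiffAt I J n f y := fun y hy => hf.contMDiffAt (hU.mem_nhds hy)
  set ft : E → E' := ψ ∘ f ∘ φ.symm with hft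
  have hsmooth : ∀ z ∈ φ.target, φ.symm z ∈ U → f (φ.symm z) ∈ ψ.source →
      ContDiffAt ℝ n ft z := by
    intro z hz h1 h2
    rw [← contMDiffAt_iff_contDiffAt]
    exact (hψc.contMDiffAt (ψ.open_source.mem_nhds h2)).comp z
      ((hfc _ h1).comp z (hφs.contMDiffAt (φ.open_target.mem_nhds hz)))
  let L : E →L[ℝ] E' := mfderiv I J f x
  have hder : HasFDerivAt ft L (φ x) := by
    have : HasFDerivWithinAt ft L (Set.range I) (φ x) :=
      ((hfc x hx).mdifferentiableAt hn).hasMFDerivAt.2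
    rwa [I.range_eq_univ, hasFDerivWithinAt_univ] at this
  have ha : φ x ∈ φ.target := φ.map_source hxφ
  have hsa : φ.symm (φ x) = x := φ.left_inv hxφ
  have hca : ContDiffAt ℝ n ft (φ x) := hsmooth _ ha (by rwa [hsa]) (by rwa [hsa])
  have hLb : Function.Bijective L := hb
  let f' : E ≃L[ℝ] E' := ContinuousLinearEquiv.ofBijective L
    (LinearMap.ker_eq_bot.2 hLb.1) (LinearMap.range_eq_top.2 hLb.2)
  have hf'L : (f' : E →L[ℝ] E') = L := by ext v; rfl
  have hder' : HasFDerivAt ft (f' : E →L[ℝ] E') (φ x) := by rw [hf'L]; exact hder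
  set e := hca.toOpenPartialHomeomorph ft hder' hn with he
  have hev : ∀ᶠ z in 𝓝 (φ x), z ∈ e.source ∧ z ∈ φ.target ∧ φ.symm z ∈ U ∧
      f (φ.symm z) ∈ ψ.source ∧ ∃ A : E ≃L[ℝ] E', HasFDerivAt ft (A : E →L[ℝ] E') z := by
    have h1 : ∀ᶠ z in 𝓝 (φ x), z ∈ e.source :=
      e.open_source.mem_nhds (hca.mem_toOpenPartialHomeomorph_source hder' hn)
    have h2 : ∀ᶠ z in 𝓝 (φ x), z ∈ φ.target := φ.open_target.mem_nhds ha
    have h3 : Filter.Tendsto φ.symm (𝓝 (φ x)) (𝓝 x) := by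
      have := (φ.continuousAt_symm ha).tendsto
      rwa [hsa] at this
    have h4 := h3.eventually (hU.mem_nhds hx)
    have h5 := h3.eventually ((hfc x hx).continuousAt.eventually (ψ.open_source.mem_nhds hfx))
    -- Invertible operators form an open set and the derivative is continuous, so it remains
    -- invertible nearby.
    have h6 := (hca.continuousAt_fderiv hn).eventually
      (by rw [hder'.fderiv]; exact ContinuousLinearEquiv.nhds f')
    filter_upwards [h1, h2, h4, h5, h6] with z z1 z2 z4 z5 z6
    obtain ⟨A, hA⟩ := z6
    refine ⟨z1, z2, z4, z5, A, ?_⟩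
    rw [hA]
    exact ((hsmooth z z2 z4 z5).differentiableAt hn).hasFDerivAt
  obtain ⟨N, hN, hNo, hxN⟩ := mem_nhds_iff.1 hev
  let Φ := ((φ.trans e).trans ψ.symm).restrOpen _ (φ.isOpen_inter_preimage hNo)
  have hΦf : ∀ z ∈ Φ.source, z ∈ φ.source ∧ φ z ∈ N ∧ Φ z = f z := by
    intro z hz
    have hz1 : z ∈ φ.source ∩ φ ⁻¹' N := hz.2
    refine ⟨hz1.1, hz1.2, ?_⟩
    have h5 := (hN hz1.2).2.2.2.1
    change ψ.symm (ψ (f (φ.symm (φ z)))) = f z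
    rw [ψ.left_inv h5, φ.left_inv hz1.1]
  have hxs : x ∈ Φ.source := by
    refine ⟨⟨⟨hxφ, (hN hxN).1⟩, ?_⟩, hxφ, hxN⟩
    change ψ (f (φ.symm (φ x))) ∈ ψ.target
    exact ψ.map_source (by rwa [hsa])
  refine ⟨⟨Φ.toPartialEquiv, Φ.open_source, Φ.open_target, ?_, ?_⟩, hxs,
    fun z hz => ((hΦf z hz).2.2).symm⟩
  · intro z hz
    obtain ⟨z1, z2, z3⟩ := hΦf z hz
    have hzU : z ∈ U := by
      have := (hN z2).2.2.1
      rwa [φ.left_inv z1] at this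
    exact (hf z hzU).mono_of_mem_nhdsWithin
      (mem_nhdsWithin_of_mem_nhds (hU.mem_nhds hzU)) |>.congr
      (fun y hy => (hΦf y hy).2.2) z3
  · intro y hy
    have hyt : y ∈ Φ.target := hy
    obtain ⟨z, hz, rfl⟩ : ∃ z ∈ Φ.source, Φ z = y := ⟨Φ.symm y, Φ.map_target hyt, Φ.right_inv hyt⟩
    obtain ⟨z1, z2, z3⟩ := hΦf z hz
    obtain ⟨w1, w2, w3, w4, A, hA⟩ := hN z2
    have hfz : f z ∈ ψ.source := by rwa [φ.left_inv z1] at w4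
    have e1 : ψ (f z) = e (φ z) := by
      change _ = ψ (f (φ.symm (φ z)))
      rw [φ.left_inv z1]
    refine ContMDiffAt.contMDiffWithinAt ?_
    change ContMDiffAt J I n (φ.symm ∘ e.symm ∘ ψ) (Φ z)
    rw [z3]
    have e2 : e.symm (ψ (f z)) = φ z := by rw [e1, e.left_inv w1]
    -- The inverse is smooth at each point where the derivative is the equivalence `A`; this is why
    -- `A` was recorded at every `z`.
    have k1 : ContDiffAt ℝ n e.symm (ψ (f z)) := by
      refine e.contDiffAt_symm (f₀' := A) (by rw [e1]; exact e.map_source w1) ?_ ?_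
      · rw [e2]; exact hA
      · rw [e2]; exact hsmooth _ w2 w3 w4
    refine ContMDiffAt.comp (I' := 𝓘(ℝ, E)) (f z) ?_ (k1.contMDiffAt.comp (f z)
      (hψc.contMDiffAt (ψ.open_source.mem_nhds hfz)))
    change ContMDiffAt _ _ _ _ (e.symm (ψ (f z)))
    rw [e2]
    exact hφs.contMDiffAt (φ.open_target.mem_nhds w2)

omit [CompleteSpace E] [CompleteSpace E'] [I.Boundaryless] [J.Boundaryless] in
/-- An injective local diffeomorphism on an open set is a diffeomorphism onto its image. -/
theorem exists_openPartialHomeomorph_of_injOn [Nonempty X] {f : X → Y} {S : Set X} (hS : IsOpen S)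
    (hf : IsLocalDiffeomorphOn I J n f S) (hinj : Set.InjOn f S) :
    ∃ Φ : OpenPartialHomeomorph X Y, Φ.source = S ∧ (∀ x, Φ x = f x) ∧ Φ.target = f '' S ∧
      ContMDiffOn I J n Φ Φ.source ∧ ContMDiffOn J I n Φ.symm Φ.target := by
  -- Openness is local, and near each point `f` agrees with a local homeomorphism; with injectivity
  -- this gives a continuous global inverse on the image.
  have hopen : ∀ T ⊆ S, IsOpen T → IsOpen (f '' T) := by
    intro T hTS hT
    rw [isOpen_iff_mem_nhds]
    rintro _ ⟨x, hx, rfl⟩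
    obtain ⟨Ψ, hxΨ, hΨ⟩ := hf ⟨x, hTS hx⟩
    have h1 : IsOpen (Ψ.toOpenPartialHomeomorph '' (Ψ.source ∩ T)) :=
      Ψ.toOpenPartialHomeomorph.isOpen_image_of_subset_source
        (Ψ.open_source.inter hT) Set.inter_subset_left
    refine Filter.mem_of_superset (h1.mem_nhds ⟨x, ⟨hxΨ, hx⟩, (hΨ hxΨ).symm⟩) ?_
    rintro _ ⟨y, ⟨hy1, hy2⟩, rfl⟩
    exact ⟨y, hy2, hΨ hy1⟩
  have hcont : ContMDiffOn I J n f S := hf.contMDiffOn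
  let Φ : OpenPartialHomeomorph X Y := OpenPartialHomeomorph.ofContinuousOpenRestrict
    (hinj.toPartialEquiv f S) hcont.continuousOn (by
      intro T hT
      have h2 : IsOpen ((↑) '' T : Set X) := hS.isOpenMap_subtype_val T hT
      have := hopen _ (by rintro _ ⟨y, -, rfl⟩; exact y.2) h2
      rw [Set.image_image] at this
      exact this) hS
  refine ⟨Φ, rfl, fun _ => rfl, rfl, hcont, ?_⟩
  rintro _ ⟨x, hx, rfl⟩
  obtain ⟨Ψ, hxΨ, hΨ⟩ := hf ⟨x, hx⟩
  have h1 : IsOpen (Ψ.toOpenPartialHomeomorph '' (Ψ.source ∩ S)) :=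
      Ψ.toOpenPartialHomeomorph.isOpen_image_of_subset_source
        (Ψ.open_source.inter hS) Set.inter_subset_left
  have hmem : f x ∈ Ψ.toOpenPartialHomeomorph '' (Ψ.source ∩ S) :=
    ⟨x, ⟨hxΨ, hx⟩, (hΨ hxΨ).symm⟩
  have hfx : f x ∈ Ψ.target := by rw [hΨ hxΨ]; exact Ψ.map_source hxΨ
  refine ContMDiffAt.contMDiffWithinAt ?_
  refine ((Ψ.contMDiffOn_invFun).contMDiffAt (Ψ.open_target.mem_nhds hfx)).congr_of_eventuallyEq ?_
  filter_upwards [h1.mem_nhds hmem]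
  rintro _ ⟨y, ⟨hy1, hy2⟩, rfl⟩
  have e1 : Ψ.toOpenPartialHomeomorph y = f y := (hΨ hy1).symm
  have e2 : Φ.symm (f y) = y := Φ.left_inv (x := y) hy2
  have e3 : Ψ.invFun (Ψ.toOpenPartialHomeomorph y) = y := Ψ.left_inv hy1
  rw [e3, e1]; exact e2

end InverseFunction

/-! ### Manifold structures on quotients admitting smooth local sections -/

section SectionCharts

variable {E : Type*} [NormedAddCommGroup E] [NormedSpace ℝ E]
  {B : Type*} [NormedAddCommGroup B] [NormedSpace ℝ B]
  {X : Type*} [TopologicalSpace X] [ChartedSpace E X]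
  {Q : Type*} [TopologicalSpace Q]

variable (E B) in
/-- A chart of the target of `π : X → Q` which is smooth when composed with `π`, and whose inverse
lifts to a smooth map into `X`. -/
structure SectionChart (π : X → Q) where
  /-- the chart -/
  chart : OpenPartialHomeomorph Q B
  /-- the lift to `X` of the inverse of the chart -/
  sec : B → X
  proj_sec : ∀ b ∈ chart.target, π (sec b) = chart.symm b
  smooth_sec : ContMDiffOn 𝓘(ℝ, B) 𝓘(ℝ, E) ∞ sec chart.target
  smooth_chart : ContMDiffOn 𝓘(ℝ, E) 𝓘(ℝ, B) ∞ (chart ∘ π) (π ⁻¹' chart.source)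

/-- If `π : X → Q` has section charts around all points of `Q`, then they form a smooth atlas. -/
theorem exists_isManifold_of_sectionCharts {π : X → Q} (hπ : Continuous π)
    (hC : ∀ q, ∃ c : SectionChart E B π, q ∈ c.chart.source) :
    ∃ _ : ChartedSpace B Q, IsManifold 𝓘(ℝ, B) ∞ Q ∧ ContMDiff 𝓘(ℝ, E) 𝓘(ℝ, B) ∞ π ∧
      ∀ c : SectionChart E B π, ContMDiffOn 𝓘(ℝ, B) 𝓘(ℝ, B) ∞ c.chart c.chart.source ∧
        ContMDiffOn 𝓘(ℝ, B) 𝓘(ℝ, B) ∞ c.chart.symm c.chart.target := by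
  choose C hC using hC
  -- A change of charts is `c'.chart ∘ π ∘ c.sec`: it passes through `X`, where smoothness already
  -- has a meaning.
  have htrans : ∀ c c' : SectionChart E B π,
      ContMDiffOn 𝓘(ℝ, B) 𝓘(ℝ, B) ∞ (c.chart.symm ≫ₕ c'.chart)
        (c.chart.symm ≫ₕ c'.chart).source := by
    intro c c'
    have h1 : (c.chart.symm ≫ₕ c'.chart).source ⊆ c.chart.target := fun z hz => hz.1
    have h2 : ContMDiffOn 𝓘(ℝ, B) 𝓘(ℝ, B) ∞ ((c'.chart ∘ π) ∘ c.sec)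
        (c.chart.symm ≫ₕ c'.chart).source := by
      refine c'.smooth_chart.comp (c.smooth_sec.mono h1) ?_
      intro z hz
      change π (c.sec z) ∈ c'.chart.source
      rw [c.proj_sec z hz.1]
      exact hz.2
    refine h2.congr fun z hz => ?_
    change c'.chart (c.chart.symm z) = c'.chart (π (c.sec z))
    rw [c.proj_sec z hz.1]
  let cs : ChartedSpace B Q :=
    { atlas := Set.range fun q => (C q).chart
      chartAt := fun q => (C q).chart
      mem_chart_source := hC
      chart_mem_atlas := fun q => ⟨q, rfl⟩ }
  have hM : IsManifold 𝓘(ℝ, B) ∞ Q := by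
    apply isManifold_of_contDiffOn
    rintro _ _ ⟨q, rfl⟩ ⟨q', rfl⟩
    have := htrans (C q) (C q')
    rw [contMDiffOn_iff_contDiffOn] at this
    simpa using this
  -- The atlas uses one chosen chart per point, but all section charts are compatible with it. Later
  -- arguments can therefore use charts adapted to a slice.
  have hchart : ∀ c : SectionChart E B π, c.chart ∈ IsManifold.maximalAtlas 𝓘(ℝ, B) ∞ Q := by
    intro c
    rw [IsManifold.mem_maximalAtlas_iff, mem_maximalAtlas_iff]
    rintro _ ⟨q, rfl⟩
    constructor
    · rw [contDiffGroupoid, mem_groupoid_of_pregroupoid]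
      have h1 := htrans c (C q)
      have h2 := htrans (C q) c
      rw [contMDiffOn_iff_contDiffOn] at h1 h2
      exact ⟨by simpa [contDiffPregroupoid] using h1, by simpa [contDiffPregroupoid] using h2⟩
    · rw [contDiffGroupoid, mem_groupoid_of_pregroupoid]
      have h1 := htrans c (C q)
      have h2 := htrans (C q) c
      rw [contMDiffOn_iff_contDiffOn] at h1 h2
      exact ⟨by simpa [contDiffPregroupoid] using h2, by simpa [contDiffPregroupoid] using h1⟩
  refine ⟨cs, hM, ?_, fun c => ⟨contMDiffOn_of_mem_maximalAtlas (hchart c),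
    contMDiffOn_symm_of_mem_maximalAtlas (hchart c)⟩⟩
  intro x
  have hx : π x ∈ (C (π x)).chart.source := hC (π x)
  have hopen : IsOpen (π ⁻¹' (C (π x)).chart.source) := (C (π x)).chart.open_source.preimage hπ
  have h1 := contMDiffOn_symm_of_mem_maximalAtlas (hchart (C (π x)))
  have h2 : ContMDiffAt 𝓘(ℝ, E) 𝓘(ℝ, B) ∞ ((C (π x)).chart.symm ∘ (C (π x)).chart ∘ π) x :=
    (h1.contMDiffAt ((C (π x)).chart.open_target.mem_nhds ((C (π x)).chart.map_source hx))).comp x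
      ((C (π x)).smooth_chart.contMDiffAt (hopen.mem_nhds hx))
  refine h2.congr_of_eventuallyEq ?_
  filter_upwards [hopen.mem_nhds hx] with y hy
  exact ((C (π x)).chart.left_inv hy).symm

/-- A section chart gives a smooth local section of `π`. -/
theorem SectionChart.contMDiffOn_section [ChartedSpace B Q] {π : X → Q} (c : SectionChart E B π)
    (hc : ContMDiffOn 𝓘(ℝ, B) 𝓘(ℝ, B) ∞ c.chart c.chart.source) :
    ContMDiffOn 𝓘(ℝ, B) 𝓘(ℝ, E) ∞ (c.sec ∘ c.chart) c.chart.source :=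
  c.smooth_sec.comp hc fun _ hz => c.chart.map_source hz

theorem SectionChart.proj_section {π : X → Q} (c : SectionChart E B π) {q : Q}
    (hq : q ∈ c.chart.source) : π (c.sec (c.chart q)) = q := by
  rw [c.proj_sec _ (c.chart.map_source hq), c.chart.left_inv hq]

end SectionCharts

/-! ### The quotient of a Lie group by a discrete normal subgroup -/

section QuotientLieGroup

variable {F : Type*} [NormedAddCommGroup F] [NormedSpace ℝ F]
  {G : Type*} [TopologicalSpace G] [ChartedSpace F G] [Group G] [LieGroup 𝓘(ℝ, F) ∞ G]

-- Around `g` there is an open `W` with `W⁻¹W ∩ K = {1}`, on which the projection is injective. A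
-- chart of `G` on `W` is then a chart of the quotient.
variable (F) in
theorem exists_sectionChart_quotientMk {K : Subgroup G}
    (hK : ∃ U ∈ 𝓝 (1 : G), ∀ k ∈ K, k ∈ U → k = 1) (g : G) :
    ∃ (e : OpenPartialHomeomorph G (G ⧸ K))
      (c : SectionChart F F (QuotientGroup.mk : G → G ⧸ K)), g ∈ e.source ∧
      (∀ x, e x = QuotientGroup.mk x) ∧ c.chart.source = e.target ∧
      ∀ y ∈ e.target, c.sec (c.chart y) = e.symm y := by
  have : IsTopologicalGroup G := topologicalGroup_of_lieGroup 𝓘(ℝ, F) ∞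
  obtain ⟨U, hU, hKU⟩ := hK
  have hnhds : ∀ᶠ x : G × G in 𝓝 (g, g), x.1⁻¹ * x.2 ∈ U := by
    have : Filter.Tendsto (fun x : G × G => x.1⁻¹ * x.2) (𝓝 (g, g)) (𝓝 1) := by
      have h : Continuous (fun x : G × G => x.1⁻¹ * x.2) := by fun_prop
      simpa using h.tendsto (g, g)
    exact this.eventually hU
  rw [nhds_prod_eq] at hnhds
  obtain ⟨T, hT, hTU⟩ := Filter.eventually_prod_self_iff'.1 hnhds
  obtain ⟨W, hWT, hWo, hgW⟩ := mem_nhds_iff.1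
    (Filter.inter_mem hT ((chartAt F g).open_source.mem_nhds (mem_chart_source F g)))
  have hinj : Set.InjOn (QuotientGroup.mk : G → G ⧸ K) W := by
    intro x hx y hy hxy
    have h1 : x⁻¹ * y ∈ K := QuotientGroup.eq.1 hxy
    have h2 := hKU _ h1 (hTU x (hWT hx).1 y (hWT hy).1)
    exact (inv_mul_eq_one.1 h2)
  let e : OpenPartialHomeomorph G (G ⧸ K) := OpenPartialHomeomorph.ofContinuousOpenRestrict
    (hinj.toPartialEquiv _ W) QuotientGroup.continuous_mk.continuousOn
    ((QuotientGroup.isOpenMap_coe (N := K)).domRestrict hWo) hWo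
  have hes : e.source = W := rfl
  have hemk : ∀ x, e x = QuotientGroup.mk x := fun _ => rfl
  let φ := chartAt F g
  have hsub : W ⊆ φ.source := fun x hx => (hWT hx).2
  have hsource : (e.symm ≫ₕ φ).source = e.target := by
    ext y
    simp only [OpenPartialHomeomorph.trans_source, OpenPartialHomeomorph.symm_source,
      Set.mem_inter_iff, Set.mem_preimage,
      and_iff_left_iff_imp]
    intro hy
    exact hsub (e.map_target hy)
  refine ⟨e, ⟨e.symm ≫ₕ φ, φ.symm, fun b _ => rfl, ?_, ?_⟩, hgW, hemk, hsource, ?_⟩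
  · exact (contMDiffOn_chart_symm (I := 𝓘(ℝ, F)) (n := ∞) (x := g)).mono fun z hz => hz.1
  · rw [hsource]
    intro x hx
    refine ContMDiffAt.contMDiffWithinAt ?_
    -- The point `x` lies in the saturation of `W`, perhaps not in `W` itself; `w` is the
    -- representative of its coset in `W`. Near `x`, the projection followed by the new chart is
    -- right translation by `x⁻¹ * w ∈ K` followed by `φ`.
    set w := e.symm (QuotientGroup.mk x) with hw
    have hwW : w ∈ W := e.map_target hx
    have hxw : x⁻¹ * w ∈ K := QuotientGroup.eq.1 (e.right_inv hx).symm
    have hsm : ContMDiffAt 𝓘(ℝ, F) 𝓘(ℝ, F) ∞ (φ ∘ fun y : G => y * (x⁻¹ * w)) x := by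
      refine ContMDiffAt.comp x ?_ (contMDiff_mul_right.contMDiffAt)
      rw [mul_inv_cancel_left]
      exact (contMDiffOn_chart (I := 𝓘(ℝ, F)) (n := ∞) (x := g)).contMDiffAt
        (φ.open_source.mem_nhds (hsub hwW))
    refine hsm.congr_of_eventuallyEq ?_
    have hev : ∀ᶠ y in 𝓝 x, y * (x⁻¹ * w) ∈ W := by
      have : ContinuousAt (fun y : G => y * (x⁻¹ * w)) x := by fun_prop
      exact this.eventually (hWo.mem_nhds (by simpa using hwW))
    filter_upwards [hev] with y hy
    have : (QuotientGroup.mk y : G ⧸ K) = e (y * (x⁻¹ * w)) := by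
      rw [hemk, QuotientGroup.mk_mul_of_mem _ hxw]
    change φ (e.symm (QuotientGroup.mk y)) = _
    rw [this, e.left_inv hy]; rfl
  · intro y hy
    exact φ.left_inv (hsub (e.map_target hy))

/-- The quotient of a Lie group by a discrete normal subgroup is a Lie group, and the projection
is a local diffeomorphism. -/
theorem exists_lieGroup_quotient {K : Subgroup G} [K.Normal]
    (hK : ∃ U ∈ 𝓝 (1 : G), ∀ k ∈ K, k ∈ U → k = 1) :
    ∃ _ : ChartedSpace F (G ⧸ K), LieGroup 𝓘(ℝ, F) ∞ (G ⧸ K) ∧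
      IsLocalDiffeomorph 𝓘(ℝ, F) 𝓘(ℝ, F) ∞ (QuotientGroup.mk : G → G ⧸ K) := by
  have : IsTopologicalGroup G := topologicalGroup_of_lieGroup 𝓘(ℝ, F) ∞
  choose e c hge he hce hsec using exists_sectionChart_quotientMk F hK
  have hcov : ∀ q : G ⧸ K, ∃ c : SectionChart F F (QuotientGroup.mk : G → G ⧸ K),
      q ∈ c.chart.source := by
    intro q
    obtain ⟨g, rfl⟩ := QuotientGroup.mk_surjective q
    refine ⟨c g, ?_⟩
    rw [hce, ← he g]
    exact (e g).map_source (hge g)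
  obtain ⟨cs, hM, hmk, hcharts⟩ :=
    exists_isManifold_of_sectionCharts QuotientGroup.continuous_mk hcov
  choose d hd using hcov
  have hsmd : ∀ q : G ⧸ K,
      ContMDiffAt 𝓘(ℝ, F) 𝓘(ℝ, F) ∞ ((d q).sec ∘ (d q).chart) q := fun q =>
    ((d q).contMDiffOn_section (hcharts _).1).contMDiffAt ((d q).chart.open_source.mem_nhds (hd q))
  have hev : ∀ q : G ⧸ K, ∀ᶠ y in 𝓝 q,
      QuotientGroup.mk ((d q).sec ((d q).chart y)) = y := fun q => by
    filter_upwards [(d q).chart.open_source.mem_nhds (hd q)] with y hy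
    exact (d q).proj_section hy
  -- Group operations are computed by lifting to `G` with smooth local sections, operating there and
  -- projecting.
  refine ⟨cs, { hM with contMDiff_mul := ?_, contMDiff_inv := ?_ }, ?_⟩
  · rintro ⟨a, b⟩
    have h1 : ContMDiffAt (𝓘(ℝ, F).prod 𝓘(ℝ, F)) 𝓘(ℝ, F) ∞
        (fun x : (G ⧸ K) × (G ⧸ K) => (d a).sec ((d a).chart x.1)) (a, b) :=
      ContMDiffAt.comp (g := (d a).sec ∘ (d a).chart) (a, b) (hsmd a) contMDiffAt_fst
    have h2 : ContMDiffAt (𝓘(ℝ, F).prod 𝓘(ℝ, F)) 𝓘(ℝ, F) ∞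
        (fun x : (G ⧸ K) × (G ⧸ K) => (d b).sec ((d b).chart x.2)) (a, b) :=
      ContMDiffAt.comp (g := (d b).sec ∘ (d b).chart) (a, b) (hsmd b) contMDiffAt_snd
    refine (hmk.contMDiffAt.comp (a, b) (h1.mul h2)).congr_of_eventuallyEq ?_
    filter_upwards [(hev a).prod_inl_nhds b, (hev b).prod_inr_nhds a] with x hx hy
    change _ = (QuotientGroup.mk (_ * _) : G ⧸ K)
    rw [QuotientGroup.mk_mul, hx, hy]
  · intro a
    refine (hmk.contMDiffAt.comp a (hsmd a).inv).congr_of_eventuallyEq ?_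
    filter_upwards [hev a] with x hx
    change _ = (QuotientGroup.mk (_)⁻¹ : G ⧸ K)
    rw [QuotientGroup.mk_inv, Function.comp_apply, hx]
  · intro g
    refine ⟨⟨(e g).toPartialEquiv, (e g).open_source, (e g).open_target, ?_, ?_⟩, hge g,
      fun x _ => (he g x).symm⟩
    · exact hmk.contMDiffOn.congr fun x _ => he g x
    · have := (c g).contMDiffOn_section (hcharts _).1
      rw [hce] at this
      exact this.congr fun y hy => (hsec g y hy).symm

end QuotientLieGroup

/-! ### Slices of smooth actions -/

section Slices

variable {E : Type*} [NormedAddCommGroup E] [NormedSpace ℝ E]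
  {F : Type*} [NormedAddCommGroup F] [NormedSpace ℝ F]
  {B : Type*} [NormedAddCommGroup B] [NormedSpace ℝ B]
  {G : Type*} [TopologicalSpace G] [ChartedSpace F G] [Group G]
  {P : Type*} [TopologicalSpace P] [ChartedSpace E P]

/-- The affine slice through `p` in the direction of `L`, in the preferred chart at `p`. -/
def sliceMap (p : P) (L : B →L[ℝ] E) (b : B) : P :=
  (chartAt E p).symm (chartAt E p p + L b)

/-- The open set of parameters for which the affine slice stays in the chart. -/
def sliceDomain (p : P) (L : B →L[ℝ] E) : Set B :=
  {b | chartAt E p p + L b ∈ (chartAt E p).target}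

theorem isOpen_sliceDomain (p : P) (L : B →L[ℝ] E) : IsOpen (sliceDomain p L) :=
  (chartAt E p).open_target.preimage (by fun_prop)

theorem sliceMap_zero (p : P) (L : B →L[ℝ] E) : sliceMap p L 0 = p := by
  simp [sliceMap]

theorem zero_mem_sliceDomain (p : P) (L : B →L[ℝ] E) : (0 : B) ∈ sliceDomain p L := by
  simp [sliceDomain]

variable [IsManifold 𝓘(ℝ, E) ∞ P]

theorem contMDiffOn_sliceMap (p : P) (L : B →L[ℝ] E) :
    ContMDiffOn 𝓘(ℝ, B) 𝓘(ℝ, E) ∞ (sliceMap p L) (sliceDomain p L) := by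
  refine (contMDiffOn_chart_symm (I := 𝓘(ℝ, E)) (n := ∞) (x := p)).comp
    (t := (chartAt E p).target) ?_ fun b hb => hb
  have : ContDiff ℝ ∞ fun b : B => chartAt E p p + L b := by fun_prop
  exact this.contMDiff.contMDiffOn

/-- The tangent space at `p` is identified with `E` by the preferred chart at `p`, the very chart in
which the slice is affine with linear part `L`. -/
theorem hasMFDerivAt_sliceMap (p : P) (L : B →L[ℝ] E) :
    HasMFDerivAt 𝓘(ℝ, B) 𝓘(ℝ, E) (sliceMap p L) 0 L := by
  refine ⟨((contMDiffOn_sliceMap p L).contMDiffAt ((isOpen_sliceDomain p L).mem_nhds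
    (zero_mem_sliceDomain p L))).continuousAt, ?_⟩
  change HasFDerivWithinAt (𝕜 := ℝ) (E := B) (F := E)
    (extChartAt 𝓘(ℝ, E) (sliceMap p L 0) ∘ sliceMap p L) L (Set.range id) 0
  rw [sliceMap_zero, Set.range_id, hasFDerivWithinAt_univ]
  have h : HasFDerivAt (fun b : B => chartAt E p p + L b) L 0 :=
    L.hasFDerivAt.const_add _
  refine h.congr_of_eventuallyEq ?_
  filter_upwards [(isOpen_sliceDomain p L).mem_nhds (zero_mem_sliceDomain p L)] with b hb
  exact (chartAt E p).right_inv hb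

variable [MulAction Gᵐᵒᵖ P]

variable (E F G) in
/-- The derivative at the identity of the orbit map `g ↦ p · g`. -/
def orbitDeriv (p : P) : F →L[ℝ] E :=
  mfderiv 𝓘(ℝ, F) 𝓘(ℝ, E) (fun g : G => p <• g) 1

theorem contMDiffOn_slice_smul (h_smooth : IsSmoothAction E F G P) (p : P) (L : B →L[ℝ] E) :
    ContMDiffOn (𝓘(ℝ, B).prod 𝓘(ℝ, F)) 𝓘(ℝ, E) ∞
      (fun x : B × G => sliceMap p L x.1 <• x.2) (sliceDomain p L ×ˢ Set.univ) := by
  have h1 : ContMDiffOn (𝓘(ℝ, B).prod 𝓘(ℝ, F)) (𝓘(ℝ, E).prod 𝓘(ℝ, F)) ∞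
      (fun x : B × G => (sliceMap p L x.1, x.2)) (sliceDomain p L ×ˢ Set.univ) :=
    ((contMDiffOn_sliceMap p L).comp contMDiffOn_fst fun x hx => hx.1).prodMk contMDiffOn_snd
  exact ContMDiff.comp_contMDiffOn (g := fun x : P × G => x.1 <• x.2) h_smooth h1

variable [LieGroup 𝓘(ℝ, F) ∞ G] [CompleteSpace E] [CompleteSpace F] [CompleteSpace B]

/-- The partial derivatives at `(0, 1)` are `L` and the orbit derivative, so `hL` is the hypothesis
of the inverse function theorem. -/
theorem isLocalDiffeomorphAt_slice (h_smooth : IsSmoothAction E F G P) (p : P) (L : B →L[ℝ] E)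
    (hL : Function.Bijective (L.coprod (orbitDeriv E F G p))) :
    IsLocalDiffeomorphAt (𝓘(ℝ, B).prod 𝓘(ℝ, F)) 𝓘(ℝ, E) ∞
      (fun x : B × G => sliceMap p L x.1 <• x.2) (0, 1) := by
  have hopen : IsOpen (sliceDomain p L ×ˢ (Set.univ : Set G)) :=
    (isOpen_sliceDomain p L).prod isOpen_univ
  have hmem : ((0 : B), (1 : G)) ∈ sliceDomain p L ×ˢ (Set.univ : Set G) :=
    ⟨zero_mem_sliceDomain p L, trivial⟩
  have hsm := contMDiffOn_slice_smul (G := G) h_smooth p L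
  refine isLocalDiffeomorphAt_of_bijective_mfderiv hopen hmem hsm (by simp) ?_
  have hd : MDifferentiableAt (𝓘(ℝ, B).prod 𝓘(ℝ, F)) 𝓘(ℝ, E)
      (fun x : B × G => sliceMap p L x.1 <• x.2) (0, 1) :=
    (hsm.contMDiffAt (hopen.mem_nhds hmem)).mdifferentiableAt (by simp)
  have e1 : mfderiv 𝓘(ℝ, B) 𝓘(ℝ, E) (fun z : B => sliceMap p L z <• (1 : G)) 0 = L := by
    have : (fun z : B => sliceMap p L z <• (1 : G)) = sliceMap p L := by
      funext z; simp
    rw [this]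
    exact (hasMFDerivAt_sliceMap p L).mfderiv
  have e2 : mfderiv 𝓘(ℝ, F) 𝓘(ℝ, E) (fun z : G => sliceMap p L 0 <• z) 1 = orbitDeriv E F G p := by
    rw [sliceMap_zero]; rfl
  have e3 : (mfderiv (𝓘(ℝ, B).prod 𝓘(ℝ, F)) 𝓘(ℝ, E)
      (fun x : B × G => sliceMap p L x.1 <• x.2) (0, 1) : B × F → E) =
      L.coprod (orbitDeriv E F G p) := by
    funext v
    refine (mfderiv_prod_eq_add_apply hd).trans ?_
    exact congrArg₂ (· + ·) (congrArg (fun A : B →L[ℝ] E => A v.1) e1)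
      (congrArg (fun A : F →L[ℝ] E => A v.2) e2)
  exact e3 ▸ hL

/-- Where the action is infinitesimally free, isotropy groups are discrete. -/
theorem exists_nhds_one_isotropy_trivial (h_smooth : IsSmoothAction E F G P) (p : P)
    (L : B →L[ℝ] E) (hL : Function.Bijective (L.coprod (orbitDeriv E F G p))) :
    ∃ U ∈ 𝓝 (1 : G), ∀ g : G, p <• g = p → g ∈ U → g = 1 := by
  obtain ⟨Ψ, hmem, hΨ⟩ := isLocalDiffeomorphAt_slice (G := G) h_smooth p L hL
  refine ⟨{g | ((0 : B), g) ∈ Ψ.source}, ?_, ?_⟩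
  · exact (Ψ.open_source.preimage (by fun_prop)).mem_nhds hmem
  · intro g hg hgU
    -- Both sides are `p`, and local injectivity of the slice map then separates `g` from `1`.
    have h1 : Ψ (0, g) = Ψ (0, 1) := by
      rw [← hΨ hgU, ← hΨ hmem]
      simp [sliceMap_zero, hg]
    exact congrArg Prod.snd (Ψ.injOn hgU hmem h1)

end Slices

/-! ### Consequences of properness near an isotropy group. -/

section ProperActions

/-- For a proper action, group elements that move a point near `p` to a point near `p` are close to
the isotropy group of `p`. -/
theorem IsProperAction.eventually_mem {G P : Type*} [Group G] [TopologicalSpace G]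
    [TopologicalSpace P] [MulAction Gᵐᵒᵖ P] [T2Space P] [LocallyCompactSpace P]
    (h_proper : IsProperAction G P) (hc : Continuous fun x : P × G => x.1 <• x.2) {p : P}
    {U : Set G} (hU : IsOpen U) (hp : ∀ g : G, p <• g = p → g ∈ U) :
    ∀ᶠ x : P × P in 𝓝 (p, p), ∀ g : G, x.2 = x.1 <• g → g ∈ U := by
  obtain ⟨C, hC, hCp⟩ := exists_compact_mem_nhds (p, p)
  have hc2 : Continuous fun x : P × G => (x.1, x.1 <• x.2) := continuous_fst.prodMk hc
  -- The pairs `(q, q · g)` in `C` with `g ∉ U` form a compact, hence closed, set missing `(p, p)`;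
  -- its complement in `C` is the required neighbourhood.
  have h1 : IsCompact (((fun x : P × G => (x.1, x.1 <• x.2)) ⁻¹' C) \ (Prod.snd ⁻¹' U)) :=
    (h_proper C hC).diff (hU.preimage continuous_snd)
  have h2 := (h1.image hc2).isClosed.isOpen_compl
  have h3 : (p, p) ∈ ((fun x : P × G => (x.1, x.1 <• x.2)) ''
      (((fun x : P × G => (x.1, x.1 <• x.2)) ⁻¹' C) \ (Prod.snd ⁻¹' U)))ᶜ := by
    rintro ⟨⟨q, g⟩, ⟨-, hg⟩, hq⟩
    simp only [Prod.mk.injEq] at hq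
    obtain ⟨rfl, hq⟩ := hq
    exact hg (hp g hq)
  filter_upwards [hCp, h2.mem_nhds h3] with x hxC hx g hg
  by_contra hgU
  refine hx ⟨(x.1, g), ⟨?_, hgU⟩, ?_⟩
  · change (x.1, x.1 <• g) ∈ C
    rwa [← hg]
  · change (x.1, x.1 <• g) = x
    rw [← hg]

end ProperActions

/-! ### Tubes around orbits of free proper actions. -/

section Slices

variable {E : Type*} [NormedAddCommGroup E] [NormedSpace ℝ E]
  {F : Type*} [NormedAddCommGroup F] [NormedSpace ℝ F]
  {B : Type*} [NormedAddCommGroup B] [NormedSpace ℝ B]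
  {G : Type*} [TopologicalSpace G] [ChartedSpace F G] [Group G]
  {P : Type*} [TopologicalSpace P] [ChartedSpace E P] [MulAction Gᵐᵒᵖ P]

theorem IsSmoothAction.contMDiff_right (h_smooth : IsSmoothAction E F G P) (g : G) :
    ContMDiff 𝓘(ℝ, E) 𝓘(ℝ, E) ∞ (fun q : P => q <• g) :=
  ContMDiff.comp (g := fun x : P × G => x.1 <• x.2) h_smooth (contMDiff_id.prodMk contMDiff_const)

theorem IsSmoothAction.contMDiff_orbit (h_smooth : IsSmoothAction E F G P) (p : P) :
    ContMDiff 𝓘(ℝ, F) 𝓘(ℝ, E) ∞ (fun g : G => p <• g) :=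
  ContMDiff.comp (g := fun x : P × G => x.1 <• x.2) h_smooth (contMDiff_const.prodMk contMDiff_id)

/-- Right translation as a diffeomorphism. -/
def IsSmoothAction.rightDiffeomorph (h_smooth : IsSmoothAction E F G P) (g : G) :
    Diffeomorph 𝓘(ℝ, E) 𝓘(ℝ, E) P P ∞ where
  toEquiv := MulAction.toPerm (MulOpposite.op g)
  contMDiff_toFun := h_smooth.contMDiff_right g
  contMDiff_invFun := h_smooth.contMDiff_right g⁻¹

variable [LieGroup 𝓘(ℝ, F) ∞ G]

variable (F B) in
/-- Right multiplication on the second factor of `B × G` as a diffeomorphism. -/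
def prodMulRightDiffeomorph (g : G) :
    Diffeomorph (𝓘(ℝ, B).prod 𝓘(ℝ, F)) (𝓘(ℝ, B).prod 𝓘(ℝ, F)) (B × G) (B × G) ∞ where
  toEquiv := Equiv.prodCongr (Equiv.refl B) (Equiv.mulRight g)
  contMDiff_toFun := contMDiff_fst.prodMk (contMDiff_mul_right.comp contMDiff_snd)
  contMDiff_invFun := contMDiff_fst.prodMk ((contMDiff_mul_right (a := g⁻¹)).comp contMDiff_snd)

variable [IsManifold 𝓘(ℝ, E) ∞ P]
  [CompleteSpace E] [CompleteSpace F] [CompleteSpace B] [T2Space P] [LocallyCompactSpace P]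

/-- A smooth, free and proper action which is infinitesimally free at `p` has a slice at `p`. -/
theorem exists_slice (h_smooth : IsSmoothAction E F G P) (h_proper : IsProperAction G P)
    (h_free : IsFreeAction G P) (p : P)
    (L : B →L[ℝ] E) (hL : Function.Bijective (L.coprod (orbitDeriv E F G p))) :
    ∃ (V : Set B) (s : B → P) (Ψ : OpenPartialHomeomorph (B × G) P),
      IsOpen V ∧ 0 ∈ V ∧ s 0 = p ∧ ContMDiffOn 𝓘(ℝ, B) 𝓘(ℝ, E) ∞ s V ∧
      Ψ.source = V ×ˢ Set.univ ∧ (∀ b g, Ψ (b, g) = s b <• g) ∧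
      ContMDiffOn (𝓘(ℝ, B).prod 𝓘(ℝ, F)) 𝓘(ℝ, E) ∞ Ψ Ψ.source ∧
      ContMDiffOn 𝓘(ℝ, E) (𝓘(ℝ, B).prod 𝓘(ℝ, F)) ∞ Ψ.symm Ψ.target := by
  have : IsTopologicalGroup G := topologicalGroup_of_lieGroup 𝓘(ℝ, F) ∞
  obtain ⟨Θ, hmem, hΘ⟩ := isLocalDiffeomorphAt_slice (G := G) h_smooth p L hL
  have hΘn : Θ.source ∈ 𝓝 ((0 : B), (1 : G)) := Θ.open_source.mem_nhds hmem
  rw [nhds_prod_eq, Filter.mem_prod_iff] at hΘn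
  obtain ⟨V₁, hV₁, U₁, hU₁, hVU⟩ := hΘn
  obtain ⟨U, hUU₁, hUo, h1U⟩ := mem_nhds_iff.1 hU₁
  have hsc : ContinuousAt (sliceMap p L) 0 :=
    ((contMDiffOn_sliceMap p L).contMDiffAt ((isOpen_sliceDomain p L).mem_nhds
    (zero_mem_sliceDomain p L))).continuousAt
  have hev := h_proper.eventually_mem (ContMDiff.continuous h_smooth) (p := p) hUo
    (fun g hg => by rw [h_free p g hg]; exact h1U)
  rw [nhds_prod_eq] at hev
  obtain ⟨T, hT, hTU⟩ := Filter.eventually_prod_self_iff'.1 hev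
  have hsT : sliceMap p L ⁻¹' T ∈ 𝓝 (0 : B) := hsc (by rwa [sliceMap_zero])
  obtain ⟨V, hVsub, hVo, h0V⟩ := mem_nhds_iff.1 (Filter.inter_mem (Filter.inter_mem hV₁ hsT)
    ((isOpen_sliceDomain p L).mem_nhds (zero_mem_sliceDomain p L)))
  set f : B × G → P := fun x => sliceMap p L x.1 <• x.2 with hf
  -- If `s(b) · g = s(b') · g'`, then `g * g'⁻¹` moves one point near `p` to another. Properness and
  -- freeness put it in the neighbourhood `U` of `1`, where the local diffeomorphism `Θ` is
  -- injective.
  have hinj : Set.InjOn f (V ×ˢ Set.univ) := by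
    rintro ⟨b, g⟩ ⟨hb, -⟩ ⟨b', g'⟩ ⟨hb', -⟩ heq
    have h1 : sliceMap p L b' = sliceMap p L b <• (g * g'⁻¹) := by
      have : sliceMap p L b <• g = sliceMap p L b' <• g' := heq
      rw [MulOpposite.op_mul, mul_smul, this, ← mul_smul, ← MulOpposite.op_mul, mul_inv_cancel,
        MulOpposite.op_one, one_smul]
    have h2 : g * g'⁻¹ ∈ U := hTU _ (hVsub hb).1.2 _ (hVsub hb').1.2 _ h1
    have h3 : (b', (1 : G)) ∈ Θ.source := hVU ⟨(hVsub hb').1.1, mem_of_mem_nhds hU₁⟩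
    have h4 : (b, g * g'⁻¹) ∈ Θ.source := hVU ⟨(hVsub hb).1.1, hUU₁ h2⟩
    have h5 : Θ (b', (1 : G)) = Θ (b, g * g'⁻¹) := by
      rw [← hΘ h3, ← hΘ h4]
      change sliceMap p L b' <• (1 : G) = _
      rw [MulOpposite.op_one, one_smul]
      exact h1
    have h6 := Θ.injOn h3 h4 h5
    simp only [Prod.mk.injEq] at h6
    obtain ⟨rfl, h6⟩ := h6
    rw [mul_inv_eq_one.1 h6.symm]
  -- By equivariance of `f`, translating by `g⁻¹` in the source and by `g` in the target reduces the
  -- point `(b, g)` to `(b, 1)`.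
  have hloc : IsLocalDiffeomorphOn (𝓘(ℝ, B).prod 𝓘(ℝ, F)) 𝓘(ℝ, E) ∞ f (V ×ˢ Set.univ) := by
    rintro ⟨⟨b, g⟩, ⟨hb, -⟩⟩
    have hb1 : IsLocalDiffeomorphAt (𝓘(ℝ, B).prod 𝓘(ℝ, F)) 𝓘(ℝ, E) ∞ f (b, 1) :=
      ⟨Θ, hVU ⟨(hVsub hb).1.1, mem_of_mem_nhds hU₁⟩, hΘ⟩
    have hd1 := (prodMulRightDiffeomorph F B g⁻¹ : Diffeomorph _ _ (B × G) _ _).isLocalDiffeomorph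
      (b, g)
    have hd2 := (h_smooth.rightDiffeomorph g).isLocalDiffeomorph (f (b, 1))
    have e1 : (prodMulRightDiffeomorph F B g⁻¹ : Diffeomorph _ _ (B × G) _ _) (b, g) = (b, 1) := by
      change (b, g * g⁻¹) = (b, 1)
      rw [mul_inv_cancel]
    have h1 := (hd1.comp 𝓘(ℝ, E) P (g := f) (by rw [e1]; exact hb1))
    have h2 := h1.comp 𝓘(ℝ, E) P (g := h_smooth.rightDiffeomorph g)
      (by rw [Function.comp_apply, e1]; exact hd2)
    convert h2 using 1
    funext x
    change sliceMap p L x.1 <• x.2 = (sliceMap p L x.1 <• (x.2 * g⁻¹)) <• g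
    rw [← mul_smul, ← MulOpposite.op_mul, inv_mul_cancel_right]
  obtain ⟨Ψ, h1, h2, h3, h4, h5⟩ :=
    exists_openPartialHomeomorph_of_injOn (hVo.prod isOpen_univ) hloc hinj
  exact ⟨V, sliceMap p L, Ψ, hVo, h0V, sliceMap_zero p L,
    (contMDiffOn_sliceMap p L).mono fun b hb => (hVsub hb).2, h1, fun b g => h2 _, h4, h5⟩

end Slices

/-! ### The orbit space of a smooth, free and proper action -/

section OrbitSpace

theorem quotientMk_eq_iff {G P : Type*} [Group G] [MulAction Gᵐᵒᵖ P] (x y : P) :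
    Quotient.mk (MulAction.orbitRel Gᵐᵒᵖ P) x = Quotient.mk (MulAction.orbitRel Gᵐᵒᵖ P) y ↔
      ∃ g : G, x = y <• g := by
  rw [Quotient.eq, MulAction.orbitRel_apply, MulAction.mem_orbit_iff]
  exact ⟨fun ⟨g, hg⟩ => ⟨g.unop, hg.symm⟩, fun ⟨g, hg⟩ => ⟨MulOpposite.op g, hg.symm⟩⟩

/-- The two notions of properness differ by a swap of factors; `ProperSMul` is the form that gives a
Hausdorff orbit space. -/
theorem IsProperAction.properSMul {G P : Type*} [Group G] [TopologicalSpace G]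
    [TopologicalSpace P] [MulAction Gᵐᵒᵖ P] [T2Space P] [LocallyCompactSpace P]
    (h_proper : IsProperAction G P) (hc : Continuous fun x : P × G => x.1 <• x.2) :
    ProperSMul Gᵐᵒᵖ P := by
  refine ⟨isProperMap_iff_isCompact_preimage.2 ⟨?_, fun C hC => ?_⟩⟩
  · exact (hc.comp (continuous_snd.prodMk (MulOpposite.continuous_unop.comp continuous_fst))).prodMk
      continuous_snd
  · have h1 := (h_proper _ (hC.image continuous_swap)).image
      (f := fun x : P × G => (MulOpposite.op x.2, x.1)) (by fun_prop)
    convert h1 using 1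
    ext ⟨g, x⟩
    constructor
    · intro h
      exact ⟨(x, g.unop), ⟨_, h, rfl⟩, rfl⟩
    · rintro ⟨⟨y, h⟩, ⟨⟨a, b⟩, hab, he⟩, he'⟩
      simp only [Prod.mk.injEq, Prod.swap_prod_mk] at he he'
      obtain ⟨rfl, rfl⟩ := he'
      obtain ⟨rfl, rfl⟩ := he
      exact hab

variable {E : Type*} [NormedAddCommGroup E] [NormedSpace ℝ E]
  {F : Type*} [NormedAddCommGroup F] [NormedSpace ℝ F]
  {B : Type*} [NormedAddCommGroup B] [NormedSpace ℝ B]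
  {G : Type*} [TopologicalSpace G] [ChartedSpace F G] [Group G] [LieGroup 𝓘(ℝ, F) ∞ G]
  {P : Type*} [TopologicalSpace P] [ChartedSpace E P] [MulAction Gᵐᵒᵖ P]
  [IsManifold 𝓘(ℝ, E) ∞ P]
  [CompleteSpace E] [CompleteSpace F] [CompleteSpace B] [T2Space P] [LocallyCompactSpace P]

/-- Injectivity of the tube `Ψ` says that the slice meets each orbit at most once, so slice
parameters are coordinates on the orbit space. The tube is kept in the conclusion because it becomes
a trivialisation. -/
theorem exists_sectionChart_orbit (h_smooth : IsSmoothAction E F G P)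
    (h_proper : IsProperAction G P) (h_free : IsFreeAction G P) (p : P)
    (L : B →L[ℝ] E) (hL : Function.Bijective (L.coprod (orbitDeriv E F G p))) :
    ∃ (c : SectionChart E B (Quotient.mk (MulAction.orbitRel Gᵐᵒᵖ P)))
      (Ψ : OpenPartialHomeomorph (B × G) P),
      0 ∈ c.chart.target ∧ c.sec 0 = p ∧ Ψ.source = c.chart.target ×ˢ Set.univ ∧
      Ψ.target = Quotient.mk (MulAction.orbitRel Gᵐᵒᵖ P) ⁻¹' c.chart.source ∧
      (∀ b g, Ψ (b, g) = c.sec b <• g) ∧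
      ContMDiffOn (𝓘(ℝ, B).prod 𝓘(ℝ, F)) 𝓘(ℝ, E) ∞ Ψ Ψ.source ∧
      ContMDiffOn 𝓘(ℝ, E) (𝓘(ℝ, B).prod 𝓘(ℝ, F)) ∞ Ψ.symm Ψ.target := by
  obtain ⟨V, s, Ψ, hVo, h0V, hs0, hs, hΨs, hΨ, hΨ1, hΨ2⟩ :=
    exists_slice h_smooth h_proper h_free p L hL
  set π : P → Quotient (MulAction.orbitRel Gᵐᵒᵖ P) := Quotient.mk _ with hπ
  have hcs : ContinuousConstSMul Gᵐᵒᵖ P :=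
    ⟨fun g => (h_smooth.contMDiff_right g.unop).continuous⟩
  have hopen : IsOpenMap π := isOpenMap_quotient_mk'_mul
  have hπc : Continuous π := continuous_quotient_mk'
  have hmem : ∀ b ∈ V, ∀ g : G, (b, g) ∈ Ψ.source := fun b hb g => by
    rw [hΨs]; exact ⟨hb, trivial⟩
  have hinj : Set.InjOn (π ∘ s) V := by
    intro b hb b' hb' h
    obtain ⟨g, hg⟩ := (quotientMk_eq_iff _ _).1 h
    have h1 : Ψ (b, 1) = Ψ (b', g) := by
      rw [hΨ, hΨ, MulOpposite.op_one, one_smul, hg]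
    exact congrArg Prod.fst (Ψ.injOn (hmem b hb 1) (hmem b' hb' g) h1)
  have hinv : ∀ (x : P) (g : G), π (x <• g) = π x := fun x g =>
    (quotientMk_eq_iff _ _).2 ⟨g, rfl⟩
  -- A piece of the slice is not open in `P`, but its saturation is, and both have the same image;
  -- this makes `π ∘ s` open.
  have himage : ∀ T ⊆ V, (π ∘ s) '' T = π '' (Ψ '' (T ×ˢ Set.univ)) := by
    intro T hT
    ext y
    constructor
    · rintro ⟨b, hb, rfl⟩
      exact ⟨Ψ (b, 1), ⟨(b, 1), ⟨hb, trivial⟩, rfl⟩, by rw [hΨ, hinv]; rfl⟩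
    · rintro ⟨_, ⟨⟨b, g⟩, ⟨hb, -⟩, rfl⟩, rfl⟩
      exact ⟨b, hb, by rw [hΨ, hinv]; rfl⟩
  let e : OpenPartialHomeomorph B (Quotient (MulAction.orbitRel Gᵐᵒᵖ P)) :=
    OpenPartialHomeomorph.ofContinuousOpenRestrict (hinj.toPartialEquiv _ V)
      (hπc.comp_continuousOn hs.continuousOn) (by
        intro T hT
        have h2 : IsOpen ((↑) '' T : Set B) := hVo.isOpenMap_subtype_val T hT
        have hsub : ((↑) '' T : Set B) ⊆ V := by rintro _ ⟨y, -, rfl⟩; exact y.2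
        have h3 := himage _ hsub
        rw [Set.image_image] at h3
        have h4 := hopen _ (Ψ.isOpen_image_of_subset_source (h2.prod isOpen_univ)
          (hΨs.symm ▸ Set.prod_mono hsub subset_rfl))
        rw [← h3] at h4
        exact h4) hVo
  have htarget : Ψ.target = π ⁻¹' e.target := by
    ext x
    constructor
    · intro hx
      have h1 := Ψ.map_target hx
      rw [hΨs] at h1
      refine ⟨(Ψ.symm x).1, h1.1, ?_⟩
      have h2 := Ψ.right_inv hx
      conv_rhs => rw [← h2]
      rw [← Prod.mk.eta (p := Ψ.symm x), hΨ, hinv]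
      rfl
    · rintro ⟨b, hb, h⟩
      obtain ⟨g, hg⟩ := (quotientMk_eq_iff _ _).1 h.symm
      have hg' : x = s b <• g := hg
      rw [hg', ← hΨ]
      exact Ψ.map_source (hmem b hb g)
  have hsymm : ∀ x ∈ Ψ.target, e.symm (π x) = (Ψ.symm x).1 := by
    intro x hx
    have h1 := Ψ.map_target hx
    rw [hΨs] at h1
    have h2 : π x = e (Ψ.symm x).1 := by
      conv_lhs => rw [← Ψ.right_inv hx, ← Prod.mk.eta (p := Ψ.symm x), hΨ, hinv]
      rfl
    rw [h2]
    exact e.left_inv h1.1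
  refine ⟨⟨e.symm, s, fun b _ => rfl, hs, ?_⟩, Ψ, h0V, hs0, hΨs, htarget, hΨ, hΨ1, hΨ2⟩
  rw [e.symm_source, ← htarget]
  exact (contMDiff_fst.comp_contMDiffOn hΨ2).congr hsymm

/-- The orbit space of a smooth, free, infinitesimally free and proper action is a manifold, over
which the total space is a principal bundle. -/
theorem exists_isPrincipalBundle_orbitSpace (h_smooth : IsSmoothAction E F G P)
    (h_proper : IsProperAction G P) (h_free : IsFreeAction G P)
    (hL : ∀ p : P, ∃ L : B →L[ℝ] E, Function.Bijective (L.coprod (orbitDeriv E F G p))) :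
    ∃ _ : ChartedSpace B (Quotient (MulAction.orbitRel Gᵐᵒᵖ P)),
      IsManifold 𝓘(ℝ, B) ∞ (Quotient (MulAction.orbitRel Gᵐᵒᵖ P)) ∧
      T2Space (Quotient (MulAction.orbitRel Gᵐᵒᵖ P)) ∧
      (SecondCountableTopology P →
        SecondCountableTopology (Quotient (MulAction.orbitRel Gᵐᵒᵖ P))) ∧
      (∀ p : P, Function.Surjective (mfderiv 𝓘(ℝ, E) 𝓘(ℝ, B)
        (Quotient.mk (MulAction.orbitRel Gᵐᵒᵖ P)) p)) ∧
      IsPrincipalBundle E F B G (Quotient.mk (MulAction.orbitRel Gᵐᵒᵖ P)) := by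
  have hcs : ContinuousConstSMul Gᵐᵒᵖ P :=
    ⟨fun g => (h_smooth.contMDiff_right g.unop).continuous⟩
  have hps : ProperSMul Gᵐᵒᵖ P := h_proper.properSMul (ContMDiff.continuous h_smooth)
  choose L hL using hL
  choose c Ψ h0 hsec hΨs hΨt hΨ hΨ1 hΨ2 using fun p : P =>
    exists_sectionChart_orbit (G := G) h_smooth h_proper h_free p (L p) (hL p)
  have hmemc : ∀ p, Quotient.mk (MulAction.orbitRel Gᵐᵒᵖ P) p ∈ (c p).chart.source := by
    intro p
    have h1 := (c p).proj_sec 0 (h0 p)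
    rw [hsec] at h1
    rw [h1]
    exact (c p).chart.map_target (h0 p)
  have hchart0 : ∀ p, (c p).chart (Quotient.mk (MulAction.orbitRel Gᵐᵒᵖ P) p) = 0 := by
    intro p
    have h1 := (c p).proj_sec 0 (h0 p)
    rw [hsec] at h1
    rw [h1, (c p).chart.right_inv (h0 p)]
  obtain ⟨cs, hM, hπ, hcharts⟩ := exists_isManifold_of_sectionCharts (E := E) (B := B)
    (π := Quotient.mk (MulAction.orbitRel Gᵐᵒᵖ P)) continuous_quotient_mk' (by
      intro q
      obtain ⟨p, rfl⟩ := Quotient.exists_rep q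
      exact ⟨c p, hmemc p⟩)
  have hinv : ∀ (x : P) (g : G), Quotient.mk (MulAction.orbitRel Gᵐᵒᵖ P) (x <• g) =
      Quotient.mk (MulAction.orbitRel Gᵐᵒᵖ P) x := fun x g =>
    (quotientMk_eq_iff _ _).2 ⟨g, rfl⟩
  refine ⟨cs, hM, t2Space_quotient_mulAction_of_properSMul,
    fun _ => ContinuousConstSMul.secondCountableTopology, ?_, h_smooth, hπ, hinv, ?_⟩
  · intro p
    set q := Quotient.mk (MulAction.orbitRel Gᵐᵒᵖ P) p with hq
    have hs := ((c p).contMDiffOn_section (hcharts (c p)).1).contMDiffAt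
      ((c p).chart.open_source.mem_nhds (hmemc p))
    have hsp : ((c p).sec ∘ (c p).chart) q = p := by
      rw [Function.comp_apply, hchart0, hsec]
    have h1 : HasMFDerivAt 𝓘(ℝ, B) 𝓘(ℝ, E) ((c p).sec ∘ (c p).chart) q
        (mfderiv 𝓘(ℝ, B) 𝓘(ℝ, E) ((c p).sec ∘ (c p).chart) q) :=
      (hs.mdifferentiableAt (by simp)).hasMFDerivAt
    have h2 := (hπ.mdifferentiableAt (x := ((c p).sec ∘ (c p).chart) q) (by simp)).hasMFDerivAt
    have h3 := h2.comp q h1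
    -- The local section through `p` is a right inverse of the projection, so its derivative is a
    -- right inverse of the derivative of the projection.
    have h4 : HasMFDerivAt 𝓘(ℝ, B) 𝓘(ℝ, B) (Quotient.mk (MulAction.orbitRel Gᵐᵒᵖ P) ∘
        (c p).sec ∘ (c p).chart) q (ContinuousLinearMap.id ℝ B) := by
      refine (hasMFDerivAt_id q).congr_of_eventuallyEq ?_
      filter_upwards [(c p).chart.open_source.mem_nhds (hmemc p)] with y hy
      exact (c p).proj_section hy
    have h5 := hasMFDerivAt_unique h3 h4
    have h6 : ∀ w : B, mfderiv 𝓘(ℝ, E) 𝓘(ℝ, B) (Quotient.mk (MulAction.orbitRel Gᵐᵒᵖ P))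
        (((c p).sec ∘ (c p).chart) q) (mfderiv 𝓘(ℝ, B) 𝓘(ℝ, E) ((c p).sec ∘ (c p).chart) q w) = w :=
      fun w => congrArg (fun A : B →L[ℝ] B => A w) h5
    rw [hsp] at h6
    exact fun v => ⟨_, h6 v⟩
  · intro m
    obtain ⟨p, rfl⟩ := Quotient.exists_rep m
    let j : OpenPartialHomeomorph (B × G) (Quotient (MulAction.orbitRel Gᵐᵒᵖ P) × G) :=
      (c p).chart.symm.prod (OpenPartialHomeomorph.refl G)
    have hjs : j.source = (Ψ p).source := by rw [hΨs]; rfl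
    have hjt : j.target = (c p).chart.source ×ˢ Set.univ := rfl
    -- The inverse tube, with the slice parameter replaced by the orbit that it labels.
    let Φ : OpenPartialHomeomorph P (Quotient (MulAction.orbitRel Gᵐᵒᵖ P) × G) :=
      (Ψ p).symm ≫ₕ j
    have hs : Φ.source = (Ψ p).target := by
      ext x
      simp only [Φ, OpenPartialHomeomorph.trans_source, OpenPartialHomeomorph.symm_source,
        Set.mem_inter_iff, Set.mem_preimage, and_iff_left_iff_imp]
      intro hx
      rw [hjs]
      exact (Ψ p).map_target hx
    have ht : Φ.target = j.target := by
      ext x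
      simp only [Φ, OpenPartialHomeomorph.trans_target, OpenPartialHomeomorph.symm_target,
        Set.mem_inter_iff, Set.mem_preimage, and_iff_left_iff_imp]
      intro hx
      rw [← hjs]
      exact j.map_target hx
    have hrep : ∀ x ∈ Φ.source, ∃ b ∈ (c p).chart.target, ∃ g : G, x = (c p).sec b <• g ∧
        (Ψ p).symm x = (b, g) := by
      intro x hx
      rw [hs] at hx
      have h1 := (Ψ p).map_target hx
      rw [hΨs] at h1
      refine ⟨((Ψ p).symm x).1, h1.1, ((Ψ p).symm x).2, ?_, rfl⟩
      rw [← hΨ, Prod.mk.eta, (Ψ p).right_inv hx]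
    refine ⟨(c p).chart.source, Φ, (c p).chart.open_source, hmemc p, hs.trans (hΨt p),
      ht.trans hjt, ?_, ?_, ?_, ?_⟩
    · have h1 : ContMDiffOn (𝓘(ℝ, B).prod 𝓘(ℝ, F)) (𝓘(ℝ, B).prod 𝓘(ℝ, F)) ∞ j j.source :=
        ((hcharts (c p)).2.comp contMDiffOn_fst fun x hx => hx.1).prodMk contMDiffOn_snd
      rw [hs]
      exact h1.comp (hΨ2 p) fun x hx => by
        change (Ψ p).symm x ∈ j.source
        rw [hjs]; exact (Ψ p).map_target hx
    · have h1 : ContMDiffOn (𝓘(ℝ, B).prod 𝓘(ℝ, F)) (𝓘(ℝ, B).prod 𝓘(ℝ, F)) ∞ j.symm j.target :=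
        ((hcharts (c p)).1.comp contMDiffOn_fst fun x hx => hx.1).prodMk contMDiffOn_snd
      rw [ht]
      exact (hΨ1 p).comp h1 fun x hx => by
        change j.symm x ∈ (Ψ p).source
        rw [← hjs]; exact j.map_target hx
    · intro x hx
      obtain ⟨b, hb, g, hx', he⟩ := hrep x hx
      change (c p).chart.symm ((Ψ p).symm x).1 = _
      rw [he, hx', hinv, (c p).proj_sec b hb]
    · intro x hx h
      obtain ⟨b, hb, g, hx', he⟩ := hrep x hx
      have h1 : (Ψ p).symm (x <• h) = (b, g * h) := by
        have : x <• h = (Ψ p) (b, g * h) := by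
          rw [hΨ, hx', MulOpposite.op_mul, mul_smul]
        rw [this, (Ψ p).left_inv]
        rw [hΨs]; exact ⟨hb, trivial⟩
      change ((c p).chart.symm ((Ψ p).symm (x <• h)).1, ((Ψ p).symm (x <• h)).2) =
        ((c p).chart.symm ((Ψ p).symm x).1, ((Ψ p).symm x).2 * h)
      rw [h1, he]

end OrbitSpace

/-! ### Pulling back forms by right translations -/

section Calculus

variable {E : Type*} [NormedAddCommGroup E] [NormedSpace ℝ E]
  {F : Type*} [NormedAddCommGroup F] [NormedSpace ℝ F]
  {W : Type*} [NormedAddCommGroup W] [NormedSpace ℝ W]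

/-- The derivative at `y₀` of the pullback of a form `Θ` by a family of maps `m (·, y)` with
`m (·, y₀) = id`, in terms of the generating vector field `x ↦ ∂₂ m (x, y₀) η`. -/
theorem fderiv_pullback_family {m : E × F → E} {Θ : E × E → W} {x₀ c : E} {y₀ : F}
    (hm : ContDiffAt ℝ 2 m (x₀, y₀)) (hΘ : DifferentiableAt ℝ Θ (x₀, c)) (B₀ : E →L[ℝ] W)
    (hB₀ : ∀ w, Θ (x₀, w) = B₀ w) (hid : ∀ᶠ x in 𝓝 x₀, m (x, y₀) = x) (η : F) :
    DifferentiableAt ℝ (fun y => Θ (m (x₀, y), fderiv ℝ m (x₀, y) (c, 0))) y₀ ∧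
    DifferentiableAt ℝ (fun x => fderiv ℝ m (x, y₀) (0, η)) x₀ ∧
    fderiv ℝ (fun y => Θ (m (x₀, y), fderiv ℝ m (x₀, y) (c, 0))) y₀ η =
      fderiv ℝ (fun x => Θ (x, c)) x₀ (fderiv ℝ m (x₀, y₀) (0, η)) +
      B₀ (fderiv ℝ (fun x => fderiv ℝ m (x, y₀) (0, η)) x₀ c) := by
  have hx₀ : m (x₀, y₀) = x₀ := hid.self_of_nhds
  have hmd : HasFDerivAt m (fderiv ℝ m (x₀, y₀)) (x₀, y₀) :=
    (hm.differentiableAt (by simp)).hasFDerivAt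
  have hD : DifferentiableAt ℝ (fderiv ℝ m) (x₀, y₀) :=
    (hm.fderiv_right (m := 1) (by norm_num)).differentiableAt (by simp)
  have hD2 := hD.hasFDerivAt
  set D2 := fderiv ℝ (fderiv ℝ m) (x₀, y₀) with hD2def
  -- Symmetry of the mixed second derivative: varying the differential of the map with `y` is the
  -- same as differentiating the generating field along `c`.
  have hsymm : D2 (0, η) (c, 0) = D2 (c, 0) (0, η) :=
    (hm.isSymmSndFDerivAt (by simp)).eq (0, η) (c, 0)
  have hinr : HasFDerivAt (fun y : F => (x₀, y)) (ContinuousLinearMap.inr ℝ E F) y₀ :=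
    hasFDerivAt_prodMk_right x₀ y₀
  have hinl : HasFDerivAt (fun x : E => (x, y₀)) (ContinuousLinearMap.inl ℝ E F) x₀ :=
    hasFDerivAt_prodMk_left x₀ y₀
  have hc1 : fderiv ℝ m (x₀, y₀) (c, 0) = c := by
    have h1 : HasFDerivAt (fun x => m (x, y₀)) (ContinuousLinearMap.id ℝ E) x₀ :=
      (hasFDerivAt_id x₀).congr_of_eventuallyEq hid
    have h2 := HasFDerivAt.comp (g := m) x₀ hmd hinl
    have h3 := h2.unique h1
    exact congrArg (fun A : E →L[ℝ] E => A c) h3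
  have h1 : HasFDerivAt (fun y => m (x₀, y))
      ((fderiv ℝ m (x₀, y₀)).comp (ContinuousLinearMap.inr ℝ E F)) y₀ :=
    HasFDerivAt.comp (g := m) y₀ hmd hinr
  have h2 : HasFDerivAt (fun y => fderiv ℝ m (x₀, y) (c, 0))
      (((ContinuousLinearMap.apply ℝ E ((c, 0) : E × F)).comp D2).comp
        (ContinuousLinearMap.inr ℝ E F)) y₀ :=
    (((ContinuousLinearMap.apply ℝ E ((c, 0) : E × F)).hasFDerivAt.comp _ hD2).comp y₀ hinr)
  have h3 : HasFDerivAt (fun x => fderiv ℝ m (x, y₀) (0, η))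
      (((ContinuousLinearMap.apply ℝ E ((0, η) : E × F)).comp D2).comp
        (ContinuousLinearMap.inl ℝ E F)) x₀ :=
    HasFDerivAt.comp (g := fun z => fderiv ℝ m z ((0, η) : E × F)) x₀
      ((ContinuousLinearMap.apply ℝ E ((0, η) : E × F)).hasFDerivAt.comp _ hD2) hinl
  have hΘ' : HasFDerivAt Θ (fderiv ℝ Θ (x₀, c)) (m (x₀, y₀), fderiv ℝ m (x₀, y₀) (c, 0)) := by
    rw [hx₀, hc1]; exact hΘ.hasFDerivAt
  have h4 := HasFDerivAt.comp (g := Θ) y₀ hΘ' (h1.prodMk h2)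
  have h5 : HasFDerivAt (fun x => Θ (x, c))
      ((fderiv ℝ Θ (x₀, c)).comp (ContinuousLinearMap.inl ℝ E E)) x₀ :=
    HasFDerivAt.comp (g := Θ) x₀ hΘ.hasFDerivAt (hasFDerivAt_prodMk_left x₀ c)
  -- `Θ` is linear in its second argument over `x₀`, so its partial derivative there is `B₀` itself.
  have h6 : (fderiv ℝ Θ (x₀, c)).comp (ContinuousLinearMap.inr ℝ E E) = B₀ := by
    have h7 : HasFDerivAt (fun w => Θ (x₀, w))
        ((fderiv ℝ Θ (x₀, c)).comp (ContinuousLinearMap.inr ℝ E E)) c :=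
      HasFDerivAt.comp (g := Θ) c hΘ.hasFDerivAt (hasFDerivAt_prodMk_right x₀ c)
    have h8 : HasFDerivAt (fun w => Θ (x₀, w)) B₀ c := by
      simp_rw [hB₀]; exact B₀.hasFDerivAt
    exact h7.unique h8
  refine ⟨h4.differentiableAt, h3.differentiableAt, ?_⟩
  have h4' := h4.fderiv
  have e1 : fderiv ℝ (fun y => Θ (m (x₀, y), fderiv ℝ m (x₀, y) (c, 0))) y₀ η =
      fderiv ℝ Θ (x₀, c) (fderiv ℝ m (x₀, y₀) (0, η), D2 (0, η) (c, 0)) :=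
    congrArg (fun A : F →L[ℝ] W => A η) h4'
  rw [e1, h5.fderiv, h3.fderiv, ← h6]
  change _ = fderiv ℝ Θ (x₀, c) (fderiv ℝ m (x₀, y₀) (0, η), 0) +
    fderiv ℝ Θ (x₀, c) (0, D2 (c, 0) (0, η))
  rw [← map_add, hsymm]
  simp

end Calculus

/-! ### Smoothness and multiplicativity of pullbacks by right translations. -/

section Pullback

variable {E : Type*} [NormedAddCommGroup E] [NormedSpace ℝ E]
  {F : Type*} [NormedAddCommGroup F] [NormedSpace ℝ F]
  {G : Type*} [TopologicalSpace G] [ChartedSpace F G] [Group G]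
  {P : Type*} [TopologicalSpace P] [ChartedSpace E P] [IsManifold 𝓘(ℝ, E) ∞ P]
  [MulAction Gᵐᵒᵖ P]
  {W : Type*} [NormedAddCommGroup W] [NormedSpace ℝ W]

/-- The value at `p` of the pullback of a form `θ` by the right translation by `g`. -/
def pullbackForm (θ : ∀ p : P, TangentSpace 𝓘(ℝ, E) p →L[ℝ] W) (p : P) (g : G) : E →L[ℝ] W :=
  ContinuousLinearMap.comp (θ (p <• g) : E →L[ℝ] W)
    (mfderiv 𝓘(ℝ, E) 𝓘(ℝ, E) (fun q : P => q <• g) p : E →L[ℝ] E)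

variable [LieGroup 𝓘(ℝ, F) ∞ G]

/-- The curve of vectors is the tangent map of the action applied to the fixed vector `v` paired
with the zero section of `TG`. -/
theorem contMDiff_rightTranslate (h_smooth : IsSmoothAction E F G P) (p : P)
    (v : TangentSpace 𝓘(ℝ, E) p) :
    ContMDiff 𝓘(ℝ, F) 𝓘(ℝ, E).tangent ∞
      (fun g : G => (⟨p <• g, rightTranslate E g p v⟩ : TangentBundle 𝓘(ℝ, E) P)) := by
  have hI : IsManifold 𝓘(ℝ, E) 1 P := IsManifold.of_le (n := ∞) (by simp)
  have hG : IsManifold 𝓘(ℝ, F) ∞ G := inferInstance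
  have hG1 : IsManifold 𝓘(ℝ, F) 1 G := IsManifold.of_le (n := ∞) (by simp)
  let fg : G → TangentBundle 𝓘(ℝ, F) G := fun g => Bundle.TotalSpace.mk' F g 0
  have sfg : ContMDiff 𝓘(ℝ, F) 𝓘(ℝ, F).tangent ∞ fg := Bundle.contMDiff_zeroSection _ _
  let fv : G → TangentBundle 𝓘(ℝ, E) P := fun _ => Bundle.TotalSpace.mk' E p v
  have sfv : ContMDiff 𝓘(ℝ, F) 𝓘(ℝ, E).tangent ∞ fv := contMDiff_const
  have S₂ : ContMDiff (𝓘(ℝ, E).tangent.prod 𝓘(ℝ, F).tangent) (𝓘(ℝ, E).prod 𝓘(ℝ, F)).tangent ∞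
      (equivTangentBundleProd 𝓘(ℝ, E) P 𝓘(ℝ, F) G).symm := contMDiff_equivTangentBundleProd_symm
  have S₃ : ContMDiff (𝓘(ℝ, E).prod 𝓘(ℝ, F)).tangent 𝓘(ℝ, E).tangent ∞
      (tangentMap (𝓘(ℝ, E).prod 𝓘(ℝ, F)) 𝓘(ℝ, E) (fun x : P × G => x.1 <• x.2)) :=
    ContMDiff.contMDiff_tangentMap h_smooth le_rfl
  have S := (S₃.comp S₂).comp (sfv.prodMk sfg)
  convert S using 1
  funext g
  have hd : MDifferentiableAt (𝓘(ℝ, E).prod 𝓘(ℝ, F)) 𝓘(ℝ, E)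
      (fun x : P × G => x.1 <• x.2) (p, g) := ContMDiff.mdifferentiableAt h_smooth (by simp)
  have key : (mfderiv (𝓘(ℝ, E).prod 𝓘(ℝ, F)) 𝓘(ℝ, E) (fun x : P × G => x.1 <• x.2) (p, g)
      ((v, 0) : E × F) : E) = rightTranslate E g p v := by
    refine (mfderiv_prod_eq_add_apply hd).trans ?_
    refine (congrArg₂ (fun a b : E => a + b) (rfl : _ = (rightTranslate E g p v : E))
      (ContinuousLinearMap.map_zero _)).trans (add_zero _)
  exact congrArg (fun w : E => (⟨p <• g, w⟩ : TangentBundle 𝓘(ℝ, E) P)) key.symm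

theorem contMDiff_pullbackForm_apply (h_smooth : IsSmoothAction E F G P)
    {θ : ∀ p : P, TangentSpace 𝓘(ℝ, E) p →L[ℝ] W} (hθ : IsSmoothForm θ) (p : P) (v : E) :
    ContMDiff 𝓘(ℝ, F) 𝓘(ℝ, W) ∞ (fun g : G => pullbackForm θ p g v) :=
  ContMDiff.comp (g := fun x : TangentBundle 𝓘(ℝ, E) P => θ x.proj x.snd) hθ
    (contMDiff_rightTranslate h_smooth p v)

omit [IsManifold 𝓘(ℝ, E) ∞ P] [LieGroup 𝓘(ℝ, F) ∞ G] in
theorem pullbackForm_mul (h_smooth : IsSmoothAction E F G P)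
    (θ : ∀ p : P, TangentSpace 𝓘(ℝ, E) p →L[ℝ] W) (p : P) (g h : G) (v : E) :
    pullbackForm θ p (g * h) v = pullbackForm θ (p <• g) h (rightTranslate E g p v) := by
  have e : (fun q : P => q <• (g * h)) = (fun q : P => q <• h) ∘ (fun q : P => q <• g) := by
    funext q; rw [Function.comp_apply, MulOpposite.op_mul, mul_smul]
  have h1 := mfderiv_comp (I := 𝓘(ℝ, E)) (I' := 𝓘(ℝ, E)) (I'' := 𝓘(ℝ, E)) p
    ((h_smooth.contMDiff_right h).mdifferentiableAt (x := p <• g) (by simp))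
    ((h_smooth.contMDiff_right g).mdifferentiableAt (x := p) (by simp))
  have h2 : (mfderiv 𝓘(ℝ, E) 𝓘(ℝ, E) (fun q : P => q <• (g * h)) p : E →L[ℝ] E) v =
      (mfderiv 𝓘(ℝ, E) 𝓘(ℝ, E) (fun q : P => q <• h) (p <• g) : E →L[ℝ] E)
        ((mfderiv 𝓘(ℝ, E) 𝓘(ℝ, E) (fun q : P => q <• g) p : E →L[ℝ] E) v) := by
    rw [e]; exact congrArg (fun A : E →L[ℝ] E => A v) h1
  -- All tangent spaces have the same model `E`; viewed this way, the base points `p · (gh)` and `(p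
  -- · g) · h` can be exchanged.
  let θ' : P → E →L[ℝ] W := θ
  change θ' (p <• (g * h)) _ = θ' ((p <• g) <• h) _
  rw [MulOpposite.op_mul, mul_smul]
  exact congrArg _ h2

end Pullback

/-! ### The infinitesimal variation of the pullback of a form -/

section ChartDerivatives

variable {E : Type*} [NormedAddCommGroup E] [NormedSpace ℝ E]
  {P : Type*} [TopologicalSpace P] [ChartedSpace E P]

variable (E) in
/-- The derivative of the preferred chart at `p`. -/
def chartDeriv (p q : P) : E →L[ℝ] E :=
  mfderiv 𝓘(ℝ, E) 𝓘(ℝ, E) (chartAt E p) q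

variable (E) in
/-- The derivative of the inverse of the preferred chart at `p`. -/
def chartSymmDeriv (p : P) (x : E) : E →L[ℝ] E :=
  mfderiv 𝓘(ℝ, E) 𝓘(ℝ, E) (chartAt E p).symm x

variable [IsManifold 𝓘(ℝ, E) ∞ P]

theorem hasMFDerivAt_chart {p q : P} (hq : q ∈ (chartAt E p).source) :
    HasMFDerivAt 𝓘(ℝ, E) 𝓘(ℝ, E) (chartAt E p) q (chartDeriv E p q) :=
  (((contMDiffOn_chart (I := 𝓘(ℝ, E)) (n := ∞) (x := p)).contMDiffAt
    ((chartAt E p).open_source.mem_nhds hq)).mdifferentiableAt (by simp)).hasMFDerivAt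

theorem hasMFDerivAt_chart_symm {p : P} {x : E} (hx : x ∈ (chartAt E p).target) :
    HasMFDerivAt 𝓘(ℝ, E) 𝓘(ℝ, E) (chartAt E p).symm x (chartSymmDeriv E p x) :=
  (((contMDiffOn_chart_symm (I := 𝓘(ℝ, E)) (n := ∞) (x := p)).contMDiffAt
    ((chartAt E p).open_target.mem_nhds hx)).mdifferentiableAt (by simp)).hasMFDerivAt

theorem chartSymmDeriv_comp_chartDeriv {p q : P} (hq : q ∈ (chartAt E p).source) :
    (chartSymmDeriv E p (chartAt E p q)).comp (chartDeriv E p q) = ContinuousLinearMap.id ℝ E := by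
  have : IsManifold 𝓘(ℝ, E) 1 P := IsManifold.of_le (n := ∞) (by simp)
  exact (mdifferentiable_chart (I := 𝓘(ℝ, E)) p).symm_comp_deriv hq

theorem chartDeriv_comp_chartSymmDeriv {p : P} {x : E} (hx : x ∈ (chartAt E p).target) :
    (chartDeriv E p ((chartAt E p).symm x)).comp (chartSymmDeriv E p x) =
      ContinuousLinearMap.id ℝ E := by
  have : IsManifold 𝓘(ℝ, E) 1 P := IsManifold.of_le (n := ∞) (by simp)
  exact (mdifferentiable_chart (I := 𝓘(ℝ, E)) p).comp_symm_deriv hx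

theorem contMDiffOn_chartSymmDeriv (p : P) :
    ContMDiffOn 𝓘(ℝ, E × E) 𝓘(ℝ, E).tangent ∞
      (fun z : E × E => (⟨(chartAt E p).symm z.1, chartSymmDeriv E p z.1 z.2⟩ :
        TangentBundle 𝓘(ℝ, E) P)) ((chartAt E p).target ×ˢ Set.univ) := by
  have hI : IsManifold 𝓘(ℝ, E) 1 P := IsManifold.of_le (n := ∞) (by simp)
  have h1 : ContMDiffOn 𝓘(ℝ, E).tangent 𝓘(ℝ, E).tangent ∞
      (tangentMapWithin 𝓘(ℝ, E) 𝓘(ℝ, E) (chartAt E p).symm (chartAt E p).target)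
      (Bundle.TotalSpace.proj ⁻¹' (chartAt E p).target) :=
    (contMDiffOn_chart_symm (I := 𝓘(ℝ, E)) (n := ∞) (x := p)).contMDiffOn_tangentMapWithin le_rfl
      (chartAt E p).open_target.uniqueMDiffOn
  have h2 : ContMDiff 𝓘(ℝ, E × E) 𝓘(ℝ, E).tangent ∞
      (fun z : E × E => (⟨z.1, z.2⟩ : TangentBundle 𝓘(ℝ, E) E)) := by
    have := contMDiff_tangentBundleModelSpaceHomeomorph_symm (I := 𝓘(ℝ, E)) (n := ∞)
    rw [modelWithCornersSelf_prod]
    exact this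
  refine (h1.comp h2.contMDiffOn fun z hz => hz.1).congr ?_
  intro z hz
  have h4 := mfderivWithin_of_isOpen (I := 𝓘(ℝ, E)) (I' := 𝓘(ℝ, E)) (f := (chartAt E p).symm)
    (chartAt E p).open_target hz.1
  exact congrArg (fun A : E →L[ℝ] E =>
    (⟨(chartAt E p).symm z.1, A z.2⟩ : TangentBundle 𝓘(ℝ, E) P)) h4.symm

end ChartDerivatives

/-! ### The action and its derivatives in charts. -/

section Variation

variable {E : Type*} [NormedAddCommGroup E] [NormedSpace ℝ E]
  {F : Type*} [NormedAddCommGroup F] [NormedSpace ℝ F]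
  {G : Type*} [TopologicalSpace G] [ChartedSpace F G] [Group G] [LieGroup 𝓘(ℝ, F) ∞ G]
  {P : Type*} [TopologicalSpace P] [ChartedSpace E P] [IsManifold 𝓘(ℝ, E) ∞ P]
  [MulAction Gᵐᵒᵖ P]
  {W : Type*} [NormedAddCommGroup W] [NormedSpace ℝ W]

/-- The action in the preferred charts at `p` and `1`. -/
def chartAction (p : P) (z : E × F) : E :=
  chartAt E p ((chartAt E p).symm z.1 <• ((chartAt F (1 : G)).symm z.2 : G))

variable (G) in
/-- The domain of the action in the preferred charts at `p` and `1`. -/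
def chartActionDomain (p : P) : Set (E × F) :=
  {z | z.1 ∈ (chartAt E p).target ∧ z.2 ∈ (chartAt F (1 : G)).target ∧
    (chartAt E p).symm z.1 <• ((chartAt F (1 : G)).symm z.2 : G) ∈ (chartAt E p).source}

theorem contMDiffAt_charts_smul (h_smooth : IsSmoothAction E F G P) {p : P} {z : E × F}
    (h1 : z.1 ∈ (chartAt E p).target) (h2 : z.2 ∈ (chartAt F (1 : G)).target) :
    ContMDiffAt 𝓘(ℝ, E × F) 𝓘(ℝ, E) ∞
      (fun z : E × F => (chartAt E p).symm z.1 <• ((chartAt F (1 : G)).symm z.2 : G)) z := by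
  have k1 : ContMDiffAt 𝓘(ℝ, E × F) 𝓘(ℝ, E) ∞ (fun z : E × F => (chartAt E p).symm z.1) z :=
    ContMDiffAt.comp z ((contMDiffOn_chart_symm (I := 𝓘(ℝ, E)) (n := ∞) (x := p)).contMDiffAt
      ((chartAt E p).open_target.mem_nhds h1)) contDiff_fst.contMDiff.contMDiffAt
  have k2 : ContMDiffAt 𝓘(ℝ, E × F) 𝓘(ℝ, F) ∞
      (fun z : E × F => (chartAt F (1 : G)).symm z.2) z :=
    ContMDiffAt.comp z ((contMDiffOn_chart_symm (I := 𝓘(ℝ, F)) (n := ∞)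
      (x := (1 : G))).contMDiffAt ((chartAt F (1 : G)).open_target.mem_nhds h2))
      contDiff_snd.contMDiff.contMDiffAt
  exact ContMDiffAt.comp (g := fun x : P × G => x.1 <• x.2) z (ContMDiff.contMDiffAt h_smooth)
    (k1.prodMk k2)

theorem contDiffAt_chartAction (h_smooth : IsSmoothAction E F G P) {p : P} {z : E × F}
    (hz : z ∈ chartActionDomain G p) :
    ContDiffAt ℝ ∞ (chartAction (G := G) (F := F) p) z := by
  rw [← contMDiffAt_iff_contDiffAt]
  exact ContMDiffAt.comp z ((contMDiffOn_chart (I := 𝓘(ℝ, E)) (n := ∞) (x := p)).contMDiffAt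
    ((chartAt E p).open_source.mem_nhds hz.2.2)) (contMDiffAt_charts_smul h_smooth hz.1 hz.2.1)

theorem eventually_mem_chartActionDomain (h_smooth : IsSmoothAction E F G P) {p : P}
    {z : E × F} (hz : z ∈ chartActionDomain G p) :
    ∀ᶠ w in 𝓝 z, w ∈ chartActionDomain G p := by
  filter_upwards [continuousAt_fst.eventually ((chartAt E p).open_target.mem_nhds hz.1),
    continuousAt_snd.eventually ((chartAt F (1 : G)).open_target.mem_nhds hz.2.1),
    (contMDiffAt_charts_smul h_smooth hz.1 hz.2.1).continuousAt.eventually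
      ((chartAt E p).open_source.mem_nhds hz.2.2)] with w h1 h2 h3
  exact ⟨h1, h2, h3⟩

omit [NormedSpace ℝ E] [NormedSpace ℝ F] [LieGroup 𝓘(ℝ, F) ∞ G] [IsManifold 𝓘(ℝ, E) ∞ P] in
theorem mem_chartActionDomain_self (p : P) :
    (chartAt E p p, chartAt F (1 : G) 1) ∈ chartActionDomain G p := by
  refine ⟨mem_chart_target E p, mem_chart_target F 1, ?_⟩
  change (chartAt E p).symm (chartAt E p p) <• (chartAt F (1 : G)).symm (chartAt F (1 : G) 1) ∈ _
  rw [(chartAt E p).left_inv (mem_chart_source E p),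
    (chartAt F (1 : G)).left_inv (mem_chart_source F 1), MulOpposite.op_one, one_smul]
  exact mem_chart_source E p

/-- Near `x`, translating the point with coordinate `x'` agrees with first applying the action in
coordinates and then the inverse chart. Differentiating both expressions in `x'` gives the formula.
-/
theorem mfderiv_right_chart (h_smooth : IsSmoothAction E F G P) {p : P} {x : E} {y : F}
    (hz : (x, y) ∈ chartActionDomain G p) (c : E) :
    (mfderiv 𝓘(ℝ, E) 𝓘(ℝ, E) (fun q : P => q <• ((chartAt F (1 : G)).symm y : G))
      ((chartAt E p).symm x) : E →L[ℝ] E) (chartSymmDeriv E p x c) =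
    chartSymmDeriv E p (chartAction (G := G) p (x, y))
      (fderiv ℝ (chartAction (G := G) p) (x, y) (c, 0)) := by
  have h1 := (((h_smooth.contMDiff_right ((chartAt F (1 : G)).symm y)).mdifferentiableAt
    (x := (chartAt E p).symm x) (by simp)).hasMFDerivAt).comp x (hasMFDerivAt_chart_symm hz.1)
  have hm : HasFDerivAt (fun x' => chartAction (G := G) p (x', y))
      ((fderiv ℝ (chartAction (G := G) p) (x, y)).comp (ContinuousLinearMap.inl ℝ E F)) x :=
    HasFDerivAt.comp (g := chartAction (G := G) p) x
      (((contDiffAt_chartAction h_smooth hz).differentiableAt (by simp)).hasFDerivAt)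
      (hasFDerivAt_prodMk_left x y)
  have h2 := HasMFDerivAt.comp (g := (chartAt E p).symm) (I' := 𝓘(ℝ, E)) x
    (hasMFDerivAt_chart_symm (x := chartAction (G := G) p (x, y))
      ((chartAt E p).map_source hz.2.2)) hm.hasMFDerivAt
  have h3 : ((fun q : P => q <• ((chartAt F (1 : G)).symm y : G)) ∘ (chartAt E p).symm) =ᶠ[𝓝 x]
      ((chartAt E p).symm ∘ fun x' => chartAction (G := G) p (x', y)) := by
    have hc : ContinuousAt (fun x' : E => (x', y)) x := by fun_prop
    filter_upwards [hc.eventually (eventually_mem_chartActionDomain h_smooth hz)] with x' hx'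
    exact ((chartAt E p).left_inv hx'.2.2).symm
  have h4 := hasMFDerivAt_unique (h2.congr_of_eventuallyEq h3) h1
  exact (congrArg (fun A : E →L[ℝ] E => A c) h4).symm

theorem mfderiv_orbit_chart (h_smooth : IsSmoothAction E F G P) {p : P} {x : E} {y : F}
    (hz : (x, y) ∈ chartActionDomain G p) (η : F) :
    (mfderiv 𝓘(ℝ, F) 𝓘(ℝ, E) (fun g : G => (chartAt E p).symm x <• g)
      ((chartAt F (1 : G)).symm y) : F →L[ℝ] E) (chartSymmDeriv F (1 : G) y η) =
    chartSymmDeriv E p (chartAction (G := G) p (x, y))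
      (fderiv ℝ (chartAction (G := G) p) (x, y) (0, η)) := by
  have h1 := (((h_smooth.contMDiff_orbit ((chartAt E p).symm x)).mdifferentiableAt
    (x := (chartAt F (1 : G)).symm y) (by simp)).hasMFDerivAt).comp y
      (hasMFDerivAt_chart_symm hz.2.1)
  have hm : HasFDerivAt (fun y' => chartAction (G := G) p (x, y'))
      ((fderiv ℝ (chartAction (G := G) p) (x, y)).comp (ContinuousLinearMap.inr ℝ E F)) y :=
    HasFDerivAt.comp (g := chartAction (G := G) p) y
      (((contDiffAt_chartAction h_smooth hz).differentiableAt (by simp)).hasFDerivAt)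
      (hasFDerivAt_prodMk_right x y)
  have h2 := HasMFDerivAt.comp (g := (chartAt E p).symm) (I' := 𝓘(ℝ, E)) y
    (hasMFDerivAt_chart_symm (x := chartAction (G := G) p (x, y))
      ((chartAt E p).map_source hz.2.2)) hm.hasMFDerivAt
  have h3 : ((fun g : G => (chartAt E p).symm x <• g) ∘ (chartAt F (1 : G)).symm) =ᶠ[𝓝 y]
      ((chartAt E p).symm ∘ fun y' => chartAction (G := G) p (x, y')) := by
    have hc : ContinuousAt (fun y' : F => (x, y')) y := by fun_prop
    filter_upwards [hc.eventually (eventually_mem_chartActionDomain h_smooth hz)] with y' hy'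
    exact ((chartAt E p).left_inv hy'.2.2).symm
  have h4 := hasMFDerivAt_unique (h2.congr_of_eventuallyEq h3) h1
  exact (congrArg (fun A : F →L[ℝ] E => A η) h4).symm

end Variation

/-! ### Lie brackets of vector fields in a chart. -/

section Bracket

variable {E : Type*} [NormedAddCommGroup E] [NormedSpace ℝ E]
  {P : Type*} [TopologicalSpace P] [ChartedSpace E P] [IsManifold 𝓘(ℝ, E) ∞ P]

theorem mpullbackWithin_chart_symm {p : P} (V : ∀ q : P, TangentSpace 𝓘(ℝ, E) q) {x : E}
    (hx : x ∈ (chartAt E p).target) :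
    (VectorField.mpullbackWithin 𝓘(ℝ, E) 𝓘(ℝ, E) (extChartAt 𝓘(ℝ, E) p).symm V
      (Set.range 𝓘(ℝ, E)) x : E) =
    chartDeriv E p ((chartAt E p).symm x) (V ((chartAt E p).symm x)) := by
  have h1 : (mfderivWithin 𝓘(ℝ, E) 𝓘(ℝ, E) (extChartAt 𝓘(ℝ, E) p).symm
      (Set.range 𝓘(ℝ, E)) x : E →L[ℝ] E) = chartSymmDeriv E p x := by
    rw [ModelWithCorners.range_eq_univ, mfderivWithin_univ]; rfl
  have h2 : (chartSymmDeriv E p x).inverse = chartDeriv E p ((chartAt E p).symm x) := by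
    refine ContinuousLinearMap.inverse_eq ?_ (chartDeriv_comp_chartSymmDeriv hx)
    have := chartSymmDeriv_comp_chartDeriv ((chartAt E p).map_target hx)
    rwa [(chartAt E p).right_inv hx] at this
  rw [← h2, ← h1]
  rfl

/-- The bracket at `p` is computed in the preferred chart and depends only on germs, so any local
coordinate representatives `v`, `v'` may be used. -/
theorem mlieBracket_chart (p : P) (V V' : ∀ q : P, TangentSpace 𝓘(ℝ, E) q) {v v' : E → E}
    (hv : ∀ᶠ x in 𝓝 (chartAt E p p),
      chartDeriv E p ((chartAt E p).symm x) (V ((chartAt E p).symm x)) = v x)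
    (hv' : ∀ᶠ x in 𝓝 (chartAt E p p),
      chartDeriv E p ((chartAt E p).symm x) (V' ((chartAt E p).symm x)) = v' x) :
    (VectorField.mlieBracket 𝓘(ℝ, E) V V' p : E) =
      chartSymmDeriv E p (chartAt E p p) (fderiv ℝ v' (chartAt E p p) (v (chartAt E p p)) -
        fderiv ℝ v (chartAt E p p) (v' (chartAt E p p))) := by
  have hp := mem_chart_source E p
  have hmem := (chartAt E p).open_target.mem_nhds (mem_chart_target E p)
  let D : E →L[ℝ] E := mfderiv 𝓘(ℝ, E) 𝓘(ℝ, E) (extChartAt 𝓘(ℝ, E) p) p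
  have h0 : D.inverse = chartSymmDeriv E p (chartAt E p p) := by
    change (chartDeriv E p p).inverse = _
    refine ContinuousLinearMap.inverse_eq ?_ (chartSymmDeriv_comp_chartDeriv hp)
    have := chartDeriv_comp_chartSymmDeriv (mem_chart_target E p)
    rwa [(chartAt E p).left_inv hp] at this
  let w : E → E := VectorField.mpullbackWithin 𝓘(ℝ, E) 𝓘(ℝ, E) (extChartAt 𝓘(ℝ, E) p).symm V
    (Set.range 𝓘(ℝ, E))
  let w' : E → E := VectorField.mpullbackWithin 𝓘(ℝ, E) 𝓘(ℝ, E) (extChartAt 𝓘(ℝ, E) p).symm V'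
    (Set.range 𝓘(ℝ, E))
  have h1 : (VectorField.mlieBracket 𝓘(ℝ, E) V V' p : E) = D.inverse
        (VectorField.lieBracketWithin ℝ w w'
          ((extChartAt 𝓘(ℝ, E) p).symm ⁻¹' Set.univ ∩ Set.range 𝓘(ℝ, E)) (chartAt E p p)) :=
    VectorField.mlieBracketWithin_apply
  have h2 : w =ᶠ[𝓝 (chartAt E p p)] v := by
    filter_upwards [hv, hmem] with x hx hxt
    rw [← hx]; exact mpullbackWithin_chart_symm V hxt
  have h3 : w' =ᶠ[𝓝 (chartAt E p p)] v' := by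
    filter_upwards [hv', hmem] with x hx hxt
    rw [← hx]; exact mpullbackWithin_chart_symm V' hxt
  have hset : (extChartAt 𝓘(ℝ, E) p).symm ⁻¹' Set.univ ∩ Set.range 𝓘(ℝ, E) = Set.univ := by
    rw [ModelWithCorners.range_eq_univ, Set.preimage_univ, Set.inter_univ]
  rw [h1, h0, hset, VectorField.lieBracketWithin_univ, h2.lieBracket_vectorField_eq (𝕜 := ℝ) h3]
  rfl

end Bracket

/-! ### The derivative of the pullback as a Lie derivative. -/

section Variation

variable {E : Type*} [NormedAddCommGroup E] [NormedSpace ℝ E]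
  {F : Type*} [NormedAddCommGroup F] [NormedSpace ℝ F]
  {G : Type*} [TopologicalSpace G] [ChartedSpace F G] [Group G] [LieGroup 𝓘(ℝ, F) ∞ G]
  {P : Type*} [TopologicalSpace P] [ChartedSpace E P] [IsManifold 𝓘(ℝ, E) ∞ P]
  [MulAction Gᵐᵒᵖ P]
  {W : Type*} [NormedAddCommGroup W] [NormedSpace ℝ W]

/-- The derivative of the pullback of a form by right translations is its Lie derivative along the
fundamental field. -/
theorem exists_mfderiv_pullbackForm_eq_lieDerivForm (h_smooth : IsSmoothAction E F G P)
    {θ : ∀ p : P, TangentSpace 𝓘(ℝ, E) p →L[ℝ] W} (hθ : IsSmoothForm θ) (p : P) (v : E) (ξ : F) :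
    ∃ (U : Set P) (Y : ∀ q : P, TangentSpace 𝓘(ℝ, E) q), IsOpen U ∧ p ∈ U ∧
      ContMDiffOn 𝓘(ℝ, E) 𝓘(ℝ, E).tangent ∞
        (fun q => (⟨q, Y q⟩ : TangentBundle 𝓘(ℝ, E) P)) U ∧ Y p = v ∧
      (mfderiv 𝓘(ℝ, F) 𝓘(ℝ, W) (fun g : G => pullbackForm θ p g v) 1 : F →L[ℝ] W) ξ =
        lieDerivForm (fundamentalField E (G := G) ξ) θ Y p := by
  set φ := chartAt E p with hφ
  set χ := chartAt F (1 : G) with hχ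
  set x₀ := φ p with hx₀
  set y₀ := χ 1 with hy₀
  set m := chartAction (E := E) (F := F) (G := G) p with hm
  let θ' : P → E →L[ℝ] W := θ
  set c : E := chartDeriv E p p v with hc
  set η : F := chartDeriv F (1 : G) 1 ξ with hη
  have hps : p ∈ φ.source := mem_chart_source E p
  have h1s : (1 : G) ∈ χ.source := mem_chart_source F 1
  have hφp : φ.symm x₀ = p := φ.left_inv hps
  have hχ1 : χ.symm y₀ = 1 := χ.left_inv h1s
  have hv : chartSymmDeriv E p x₀ c = v :=
    congrArg (fun A : E →L[ℝ] E => A v) (chartSymmDeriv_comp_chartDeriv hps)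
  have hξ : chartSymmDeriv F (1 : G) y₀ η = ξ :=
    congrArg (fun A : F →L[ℝ] F => A ξ) (chartSymmDeriv_comp_chartDeriv h1s)
  have hdom : (x₀, y₀) ∈ chartActionDomain G p := mem_chartActionDomain_self p
  let Θ : E × E → W := fun z => θ' (φ.symm z.1) (chartSymmDeriv E p z.1 z.2)
  have hΘ : ∀ w, DifferentiableAt ℝ Θ (x₀, w) := by
    intro w
    have h1 := (contMDiffOn_chartSymmDeriv p).contMDiffAt (x := (x₀, w))
      ((φ.open_target.prod isOpen_univ).mem_nhds ⟨mem_chart_target E p, trivial⟩)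
    have h2 : ContMDiffAt 𝓘(ℝ, E × E) 𝓘(ℝ, W) ∞ Θ (x₀, w) :=
      ContMDiffAt.comp (g := fun x : TangentBundle 𝓘(ℝ, E) P => θ x.proj x.snd) _
        (ContMDiff.contMDiffAt hθ) h1
    exact (contMDiffAt_iff_contDiffAt.1 h2).differentiableAt (by simp)
  have hmy : ∀ x ∈ φ.target, m (x, y₀) = x := by
    intro x hx
    change φ (φ.symm x <• χ.symm y₀) = x
    rw [hχ1, MulOpposite.op_one, one_smul, φ.right_inv hx]
  have htn : ∀ᶠ x in 𝓝 x₀, x ∈ φ.target := φ.open_target.mem_nhds (mem_chart_target E p)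
  have hid : ∀ᶠ x in 𝓝 x₀, m (x, y₀) = x := htn.mono hmy
  let B₀ : E →L[ℝ] W := (θ' p).comp (chartSymmDeriv E p x₀)
  have hB₀ : ∀ w, Θ (x₀, w) = B₀ w := by
    intro w
    change θ' (φ.symm x₀) _ = _
    rw [hφp]; rfl
  obtain ⟨d1, d2, key⟩ := fderiv_pullback_family
    ((contDiffAt_chartAction h_smooth hdom).of_le ENat.LEInfty.out) (hΘ c) B₀ hB₀ hid η
  have hleft : (mfderiv 𝓘(ℝ, F) 𝓘(ℝ, W) (fun g : G => pullbackForm θ p g v) 1 : F →L[ℝ] W) ξ =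
      fderiv ℝ (fun y => Θ (m (x₀, y), fderiv ℝ m (x₀, y) (c, 0))) y₀ η := by
    have h1 := HasMFDerivAt.comp (I' := 𝓘(ℝ, F))
      (g := fun y => Θ (m (x₀, y), fderiv ℝ m (x₀, y) (c, 0)))
      (1 : G) (d1.hasFDerivAt.hasMFDerivAt) (hasMFDerivAt_chart h1s)
    have h2 : (fun g : G => pullbackForm θ p g v) =ᶠ[𝓝 1]
        (fun y => Θ (m (x₀, y), fderiv ℝ m (x₀, y) (c, 0))) ∘ χ := by
      have hcont : ContinuousAt (fun g : G => (x₀, χ g)) 1 :=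
        continuousAt_const.prodMk (χ.continuousAt h1s)
      filter_upwards [χ.open_source.mem_nhds h1s,
        hcont.eventually (eventually_mem_chartActionDomain h_smooth hdom)] with g hg hgd
      have h3 := mfderiv_right_chart h_smooth hgd c
      have hgd3 := hgd.2.2
      change φ.symm x₀ <• χ.symm (χ g) ∈ φ.source at hgd3
      rw [χ.left_inv hg, hφp] at hgd3
      have h5 : φ.symm (m (x₀, χ g)) = p <• g := by
        change φ.symm (φ (φ.symm x₀ <• χ.symm (χ g))) = _
        rw [χ.left_inv hg, hφp, φ.left_inv hgd3]
      rw [χ.left_inv hg, hv, hφp] at h3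
      change θ' (p <• g) _ = θ' (φ.symm (m (x₀, χ g))) _
      rw [h5]
      exact congrArg _ h3
    have h4 := (h1.congr_of_eventuallyEq h2).mfderiv
    exact congrArg (fun A : F →L[ℝ] W => A ξ) h4
  -- The extension of `v` with constant coordinate `c` in the chart: its own derivative then drops
  -- out of the bracket.
  let Y : P → E := fun q => chartSymmDeriv E p (φ q) c
  let X : P → E := fun q => fundamentalField E (G := G) ξ q
  have hX : ∀ᶠ x in 𝓝 x₀, chartDeriv E p (φ.symm x) (X (φ.symm x)) =
      fderiv ℝ m (x, y₀) (0, η) := by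
    have hcont : ContinuousAt (fun x : E => (x, y₀)) x₀ := by fun_prop
    filter_upwards [htn, hcont.eventually (eventually_mem_chartActionDomain h_smooth hdom)]
      with x hx hxd
    have h1 := mfderiv_orbit_chart h_smooth hxd η
    rw [hξ, hχ1] at h1
    have h2 : X (φ.symm x) = chartSymmDeriv E p x (fderiv ℝ m (x, y₀) (0, η)) := by
      have h3 : X (φ.symm x) = chartSymmDeriv E p (m (x, y₀)) (fderiv ℝ m (x, y₀) (0, η)) := h1
      rwa [hmy x hx] at h3
    rw [h2]
    exact congrArg (fun A : E →L[ℝ] E => A (fderiv ℝ m (x, y₀) (0, η)))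
      (chartDeriv_comp_chartSymmDeriv hx)
  have hY : ∀ᶠ x in 𝓝 x₀, chartDeriv E p (φ.symm x) (Y (φ.symm x)) = c := by
    filter_upwards [htn] with x hx
    change chartDeriv E p (φ.symm x) (chartSymmDeriv E p (φ (φ.symm x)) c) = c
    rw [φ.right_inv hx]
    exact congrArg (fun A : E →L[ℝ] E => A c) (chartDeriv_comp_chartSymmDeriv hx)
  have hbr := mlieBracket_chart p X Y hX hY
  refine ⟨φ.source, Y, φ.open_source, hps, ?_, hv, ?_⟩
  · have h1 : ContMDiffOn 𝓘(ℝ, E) 𝓘(ℝ, E × E) ∞ (fun q : P => (φ q, c)) φ.source :=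
      (contMDiffOn_chart (I := 𝓘(ℝ, E)) (n := ∞) (x := p)).prodMk_space contMDiffOn_const
    refine ((contMDiffOn_chartSymmDeriv p).comp h1
      fun q hq => ⟨φ.map_source hq, trivial⟩).congr ?_
    intro q hq
    change (⟨q, Y q⟩ : TangentBundle 𝓘(ℝ, E) P) = ⟨φ.symm (φ q), Y q⟩
    exact congrArg (fun q' => (⟨q', Y q⟩ : TangentBundle 𝓘(ℝ, E) P)) (φ.left_inv hq).symm
  · rw [hleft, key]
    let A : E →L[ℝ] W := mfderiv 𝓘(ℝ, E) 𝓘(ℝ, W) (fun q => θ' q (Y q)) p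
    have h1 : A (X p) = fderiv ℝ (fun x => Θ (x, c)) x₀ (fderiv ℝ m (x₀, y₀) (0, η)) := by
      have hd : DifferentiableAt ℝ (fun x => Θ (x, c)) x₀ :=
        DifferentiableAt.comp (g := Θ) x₀ (hΘ c) (by fun_prop)
      have h2 := HasMFDerivAt.comp (I' := 𝓘(ℝ, E)) (g := fun x => Θ (x, c))
        p (hd.hasFDerivAt.hasMFDerivAt) (hasMFDerivAt_chart hps)
      have h3 : (fun q => θ' q (Y q)) =ᶠ[𝓝 p] (fun x => Θ (x, c)) ∘ φ := by
        filter_upwards [φ.open_source.mem_nhds hps] with q hq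
        change _ = θ' (φ.symm (φ q)) _
        rw [φ.left_inv hq]
      have h4 := (h2.congr_of_eventuallyEq h3).mfderiv
      have h5 := hX.self_of_nhds
      rw [hφp] at h5
      rw [← h5]
      exact congrArg (fun A : E →L[ℝ] W => A (X p)) h4
    -- With `Y` constant in the chart, `[X, Y]` is minus the derivative of `X` along `c`, which
    -- matches the second term of the variation formula.
    have h6 : θ' p (VectorField.mlieBracket 𝓘(ℝ, E) X Y p : E) =
        - B₀ (fderiv ℝ (fun x => fderiv ℝ m (x, y₀) (0, η)) x₀ c) := by
      rw [hbr]
      change B₀ _ = _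
      rw [← map_neg]
      congr 1
      simp only [fderiv_fun_const, Pi.zero_apply, zero_apply, zero_sub]
      rfl
    change _ = A (X p) - θ' p (VectorField.mlieBracket 𝓘(ℝ, E) X Y p : E)
    rw [h1, h6, sub_neg_eq_add]

end Variation

/-! ### Linear differential equations on a Lie group -/

section LeftDeriv

variable {F : Type*} [NormedAddCommGroup F] [NormedSpace ℝ F]
  {G : Type*} [TopologicalSpace G] [ChartedSpace F G] [Group G]
  {A : Type*} [NormedAddCommGroup A] [NormedSpace ℝ A]
  {A' : Type*} [NormedAddCommGroup A'] [NormedSpace ℝ A']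

variable (F) in
/-- The derivative of `f` at `g` along left-invariant vector fields. -/
def leftDeriv (f : G → A) (g : G) : F →L[ℝ] A :=
  mfderiv 𝓘(ℝ, F) 𝓘(ℝ, A) (fun x : G => f (g * x)) 1

variable [LieGroup 𝓘(ℝ, F) ∞ G]

theorem hasMFDerivAt_leftDeriv {f : G → A} (hf : ContMDiff 𝓘(ℝ, F) 𝓘(ℝ, A) ∞ f) (g : G) :
    HasMFDerivAt 𝓘(ℝ, F) 𝓘(ℝ, A) (fun x : G => f (g * x)) 1 (leftDeriv (A := A) F f g) :=
  ((hf.comp contMDiff_mul_left).mdifferentiableAt (by simp)).hasMFDerivAt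

theorem leftDeriv_eq_of_hasFDerivAt {f : G → A} (hf : ContMDiff 𝓘(ℝ, F) 𝓘(ℝ, A) ∞ f) (g : G)
    {Φ : A → A'} {Φ' : A →L[ℝ] A'} (hΦ : HasFDerivAt Φ Φ' (f g)) :
    leftDeriv F (fun x => Φ (f x)) g = Φ'.comp (leftDeriv F f g) := by
  have h1 : HasFDerivAt Φ Φ' (f (g * 1)) := by rwa [mul_one]
  exact (HasMFDerivAt.comp (I' := 𝓘(ℝ, A)) (g := Φ) (1 : G) h1.hasMFDerivAt
    (hasMFDerivAt_leftDeriv hf g)).mfderiv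

/-- Reading `x ↦ f (g * x)` in the chart at `1` makes the product rule of normed spaces available.
-/
theorem hasFDerivAt_leftDeriv {f : G → A} (hf : ContMDiff 𝓘(ℝ, F) 𝓘(ℝ, A) ∞ f) (g : G) :
    HasFDerivAt (fun y : F => f (g * (chartAt F (1 : G)).symm y))
      ((leftDeriv F f g).comp (chartSymmDeriv F (1 : G) (chartAt F (1 : G) 1)))
      (chartAt F (1 : G) 1) := by
  have h1 : HasMFDerivAt 𝓘(ℝ, F) 𝓘(ℝ, A) (fun x : G => f (g * x))
      ((chartAt F (1 : G)).symm (chartAt F (1 : G) 1)) (leftDeriv (A := A) F f g) := by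
    rw [(chartAt F (1 : G)).left_inv (mem_chart_source F 1)]
    exact hasMFDerivAt_leftDeriv hf g
  exact (HasMFDerivAt.comp (I' := 𝓘(ℝ, F)) (g := fun x : G => f (g * x)) _ h1
    (hasMFDerivAt_chart_symm (mem_chart_target F 1))).hasFDerivAt

theorem hasMFDerivAt_zero_of_leftDeriv {f : G → A} (hf : ContMDiff 𝓘(ℝ, F) 𝓘(ℝ, A) ∞ f) (g : G)
    (h : leftDeriv F f g = 0) :
    HasMFDerivAt 𝓘(ℝ, F) 𝓘(ℝ, A) f g (0 : F →L[ℝ] A) := by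
  have h1 : HasMFDerivAt 𝓘(ℝ, F) 𝓘(ℝ, A) (fun x : G => f (g * x)) (g⁻¹ * g)
      (0 : F →L[ℝ] A) := by
    rw [inv_mul_cancel, ← h]
    exact hasMFDerivAt_leftDeriv hf g
  have h2 := HasMFDerivAt.comp (I' := 𝓘(ℝ, F)) (g := fun x : G => f (g * x))
    (f := fun x : G => g⁻¹ * x) g h1
    (((contMDiff_mul_left (I := 𝓘(ℝ, F)) (n := ∞) (a := g⁻¹)).mdifferentiableAt
      (by simp)).hasMFDerivAt)
  have h3 : (fun x : G => f (g * x)) ∘ (fun x : G => g⁻¹ * x) = f := by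
    funext x; simp
  rw [h3] at h2
  exact h2

/-- A function on a connected Lie group with vanishing derivative is constant. -/
theorem eq_of_leftDeriv_eq_zero [ConnectedSpace G] {f : G → A}
    (hf : ContMDiff 𝓘(ℝ, F) 𝓘(ℝ, A) ∞ f) (h : ∀ g, leftDeriv F f g = 0) (g g' : G) :
    f g = f g' := by
  refine IsLocallyConstant.apply_eq_of_preconnectedSpace ?_ g g'
  rw [IsLocallyConstant.iff_eventually_eq]
  intro g
  set φ := chartAt F g with hφ
  have hg : g ∈ φ.source := mem_chart_source F g
  obtain ⟨r, hr, hball⟩ := Metric.isOpen_iff.1 φ.open_target _ (φ.map_source hg)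
  have hd : ∀ y ∈ Metric.ball (φ g) r, HasFDerivAt (f ∘ φ.symm) (0 : F →L[ℝ] A) y := by
    intro y hy
    have h1 := HasMFDerivAt.comp (I' := 𝓘(ℝ, F)) (g := f) y
      (hasMFDerivAt_zero_of_leftDeriv hf (φ.symm y) (h _)) (hasMFDerivAt_chart_symm (hball hy))
    have h2 := h1.hasFDerivAt
    exact h2
  have hconst : ∀ y ∈ Metric.ball (φ g) r, (f ∘ φ.symm) y = (f ∘ φ.symm) (φ g) := by
    intro y hy
    exact (Metric.isOpen_ball).is_const_of_fderiv_eq_zero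
      (convex_ball _ _).isPreconnected
      (fun z hz => (hd z hz).differentiableAt.differentiableWithinAt)
      (fun z hz => (hd z hz).fderiv) hy (Metric.mem_ball_self hr)
  filter_upwards [φ.open_source.mem_nhds hg,
    (φ.continuousAt hg).eventually (Metric.ball_mem_nhds (φ g) hr)] with x hx hxb
  have := hconst (φ x) hxb
  simpa [φ.left_inv hx, φ.left_inv hg] using this

variable {V : Type*} [NormedAddCommGroup V] [NormedSpace ℝ V] [CompleteSpace V]
  {U : Type*} [NormedAddCommGroup U] [NormedSpace ℝ U]

/-- Two solutions of the same linear equation along left-invariant fields differ by a constant. -/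
theorem inverse_comp_eq_of_leftDeriv [ConnectedSpace G] {S : G → V →L[ℝ] V} {T : G → U →L[ℝ] V}
    (hS : ContMDiff 𝓘(ℝ, F) 𝓘(ℝ, V →L[ℝ] V) ∞ S) (hT : ContMDiff 𝓘(ℝ, F) 𝓘(ℝ, U →L[ℝ] V) ∞ T)
    (hunit : ∀ g, IsUnit (S g)) (a : F → V →L[ℝ] V)
    (hS' : ∀ g ξ, leftDeriv F S g ξ = (a ξ).comp (S g))
    (hT' : ∀ g ξ, leftDeriv F T g ξ = (a ξ).comp (T g)) (g g' : G) :
    (Ring.inverse (S g)).comp (T g) = (Ring.inverse (S g')).comp (T g') := by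
  have hu : ContMDiff 𝓘(ℝ, F) 𝓘(ℝ, U →L[ℝ] V) ∞
      (fun g => (Ring.inverse (S g)).comp (T g)) := by
    refine ContMDiff.clm_comp (g := fun g => Ring.inverse (S g)) ?_ hT
    intro g
    obtain ⟨s, hs⟩ := hunit g
    have h1 : ContDiffAt ℝ ∞ (Ring.inverse : (V →L[ℝ] V) → _) (S g) := by
      rw [← hs]; exact contDiffAt_ringInverse ℝ s
    exact h1.contMDiffAt.comp g (hS g)
  refine eq_of_leftDeriv_eq_zero (f := fun g => (Ring.inverse (S g)).comp (T g)) hu ?_ g g'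
  intro g
  obtain ⟨s, hs⟩ := hunit g
  have hg1 : g * (chartAt F (1 : G)).symm ((chartAt F (1 : G)) 1) = g := by
    rw [(chartAt F (1 : G)).left_inv (mem_chart_source F 1), mul_one]
  have dS := hasFDerivAt_leftDeriv hS g
  have dT := hasFDerivAt_leftDeriv hT g
  have dI : HasFDerivAt (Ring.inverse : (V →L[ℝ] V) → _)
      (-ContinuousLinearMap.mulLeftRight ℝ (V →L[ℝ] V) ↑s⁻¹ ↑s⁻¹)
      (S (g * (chartAt F (1 : G)).symm ((chartAt F (1 : G)) 1))) := by
    rw [hg1, ← hs]; exact hasFDerivAt_ringInverse s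
  have dIS := HasFDerivAt.comp (g := Ring.inverse) ((chartAt F (1 : G)) 1) dI dS
  have dU := dIS.clm_comp dT
  have dU' := hasFDerivAt_leftDeriv hu g
  have huniq := dU'.unique dU
  ext1 ξ
  have hξ : chartSymmDeriv F (1 : G) ((chartAt F (1 : G)) 1) (chartDeriv F (1 : G) 1 ξ) = ξ :=
    congrArg (fun A : F →L[ℝ] F => A ξ) (chartSymmDeriv_comp_chartDeriv (mem_chart_source F 1))
  have h1 := congrArg (fun A : F →L[ℝ] (U →L[ℝ] V) => A (chartDeriv F (1 : G) 1 ξ)) huniq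
  have h2 : Ring.inverse (S g) = ↑s⁻¹ := by rw [← hs, Ring.inverse_unit]
  simp only [add_apply, ContinuousLinearMap.comp_apply, neg_apply, Function.comp_apply,
    ContinuousLinearMap.compL_apply, ContinuousLinearMap.flip_apply,
    ContinuousLinearMap.mulLeftRight_apply, hξ, hg1, hS', hT', h2] at h1
  -- The derivative of `S⁻¹ T` is `-S⁻¹ (a S) S⁻¹ T + S⁻¹ (a T)`; after this simplification the two
  -- terms cancel.
  have h3 : (↑s⁻¹ : V →L[ℝ] V) * ((a ξ).comp (S g)) * (↑s⁻¹ : V →L[ℝ] V) =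
      (↑s⁻¹ : V →L[ℝ] V) * a ξ := by
    change (↑s⁻¹ : V →L[ℝ] V) * (a ξ * S g) * (↑s⁻¹ : V →L[ℝ] V) = _
    rw [← hs, mul_assoc, mul_assoc, Units.mul_inv, mul_one]
  rw [h3] at h1
  rw [h1]
  ext u
  simp

end LeftDeriv

/-! ### Operator-valued functions and fundamental fields -/

section OperatorValued

variable {F : Type*} [NormedAddCommGroup F] [NormedSpace ℝ F]
  {G : Type*} [TopologicalSpace G] [ChartedSpace F G]
  {A : Type*} [NormedAddCommGroup A] [NormedSpace ℝ A]
  {U : Type*} [NormedAddCommGroup U] [NormedSpace ℝ U] [FiniteDimensional ℝ U]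

/-- In a basis of the finite-dimensional `U`, an operator is a finite sum of rank-one operators
built from its values on basis vectors. -/
theorem contMDiff_clm_of_apply {f : G → U →L[ℝ] A}
    (hf : ∀ u, ContMDiff 𝓘(ℝ, F) 𝓘(ℝ, A) ∞ (fun g => f g u)) :
    ContMDiff 𝓘(ℝ, F) 𝓘(ℝ, U →L[ℝ] A) ∞ f := by
  let b := Module.finBasis ℝ U
  let l : Fin (Module.finrank ℝ U) → U →L[ℝ] ℝ := fun i =>
    LinearMap.toContinuousLinearMap (b.coord i)
  have h1 : f = fun g => ∑ i, ContinuousLinearMap.smulRightL ℝ U A (l i) (f g (b i)) := by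
    funext g
    ext u
    conv_lhs => rw [← b.sum_repr u, map_sum]
    simp [l]
  rw [h1]
  have h2 : ∀ i, ContMDiff 𝓘(ℝ, F) 𝓘(ℝ, U →L[ℝ] A) ∞
      (fun g => ContinuousLinearMap.smulRightL ℝ U A (l i) (f g (b i))) := fun i =>
    (ContinuousLinearMap.smulRightL ℝ U A (l i)).contMDiff.comp (hf (b i))
  exact contMDiff_finsetSum fun i _ => h2 i

end OperatorValued

/-! ### Right translations of fundamental fields. -/

section FundamentalField

variable {E : Type*} [NormedAddCommGroup E] [NormedSpace ℝ E]
  {F : Type*} [NormedAddCommGroup F] [NormedSpace ℝ F]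
  {G : Type*} [TopologicalSpace G] [ChartedSpace F G] [Group G] [LieGroup 𝓘(ℝ, F) ∞ G]
  {P : Type*} [TopologicalSpace P] [ChartedSpace E P] [MulAction Gᵐᵒᵖ P]

theorem contMDiff_conj (g : G) :
    ContMDiff 𝓘(ℝ, F) 𝓘(ℝ, F) ∞ (fun x : G => g * x * g⁻¹) :=
  (contMDiff_const.mul contMDiff_id).mul contMDiff_const

/-- Right translations act on fundamental fields by the adjoint action. -/
theorem rightTranslate_fundamentalField (h_smooth : IsSmoothAction E F G P) (p : P) (g : G)
    (ξ : F) : rightTranslate E g p (fundamentalField E (G := G) ξ p) =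
      fundamentalField E (G := G) (Ad (F := F) g⁻¹ ξ) (p <• g) := by
  let R : E →L[ℝ] E := mfderiv 𝓘(ℝ, E) 𝓘(ℝ, E) (fun q : P => q <• g) p
  let O : F →L[ℝ] E := mfderiv 𝓘(ℝ, F) 𝓘(ℝ, E) (fun x : G => p <• x) 1
  let O' : F →L[ℝ] E := mfderiv 𝓘(ℝ, F) 𝓘(ℝ, E) (fun x : G => (p <• g) <• x) 1
  let C : F →L[ℝ] F := mfderiv 𝓘(ℝ, F) 𝓘(ℝ, F) (fun x : G => g⁻¹ * x * g⁻¹⁻¹) 1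
  have hR : HasMFDerivAt 𝓘(ℝ, E) 𝓘(ℝ, E) (fun q : P => q <• g) (p <• (1 : G)) R := by
    have e : p <• (1 : G) = p := by simp
    rw [e]
    exact ((h_smooth.contMDiff_right g).mdifferentiableAt (by simp)).hasMFDerivAt
  have hO : HasMFDerivAt 𝓘(ℝ, F) 𝓘(ℝ, E) (fun x : G => p <• x) 1 O :=
    ((h_smooth.contMDiff_orbit p).mdifferentiableAt (by simp)).hasMFDerivAt
  have hO' : HasMFDerivAt 𝓘(ℝ, F) 𝓘(ℝ, E) (fun x : G => (p <• g) <• x) (g⁻¹ * 1 * g⁻¹⁻¹) O' := by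
    have e : g⁻¹ * 1 * g⁻¹⁻¹ = 1 := by simp
    rw [e]
    exact ((h_smooth.contMDiff_orbit (p <• g)).mdifferentiableAt (by simp)).hasMFDerivAt
  have hC : HasMFDerivAt 𝓘(ℝ, F) 𝓘(ℝ, F) (fun x : G => g⁻¹ * x * g⁻¹⁻¹) 1 C :=
    ((contMDiff_conj g⁻¹).mdifferentiableAt (by simp)).hasMFDerivAt
  have h1 := HasMFDerivAt.comp (g := fun q : P => q <• g) (f := fun x : G => p <• x) 1 hR hO
  have h2 := HasMFDerivAt.comp (g := fun x : G => (p <• g) <• x)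
    (f := fun x : G => g⁻¹ * x * g⁻¹⁻¹) 1 hO' hC
  -- The identity `(p · g) · (g⁻¹ x g) = (p · x) · g`, differentiated at `x = 1`.
  have e : (fun x : G => (p <• g) <• x) ∘ (fun x : G => g⁻¹ * x * g⁻¹⁻¹) =
      (fun q : P => q <• g) ∘ (fun x : G => p <• x) := by
    funext x
    simp only [Function.comp_apply]
    rw [← mul_smul, ← mul_smul, ← MulOpposite.op_mul, ← MulOpposite.op_mul]
    simp [mul_assoc]
  rw [e] at h2
  exact congrArg (fun A : F →L[ℝ] E => A ξ) (hasMFDerivAt_unique h1 h2)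

end FundamentalField

/-! ### The holonomy of right translations with respect to a Cartan connection -/

section Transport

variable {E : Type*} [NormedAddCommGroup E] [NormedSpace ℝ E] [FiniteDimensional ℝ E]
  {F : Type*} [NormedAddCommGroup F] [NormedSpace ℝ F] [FiniteDimensional ℝ F]
  {G : Type*} [TopologicalSpace G] [ChartedSpace F G] [Group G] [LieGroup 𝓘(ℝ, F) ∞ G]
  {P : Type*} [TopologicalSpace P] [ChartedSpace E P] [IsManifold 𝓘(ℝ, E) ∞ P]
  [MulAction Gᵐᵒᵖ P] {n : ℕ}
  [LieRingModule (GroupLieAlgebra 𝓘(ℝ, F) G) (EuclideanSpace ℝ (Fin n))]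
  {ϖ : ∀ p : P, TangentSpace 𝓘(ℝ, E) p →L[ℝ] (F × EuclideanSpace ℝ (Fin n))}

/-- A Cartan connection identifies every tangent space with `𝔤 ⋉ ℝⁿ`. -/
def IsGeneralisedCartanConnection.equiv (hϖ : IsGeneralisedCartanConnection G ϖ) (p : P) :
    E ≃L[ℝ] (F × EuclideanSpace ℝ (Fin n)) :=
  let A : E →L[ℝ] (F × EuclideanSpace ℝ (Fin n)) := ϖ p
  (LinearEquiv.ofBijective (A : E →ₗ[ℝ] (F × EuclideanSpace ℝ (Fin n)))
    (hϖ.nondegenerate p)).toContinuousLinearEquiv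

theorem IsGeneralisedCartanConnection.apply_equiv_symm
    (hϖ : IsGeneralisedCartanConnection G ϖ) (p : P) (w : F × EuclideanSpace ℝ (Fin n)) :
    (ϖ p : E →L[ℝ] (F × EuclideanSpace ℝ (Fin n))) ((hϖ.equiv p).symm w) = w :=
  (hϖ.equiv p).apply_symm_apply w

theorem IsGeneralisedCartanConnection.equiv_symm_apply
    (hϖ : IsGeneralisedCartanConnection G ϖ) (p : P) (v : E) :
    (hϖ.equiv p).symm (ϖ p v) = v :=
  (hϖ.equiv p).symm_apply_apply v

/-- The right translation by `g` at `p`, read in the coframe `ϖ`. -/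
def IsGeneralisedCartanConnection.transport (hϖ : IsGeneralisedCartanConnection G ϖ) (p : P)
    (g : G) : (F × EuclideanSpace ℝ (Fin n)) →L[ℝ] (F × EuclideanSpace ℝ (Fin n)) :=
  (pullbackForm ϖ p g).comp ((hϖ.equiv p).symm : (F × EuclideanSpace ℝ (Fin n)) →L[ℝ] E)

theorem IsGeneralisedCartanConnection.apply_rightTranslate
    (hϖ : IsGeneralisedCartanConnection G ϖ) (p : P) (g : G) (v : TangentSpace 𝓘(ℝ, E) p) :
    ϖ (p <• g) (rightTranslate E g p v) = hϖ.transport p g (ϖ p v) := by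
  exact (congrArg (pullbackForm ϖ p g) (hϖ.equiv_symm_apply p v)).symm

theorem IsGeneralisedCartanConnection.transport_of_forall_smul_eq
    (hϖ : IsGeneralisedCartanConnection G ϖ) (p : P) {g : G} (hg : ∀ q : P, q <• g = q) :
    hϖ.transport p g = ContinuousLinearMap.id ℝ _ := by
  have h1 : (fun q : P => q <• g) = id := funext hg
  have h2 : (mfderiv 𝓘(ℝ, E) 𝓘(ℝ, E) (fun q : P => q <• g) p : E →L[ℝ] E) =
      ContinuousLinearMap.id ℝ E := by
    rw [h1]; exact mfderiv_id
  refine ContinuousLinearMap.ext fun w => ?_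
  let ϖ' : P → E →L[ℝ] (F × EuclideanSpace ℝ (Fin n)) := ϖ
  change ϖ' (p <• g) ((mfderiv 𝓘(ℝ, E) 𝓘(ℝ, E) (fun q : P => q <• g) p : E →L[ℝ] E)
    ((hϖ.equiv p).symm w)) = w
  rw [hg p]
  exact (congrArg (fun A : E →L[ℝ] E => ϖ' p (A ((hϖ.equiv p).symm w))) h2).trans
    (hϖ.apply_equiv_symm p w)

theorem IsGeneralisedCartanConnection.transport_one
    (hϖ : IsGeneralisedCartanConnection G ϖ) (p : P) :
    hϖ.transport p 1 = ContinuousLinearMap.id ℝ _ :=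
  hϖ.transport_of_forall_smul_eq p fun q => by simp

theorem IsGeneralisedCartanConnection.transport_mul (h_smooth : IsSmoothAction E F G P)
    (hϖ : IsGeneralisedCartanConnection G ϖ) (p : P) (g h : G) :
    hϖ.transport p (g * h) = (hϖ.transport (p <• g) h).comp (hϖ.transport p g) := by
  refine ContinuousLinearMap.ext fun w => ?_
  change pullbackForm ϖ p (g * h) ((hϖ.equiv p).symm w) = pullbackForm ϖ (p <• g) h
    ((hϖ.equiv (p <• g)).symm (ϖ (p <• g) (rightTranslate E g p ((hϖ.equiv p).symm w))))
  rw [pullbackForm_mul h_smooth]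
  exact (congrArg (pullbackForm ϖ (p <• g) h) (hϖ.equiv_symm_apply (p <• g) _)).symm

theorem IsGeneralisedCartanConnection.contMDiff_transport (h_smooth : IsSmoothAction E F G P)
    (hϖ : IsGeneralisedCartanConnection G ϖ) (p : P) :
    ContMDiff 𝓘(ℝ, F) 𝓘(ℝ, (F × EuclideanSpace ℝ (Fin n)) →L[ℝ] (F × EuclideanSpace ℝ (Fin n))) ∞
      (hϖ.transport p) :=
  contMDiff_clm_of_apply fun w =>
    contMDiff_pullbackForm_apply h_smooth hϖ.smooth p ((hϖ.equiv p).symm w)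

/-- The derivative of the pullback is the Lie derivative of `ϖ`, which the Cartan condition
evaluates as `-ad_ξ`. The right-hand side does not involve `p`, and this drives the uniqueness
argument. -/
theorem IsGeneralisedCartanConnection.leftDeriv_transport_one
    (h_smooth : IsSmoothAction E F G P)
    (hϖ : IsGeneralisedCartanConnection G ϖ) (p : P) (ξ : F)
    (w : F × EuclideanSpace ℝ (Fin n)) :
    leftDeriv F (hϖ.transport p) 1 ξ w = - semidirectBracket G (ξ, 0) w := by
  have h1 := leftDeriv_eq_of_hasFDerivAt (hϖ.contMDiff_transport h_smooth p) 1
    (ContinuousLinearMap.apply ℝ (F × EuclideanSpace ℝ (Fin n)) w).hasFDerivAt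
  have h2 := congrArg (fun A : F →L[ℝ] (F × EuclideanSpace ℝ (Fin n)) => A ξ) h1
  refine h2.symm.trans ?_
  obtain ⟨U, Y, hU, hpU, hY, hYp, hd⟩ := exists_mfderiv_pullbackForm_eq_lieDerivForm (G := G)
    h_smooth hϖ.smooth p ((hϖ.equiv p).symm w) ξ
  have h3 := hϖ.equivariant ξ U Y hU hY p hpU
  rw [hYp] at h3
  have h5 : ϖ p ((hϖ.equiv p).symm w) = w := hϖ.apply_equiv_symm p w
  rw [h5] at h3
  have h4 : (fun x : G => hϖ.transport p (1 * x) w) =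
      fun g : G => pullbackForm ϖ p g ((hϖ.equiv p).symm w) := by
    funext x; rw [one_mul]; rfl
  change (mfderiv 𝓘(ℝ, F) 𝓘(ℝ, F × EuclideanSpace ℝ (Fin n))
    (fun x : G => hϖ.transport p (1 * x) w) 1 : F →L[ℝ] (F × EuclideanSpace ℝ (Fin n))) ξ = _
  rw [h4]
  exact hd.trans (eq_neg_of_add_eq_zero_left h3)

/-- The cocycle identity moves the derivative from `g` to `1` at the point `p · g`, where the
coefficient is the same as at any other point `q`. All transports thus solve one linear equation. -/
theorem IsGeneralisedCartanConnection.leftDeriv_transport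
    (h_smooth : IsSmoothAction E F G P)
    (hϖ : IsGeneralisedCartanConnection G ϖ) (p q : P) (g : G) (ξ : F) :
    leftDeriv F (hϖ.transport p) g ξ =
      (leftDeriv F (hϖ.transport q) 1 ξ).comp (hϖ.transport p g) := by
  have h0 : leftDeriv F (hϖ.transport q) 1 ξ = leftDeriv F (hϖ.transport (p <• g)) 1 ξ := by
    refine ContinuousLinearMap.ext fun w => ?_
    rw [hϖ.leftDeriv_transport_one h_smooth, hϖ.leftDeriv_transport_one h_smooth]
  let R := (ContinuousLinearMap.compL ℝ (F × EuclideanSpace ℝ (Fin n))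
    (F × EuclideanSpace ℝ (Fin n)) (F × EuclideanSpace ℝ (Fin n))).flip (hϖ.transport p g)
  have h1 := leftDeriv_eq_of_hasFDerivAt (hϖ.contMDiff_transport h_smooth (p <• g)) 1 R.hasFDerivAt
  have h2 : leftDeriv F (hϖ.transport p) g =
      leftDeriv F (fun x => R (hϖ.transport (p <• g) x)) 1 := by
    have h3 : (fun x : G => hϖ.transport p (g * x)) =
        fun x : G => R (hϖ.transport (p <• g) (1 * x)) := by
      funext x
      rw [hϖ.transport_mul h_smooth, one_mul]
      rfl
    unfold leftDeriv
    rw [h3]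
  rw [h2, h1, h0]
  rfl

theorem IsGeneralisedCartanConnection.transport_inv_comp (h_smooth : IsSmoothAction E F G P)
    (hϖ : IsGeneralisedCartanConnection G ϖ) (p : P) (g : G) :
    (hϖ.transport (p <• g) g⁻¹).comp (hϖ.transport p g) = ContinuousLinearMap.id ℝ _ := by
  rw [← hϖ.transport_mul h_smooth, mul_inv_cancel, hϖ.transport_one]

theorem IsGeneralisedCartanConnection.isUnit_transport (h_smooth : IsSmoothAction E F G P)
    (hϖ : IsGeneralisedCartanConnection G ϖ) (p : P) (g : G) :
    IsUnit (hϖ.transport p g) := by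
  have h1 := hϖ.transport_inv_comp h_smooth p g
  -- Translating back from `p · g` by `g⁻¹` gives the inverse on the other side.
  have h2 := hϖ.transport_inv_comp h_smooth (p <• g) g⁻¹
  have e : (p <• g) <• g⁻¹ = p := by
    rw [← mul_smul, ← MulOpposite.op_mul, mul_inv_cancel, MulOpposite.op_one, one_smul]
  rw [e, inv_inv] at h2
  exact ⟨⟨hϖ.transport p g, hϖ.transport (p <• g) g⁻¹, h2, h1⟩, rfl⟩

/-- On a connected group the transport does not depend on the base point. -/
theorem IsGeneralisedCartanConnection.transport_eq [ConnectedSpace G]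
    (h_smooth : IsSmoothAction E F G P)
    (hϖ : IsGeneralisedCartanConnection G ϖ) (p q : P) (g : G) :
    hϖ.transport p g = hϖ.transport q g := by
  have h := inverse_comp_eq_of_leftDeriv (hϖ.contMDiff_transport h_smooth p)
    (hϖ.contMDiff_transport h_smooth q) (hϖ.isUnit_transport h_smooth p)
    (fun ξ => leftDeriv F (hϖ.transport p) 1 ξ) (hϖ.leftDeriv_transport h_smooth p p)
    (hϖ.leftDeriv_transport h_smooth q p) g 1
  rw [hϖ.transport_one, hϖ.transport_one] at h
  have h1 : Ring.inverse (hϖ.transport p g) * hϖ.transport q g = 1 := by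
    refine h.trans ?_
    change Ring.inverse (1 : (F × EuclideanSpace ℝ (Fin n)) →L[ℝ]
      (F × EuclideanSpace ℝ (Fin n))) * 1 = 1
    rw [Ring.inverse_one, mul_one]
  have h2 := congrArg (fun A => hϖ.transport p g * A) h1
  simp only [mul_one, ← mul_assoc, Ring.mul_inverse_cancel _ (hϖ.isUnit_transport h_smooth p g),
    one_mul] at h2
  exact h2.symm

end Transport

/-! ### Blocks and inverses of operator-valued functions. -/

section Compress

variable {F : Type*} [NormedAddCommGroup F] [NormedSpace ℝ F]
  {G : Type*} [TopologicalSpace G] [ChartedSpace F G] [Group G] [LieGroup 𝓘(ℝ, F) ∞ G]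

theorem contMDiff_compress {U V W : Type*} [NormedAddCommGroup U] [NormedSpace ℝ U]
    [NormedAddCommGroup V] [NormedSpace ℝ V] [NormedAddCommGroup W] [NormedSpace ℝ W]
    {T : G → W →L[ℝ] W} (hT : ContMDiff 𝓘(ℝ, F) 𝓘(ℝ, W →L[ℝ] W) ∞ T)
    (r : W →L[ℝ] V) (j : U →L[ℝ] W) :
    ContMDiff 𝓘(ℝ, F) 𝓘(ℝ, U →L[ℝ] V) ∞ (fun g => r.comp ((T g).comp j)) ∧
      ∀ g ξ, leftDeriv F (fun g => r.comp ((T g).comp j)) g ξ =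
        r.comp ((leftDeriv F T g ξ).comp j) := by
  let Φ : (W →L[ℝ] W) →L[ℝ] (U →L[ℝ] V) :=
    (ContinuousLinearMap.compL ℝ U W V r).comp ((ContinuousLinearMap.compL ℝ U W W).flip j)
  refine ⟨Φ.contMDiff.comp hT, fun g ξ => ?_⟩
  exact congrArg (fun A : F →L[ℝ] (U →L[ℝ] V) => A ξ)
    (leftDeriv_eq_of_hasFDerivAt hT g (Φ := Φ) Φ.hasFDerivAt)

theorem leftDeriv_inverse_one {V : Type*} [NormedAddCommGroup V] [NormedSpace ℝ V]
    [CompleteSpace V] {τ : G → V →L[ℝ] V} (hτ : ContMDiff 𝓘(ℝ, F) 𝓘(ℝ, V →L[ℝ] V) ∞ τ)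
    (h1 : τ 1 = 1) (ξ : F) :
    leftDeriv F (fun g => Ring.inverse (τ g)) 1 ξ = -leftDeriv F τ 1 ξ := by
  have hd : HasFDerivAt (Ring.inverse : (V →L[ℝ] V) → _)
      (-ContinuousLinearMap.mulLeftRight ℝ (V →L[ℝ] V) 1 1) (τ 1) := by
    rw [h1]
    simpa using hasFDerivAt_ringInverse (𝕜 := ℝ) (1 : (V →L[ℝ] V)ˣ)
  refine (congrArg (fun A : F →L[ℝ] (V →L[ℝ] V) => A ξ)
    (leftDeriv_eq_of_hasFDerivAt hτ 1 hd)).trans ?_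
  change -((1 : V →L[ℝ] V) * leftDeriv F τ 1 ξ * 1) = _
  rw [one_mul, mul_one]

end Compress

/-! ### The representation of a connected group on the translational part -/

section Representation

variable {E : Type*} [NormedAddCommGroup E] [NormedSpace ℝ E] [FiniteDimensional ℝ E]
  {F : Type*} [NormedAddCommGroup F] [NormedSpace ℝ F] [FiniteDimensional ℝ F]
  {G : Type*} [TopologicalSpace G] [ChartedSpace F G] [Group G] [LieGroup 𝓘(ℝ, F) ∞ G]
  {P : Type*} [TopologicalSpace P] [ChartedSpace E P] [IsManifold 𝓘(ℝ, E) ∞ P]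
  [MulAction Gᵐᵒᵖ P] {n : ℕ}
  [LieRingModule (GroupLieAlgebra 𝓘(ℝ, F) G) (EuclideanSpace ℝ (Fin n))]
  {ϖ : ∀ p : P, TangentSpace 𝓘(ℝ, E) p →L[ℝ] (F × EuclideanSpace ℝ (Fin n))}

/-- The vector `(ξ, 0)` is the value of `ϖ` on a fundamental field, and right translation by `g`
turns that field into the one of `Ad_{g⁻¹} ξ`. -/
theorem IsGeneralisedCartanConnection.transport_inl (h_smooth : IsSmoothAction E F G P)
    (hϖ : IsGeneralisedCartanConnection G ϖ) (p : P) (g : G) (ξ : F) :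
    hϖ.transport p g (ξ, 0) = (Ad (F := F) g⁻¹ ξ, 0) := by
  have h1 := hϖ.apply_rightTranslate p g (fundamentalField E (G := G) ξ p)
  rw [hϖ.normalised, rightTranslate_fundamentalField h_smooth] at h1
  exact h1.symm.trans (hϖ.normalised _ _)

theorem IsGeneralisedCartanConnection.transport_mul_of_connected [ConnectedSpace G]
    (h_smooth : IsSmoothAction E F G P)
    (hϖ : IsGeneralisedCartanConnection G ϖ) (p : P) (g h : G) :
    hϖ.transport p (g * h) = (hϖ.transport p h).comp (hϖ.transport p g) := by
  rw [hϖ.transport_mul h_smooth, hϖ.transport_eq h_smooth (p <• g) p]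

/-- The `𝔤`-component of `ad_ξ w` depends only on the `𝔤`-component of `w`. So the block `ℝⁿ → 𝔤`
obeys the same linear equation as the invertible block `𝔤 → 𝔤`; it is zero at `1` and hence
everywhere. -/
theorem IsGeneralisedCartanConnection.fst_transport_inr [ConnectedSpace G]
    (h_smooth : IsSmoothAction E F G P)
    (hϖ : IsGeneralisedCartanConnection G ϖ) (p : P) (g : G) (v : EuclideanSpace ℝ (Fin n)) :
    (hϖ.transport p g (0, v)).1 = 0 := by
  have := FiniteDimensional.complete ℝ F
  let V := EuclideanSpace ℝ (Fin n)
  let r := ContinuousLinearMap.fst ℝ F V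
  let i := ContinuousLinearMap.inl ℝ F V
  let j := ContinuousLinearMap.inr ℝ F V
  let T := hϖ.transport p
  have hT := hϖ.contMDiff_transport h_smooth p
  let S : G → F →L[ℝ] F := fun g => r.comp ((T g).comp i)
  let a : F → F →L[ℝ] F := fun ξ => r.comp ((leftDeriv F T 1 ξ).comp i)
  have ha : ∀ ξ w, (leftDeriv F T 1 ξ w).1 = a ξ w.1 := by
    intro ξ w
    change _ = (leftDeriv F T 1 ξ (w.1, 0)).1
    rw [hϖ.leftDeriv_transport_one h_smooth, hϖ.leftDeriv_transport_one h_smooth]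
    rfl
  have hS : ∀ g ξ, T g (ξ, 0) = (S g ξ, 0) := by
    intro g ξ
    have h1 := congrArg Prod.snd (hϖ.transport_inl h_smooth p g ξ)
    exact Prod.ext rfl h1
  have hmul : ∀ g h, S (g * h) = S h * S g := by
    intro g h
    refine ContinuousLinearMap.ext fun ξ => ?_
    change (T (g * h) (ξ, 0)).1 = (T h (S g ξ, 0)).1
    rw [← hS]
    exact congrArg (fun A : (F × V) →L[ℝ] (F × V) => (A (ξ, 0)).1)
      (hϖ.transport_mul_of_connected h_smooth p g h)
  have hone : S 1 = 1 := by
    refine ContinuousLinearMap.ext fun ξ => ?_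
    exact congrArg (fun A : (F × V) →L[ℝ] (F × V) => (A (ξ, 0)).1) (hϖ.transport_one p)
  have hunit : ∀ g, IsUnit (S g) := fun g =>
    ⟨⟨S g, S g⁻¹, by rw [← hmul, inv_mul_cancel, hone], by rw [← hmul, mul_inv_cancel, hone]⟩, rfl⟩
  have hd : ∀ (g : G) (ξ : F), (r.comp (leftDeriv F T g ξ)) = (a ξ).comp (r.comp (T g)) := by
    intro g ξ
    rw [hϖ.leftDeriv_transport h_smooth p p]
    exact ContinuousLinearMap.ext fun w => ha ξ (T g w)
  obtain ⟨h1, h1'⟩ := contMDiff_compress hT r i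
  obtain ⟨h2, h2'⟩ := contMDiff_compress hT r j
  have key := inverse_comp_eq_of_leftDeriv h1 h2 hunit a
    (fun g ξ => (h1' g ξ).trans (congrArg (fun A : (F × V) →L[ℝ] F => A.comp i) (hd g ξ)))
    (fun g ξ => (h2' g ξ).trans (congrArg (fun A : (F × V) →L[ℝ] F => A.comp j) (hd g ξ))) g 1
  have h0 : r.comp ((T 1).comp j) = 0 := by
    refine ContinuousLinearMap.ext fun w => ?_
    exact congrArg (fun A : (F × V) →L[ℝ] (F × V) => (A (0, w)).1) (hϖ.transport_one p)
  rw [h0, ContinuousLinearMap.comp_zero] at key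
  have h3 := congrArg (fun A : V →L[ℝ] F => S g (A v)) key
  have h4 : S g * Ring.inverse (S g) = 1 := Ring.mul_inverse_cancel _ (hunit g)
  have h5 := congrArg (fun A : F →L[ℝ] F => A (hϖ.transport p g (0, v)).1) h4
  refine h5.symm.trans (h3.trans ?_)
  simp

/-- The action of right translation on the translational part. -/
def IsGeneralisedCartanConnection.translationPart (hϖ : IsGeneralisedCartanConnection G ϖ)
    (p : P) (g : G) : EuclideanSpace ℝ (Fin n) →L[ℝ] EuclideanSpace ℝ (Fin n) :=
  (ContinuousLinearMap.snd ℝ F _).comp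
    ((hϖ.transport p g).comp (ContinuousLinearMap.inr ℝ F (EuclideanSpace ℝ (Fin n))))

theorem IsGeneralisedCartanConnection.transport_apply [ConnectedSpace G]
    (h_smooth : IsSmoothAction E F G P)
    (hϖ : IsGeneralisedCartanConnection G ϖ) (p : P) (g : G)
    (w : F × EuclideanSpace ℝ (Fin n)) :
    hϖ.transport p g w = (Ad (F := F) g⁻¹ w.1, hϖ.translationPart p g w.2) := by
  have h1 : w = (w.1, 0) + (0, w.2) := by simp
  have h2 : hϖ.transport p g (0, w.2) = (0, hϖ.translationPart p g w.2) :=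
    Prod.ext (hϖ.fst_transport_inr h_smooth p g w.2) rfl
  conv_lhs => rw [h1, map_add, hϖ.transport_inl h_smooth, h2]
  exact Prod.ext (add_zero _) (zero_add _)

theorem IsGeneralisedCartanConnection.translationPart_one
    (hϖ : IsGeneralisedCartanConnection G ϖ) (p : P) : hϖ.translationPart p 1 = 1 := by
  refine ContinuousLinearMap.ext fun v => ?_
  change (hϖ.transport p 1 (0, v)).2 = v
  rw [hϖ.transport_one]
  rfl

theorem IsGeneralisedCartanConnection.translationPart_mul [ConnectedSpace G]
    (h_smooth : IsSmoothAction E F G P)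
    (hϖ : IsGeneralisedCartanConnection G ϖ) (p : P) (g h : G) :
    hϖ.translationPart p (g * h) = hϖ.translationPart p h * hϖ.translationPart p g := by
  refine ContinuousLinearMap.ext fun v => ?_
  change (hϖ.transport p (g * h) (0, v)).2 = (hϖ.transport p h (0, (hϖ.transport p g (0, v)).2)).2
  have h1 : hϖ.transport p g (0, v) = (0, (hϖ.transport p g (0, v)).2) :=
    Prod.ext (hϖ.fst_transport_inr h_smooth p g v) rfl
  rw [← h1, hϖ.transport_mul_of_connected h_smooth]
  rfl

/-- The representation of a connected group on `ℝⁿ` defined by a Cartan connection. -/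
def IsGeneralisedCartanConnection.representation [ConnectedSpace G]
    (hϖ : IsGeneralisedCartanConnection G ϖ) (h_smooth : IsSmoothAction E F G P) (p : P) :
    G →* (EuclideanSpace ℝ (Fin n) →L[ℝ] EuclideanSpace ℝ (Fin n)) where
  -- Right translations compose in reverse order; the inverse restores a homomorphism.
  toFun g := hϖ.translationPart p g⁻¹
  map_one' := by rw [inv_one, hϖ.translationPart_one]
  map_mul' g h := by rw [mul_inv_rev, hϖ.translationPart_mul h_smooth]

theorem IsGeneralisedCartanConnection.contMDiff_translationPart
    (h_smooth : IsSmoothAction E F G P) (hϖ : IsGeneralisedCartanConnection G ϖ) (p : P) :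
    ContMDiff 𝓘(ℝ, F) 𝓘(ℝ, EuclideanSpace ℝ (Fin n) →L[ℝ] EuclideanSpace ℝ (Fin n)) ∞
      (hϖ.translationPart p) :=
  (contMDiff_compress (hϖ.contMDiff_transport h_smooth p) (ContinuousLinearMap.snd ℝ F _)
    (ContinuousLinearMap.inr ℝ F (EuclideanSpace ℝ (Fin n)))).1

theorem IsGeneralisedCartanConnection.contMDiff_representation [ConnectedSpace G]
    (hϖ : IsGeneralisedCartanConnection G ϖ) (h_smooth : IsSmoothAction E F G P) (p : P) :
    ContMDiff 𝓘(ℝ, F) 𝓘(ℝ, EuclideanSpace ℝ (Fin n) →L[ℝ] EuclideanSpace ℝ (Fin n)) ∞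
      (hϖ.representation h_smooth p) :=
  (hϖ.contMDiff_translationPart h_smooth p).comp (contMDiff_inv 𝓘(ℝ, F) ∞)

theorem IsGeneralisedCartanConnection.leftDeriv_translationPart
    (h_smooth : IsSmoothAction E F G P) (hϖ : IsGeneralisedCartanConnection G ϖ) (p : P)
    (ξ : GroupLieAlgebra 𝓘(ℝ, F) G) (v : EuclideanSpace ℝ (Fin n)) :
    leftDeriv F (hϖ.translationPart p) 1 ξ v = -⁅ξ, v⁆ := by
  have h1 := (contMDiff_compress (hϖ.contMDiff_transport h_smooth p)
    (ContinuousLinearMap.snd ℝ F _)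
    (ContinuousLinearMap.inr ℝ F (EuclideanSpace ℝ (Fin n)))).2 1 ξ
  refine (congrArg (fun A : EuclideanSpace ℝ (Fin n) →L[ℝ] EuclideanSpace ℝ (Fin n) => A v)
    h1).trans ?_
  refine (congrArg Prod.snd (hϖ.leftDeriv_transport_one h_smooth p ξ (0, v))).trans ?_
  change -(⁅ξ, v⁆ - ⁅(0 : GroupLieAlgebra 𝓘(ℝ, F) G), (0 : EuclideanSpace ℝ (Fin n))⁆) = _
  rw [lie_zero, sub_zero]

theorem IsGeneralisedCartanConnection.infinitesimalRep_representation [ConnectedSpace G]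
    (hϖ : IsGeneralisedCartanConnection G ϖ) (h_smooth : IsSmoothAction E F G P) (p : P)
    (ξ : GroupLieAlgebra 𝓘(ℝ, F) G) (v : EuclideanSpace ℝ (Fin n)) :
    infinitesimalRep (fun g : G => hϖ.representation h_smooth p g) ξ v = ⁅ξ, v⁆ := by
  -- With `g⁻¹` replaced by operator inversion, differentiation at `1` only changes the sign `-ξ` of
  -- the translational block to `ξ`.
  have hinv : ∀ g : G, hϖ.representation h_smooth p g = Ring.inverse (hϖ.translationPart p g) := by
    intro g
    have h1 : hϖ.translationPart p g * hϖ.translationPart p g⁻¹ = 1 := by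
      rw [← hϖ.translationPart_mul h_smooth, inv_mul_cancel, hϖ.translationPart_one]
    have h2 : hϖ.translationPart p g⁻¹ * hϖ.translationPart p g = 1 := by
      rw [← hϖ.translationPart_mul h_smooth, mul_inv_cancel, hϖ.translationPart_one]
    exact (Ring.inverse_unit (⟨_, _, h1, h2⟩ :
      (EuclideanSpace ℝ (Fin n) →L[ℝ] EuclideanSpace ℝ (Fin n))ˣ)).symm
  have h2 : (fun g : G => hϖ.representation h_smooth p g) =
      fun g : G => Ring.inverse (hϖ.translationPart p (1 * g)) := by
    funext g; rw [hinv, one_mul]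
  rw [h2]
  refine (congrArg (fun A : EuclideanSpace ℝ (Fin n) →L[ℝ] EuclideanSpace ℝ (Fin n) => A v)
    (leftDeriv_inverse_one (hϖ.contMDiff_translationPart h_smooth p)
      (hϖ.translationPart_one p) ξ)).trans ?_
  exact (congrArg (fun w : EuclideanSpace ℝ (Fin n) => -w)
    (hϖ.leftDeriv_translationPart h_smooth p ξ v)).trans (neg_neg _)

theorem IsGeneralisedCartanConnection.representation_of_forall_smul_eq [ConnectedSpace G]
    (hϖ : IsGeneralisedCartanConnection G ϖ) (h_smooth : IsSmoothAction E F G P) (p : P)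
    {g : G} (hg : ∀ q : P, q <• g = q) : hϖ.representation h_smooth p g = 1 := by
  refine ContinuousLinearMap.ext fun v => ?_
  change (hϖ.transport p g⁻¹ (0, v)).2 = v
  have hg' : ∀ q : P, q <• g⁻¹ = q := fun q => by
    conv_lhs => rw [← hg q]
    rw [← mul_smul, ← MulOpposite.op_mul, mul_inv_cancel, MulOpposite.op_one, one_smul]
  rw [hϖ.transport_of_forall_smul_eq p hg']
  rfl

end Representation

/-! ### Isotropy groups -/

section Isotropy

theorem mem_isotropy {G P : Type*} [Group G] [MulAction Gᵐᵒᵖ P] {p : P} {g : G} :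
    g ∈ isotropy G p ↔ p <• g = p := Iff.rfl

theorem IsProperAction.isCompact_isotropy {G P : Type*} [Group G] [TopologicalSpace G]
    [TopologicalSpace P] [MulAction Gᵐᵒᵖ P] (h_proper : IsProperAction G P) (p : P) :
    IsCompact (isotropy G p : Set G) := by
  have h1 := (h_proper {(p, p)} isCompact_singleton).image continuous_snd
  convert h1 using 1
  ext g
  constructor
  · intro hg
    exact ⟨(p, g), Prod.ext rfl (mem_isotropy.1 hg), rfl⟩
  · rintro ⟨⟨q, g⟩, h, rfl⟩
    obtain ⟨rfl, h2⟩ := Prod.mk.inj h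
    exact mem_isotropy.2 h2

theorem finite_of_isCompact_of_discrete {G : Type*} [Group G] [TopologicalSpace G]
    [IsTopologicalGroup G] {K : Subgroup G} (hc : IsCompact (K : Set G))
    (hK : ∃ U ∈ 𝓝 (1 : G), ∀ k ∈ K, k ∈ U → k = 1) : Finite K := by
  have : CompactSpace K := isCompact_iff_compactSpace.1 hc
  have : DiscreteTopology K := by
    refine discreteTopology_of_isOpen_singleton_one ?_
    obtain ⟨U, hU, h⟩ := hK
    obtain ⟨V, hVU, hV, h1⟩ := mem_nhds_iff.1 hU
    refine ⟨V, hV, ?_⟩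
    ext k
    constructor
    · intro hk
      exact Subtype.ext (h k k.2 (hVU hk))
    · rintro rfl
      exact h1
  exact finite_of_compact_of_discrete

theorem HasSingleOrbitType.isotropy_eq {G P : Type*} [Group G] [MulAction Gᵐᵒᵖ P]
    (h_type : HasSingleOrbitType G P) (hn : ∀ p : P, (isotropy G p).Normal) (p q : P) :
    isotropy G q = isotropy G p := by
  obtain ⟨g, hg⟩ := h_type p q
  have := hn p
  exact hg.trans (Subgroup.Normal.map_conj_eq (isotropy G p) g)

end Isotropy

/-! ### The action of a quotient group -/

section QuotientAction

variable {G P : Type*} [Group G] [MulAction Gᵐᵒᵖ P] {K : Subgroup G} [K.Normal]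

/-- The right action of `G ⧸ K` induced by a right action of `G` for which `K` acts trivially. -/
abbrev quotientAction (hK : ∀ k ∈ K, ∀ p : P, p <• k = p) : MulAction (G ⧸ K)ᵐᵒᵖ P where
  smul h p := Quotient.liftOn' h.unop (fun g : G => p <• g) fun a b hab => by
    have h1 : a⁻¹ * b ∈ K := QuotientGroup.leftRel_apply.1 hab
    have h2 := hK _ h1 (p <• a)
    rw [← mul_smul, ← MulOpposite.op_mul, mul_inv_cancel_left] at h2
    exact h2.symm
  one_smul p := one_smul Gᵐᵒᵖ p
  mul_smul a b p := by
    induction a with | _ a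
    induction b with | _ b
    induction a using QuotientGroup.induction_on with | _ a
    induction b using QuotientGroup.induction_on with | _ b
    exact mul_smul (MulOpposite.op a) (MulOpposite.op b) p

variable [MulAction (G ⧸ K)ᵐᵒᵖ P]

theorem isFreeAction_quotient
    (hact : ∀ (p : P) (g : G), p <• (QuotientGroup.mk g : G ⧸ K) = p <• g)
    (hK : ∀ p : P, isotropy G p = K) : IsFreeAction (G ⧸ K) P := by
  intro p h hp
  obtain ⟨g, rfl⟩ := QuotientGroup.mk_surjective h
  rw [hact] at hp
  rw [QuotientGroup.eq_one_iff, ← hK p]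
  exact mem_isotropy.2 hp

/-- The preimage of `C` for `G ⧸ K` is the image of its preimage for `G`, and continuous images of
compact sets are compact. -/
theorem IsProperAction.quotient [TopologicalSpace G] [TopologicalSpace P]
    (h_proper : IsProperAction G P)
    (hact : ∀ (p : P) (g : G), p <• (QuotientGroup.mk g : G ⧸ K) = p <• g) : IsProperAction (G ⧸ K) P := by
  intro C hC
  have h1 := (h_proper C hC).image
    (f := fun x : P × G => (x.1, (QuotientGroup.mk x.2 : G ⧸ K)))
    (continuous_fst.prodMk (QuotientGroup.continuous_mk.comp continuous_snd))
  convert h1 using 1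
  ext ⟨p, h⟩
  obtain ⟨g, rfl⟩ := QuotientGroup.mk_surjective h
  constructor
  · intro h2
    refine ⟨(p, g), ?_, rfl⟩
    change (p, p <• (QuotientGroup.mk g : G ⧸ K)) ∈ C at h2
    rw [hact] at h2
    exact h2
  · rintro ⟨⟨q, g'⟩, h2, he⟩
    obtain ⟨rfl, h3⟩ := Prod.mk.inj he
    change (q, q <• (QuotientGroup.mk g : G ⧸ K)) ∈ C
    rw [← h3, hact]
    exact h2

end QuotientAction

theorem faithfulSMul_of_isFreeAction {H P : Type*} [Group H] [MulAction Hᵐᵒᵖ P] [Nonempty P]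
    (h_free : IsFreeAction H P) : FaithfulSMul Hᵐᵒᵖ P := by
  refine ⟨fun {a b} hab => ?_⟩
  obtain ⟨p⟩ := ‹Nonempty P›
  have h1 : p <• (b.unop * a.unop⁻¹) = p := by
    rw [MulOpposite.op_mul, mul_smul, MulOpposite.op_unop, ← hab p, MulOpposite.op_inv,
      MulOpposite.op_unop, inv_smul_smul]
  have h2 := mul_inv_eq_one.1 (h_free p _ h1)
  exact (MulOpposite.unop_injective h2).symm

/-- The two translated vectors sit over points that are equal only through `hact`. An arbitrary
family `θ` over the base points absorbs this change of base point. -/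
theorem rightTranslate_quotientMk {E : Type*} [NormedAddCommGroup E] [NormedSpace ℝ E]
    {G P : Type*} [Group G] [TopologicalSpace P] [ChartedSpace E P] [MulAction Gᵐᵒᵖ P]
    {K : Subgroup G} [K.Normal] [MulAction (G ⧸ K)ᵐᵒᵖ P]
    (hact : ∀ (p : P) (g : G), p <• (QuotientGroup.mk g : G ⧸ K) = p <• g) (p : P) (g : G)
    {A : Type*} (θ : P → E → A) (v : E) :
    θ (p <• (QuotientGroup.mk g : G ⧸ K))
        (rightTranslate E (QuotientGroup.mk g : G ⧸ K) p v : E) =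
      θ (p <• g) (rightTranslate E g p v : E) := by
  have h1 : (fun q : P => q <• (QuotientGroup.mk g : G ⧸ K)) = fun q : P => q <• g :=
    funext fun q => hact q g
  have h2 : (mfderiv 𝓘(ℝ, E) 𝓘(ℝ, E) (fun q : P => q <• (QuotientGroup.mk g : G ⧸ K)) p :
      E →L[ℝ] E) = (mfderiv 𝓘(ℝ, E) 𝓘(ℝ, E) (fun q : P => q <• g) p : E →L[ℝ] E) := by
    rw [h1]
  have h3 := congrArg (fun A : E →L[ℝ] E => A v) h2
  rw [hact]
  exact congrArg (θ (p <• g)) h3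

/-! ### Smooth maps out of a quotient group -/

section SmoothQuotient

variable {E : Type*} [NormedAddCommGroup E] [NormedSpace ℝ E]
  {F : Type*} [NormedAddCommGroup F] [NormedSpace ℝ F]
  {G : Type*} [TopologicalSpace G] [ChartedSpace F G] [Group G]
  {P : Type*} [TopologicalSpace P] [ChartedSpace E P] [MulAction Gᵐᵒᵖ P]
  {K : Subgroup G} [ChartedSpace F (G ⧸ K)]

theorem contMDiff_of_comp_quotientMk {A : Type*} [NormedAddCommGroup A] [NormedSpace ℝ A]
    (hmk : IsLocalDiffeomorph 𝓘(ℝ, F) 𝓘(ℝ, F) ∞ (QuotientGroup.mk : G → G ⧸ K))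
    {f : G ⧸ K → A} (hf : ContMDiff 𝓘(ℝ, F) 𝓘(ℝ, A) ∞ fun g : G => f (QuotientGroup.mk g)) :
    ContMDiff 𝓘(ℝ, F) 𝓘(ℝ, A) ∞ f := by
  intro h
  obtain ⟨g, rfl⟩ := QuotientGroup.mk_surjective h
  have h1 := hf.contMDiffAt.comp _ (hmk g).localInverse_contMDiffAt
  refine h1.congr_of_eventuallyEq ?_
  filter_upwards [(hmk g).localInverse_eventuallyEq_right] with y hy
  exact congrArg f hy.symm

theorem bijective_lieQuotient
    (hmk : IsLocalDiffeomorph 𝓘(ℝ, F) 𝓘(ℝ, F) ∞ (QuotientGroup.mk : G → G ⧸ K)) :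
    Function.Bijective (lieQuotient F K) :=
  ((hmk 1).mfderivToContinuousLinearEquiv (by simp)).bijective

variable [K.Normal] [MulAction (G ⧸ K)ᵐᵒᵖ P]

theorem IsSmoothAction.quotient (h_smooth : IsSmoothAction E F G P)
    (hmk : IsLocalDiffeomorph 𝓘(ℝ, F) 𝓘(ℝ, F) ∞ (QuotientGroup.mk : G → G ⧸ K))
    (hact : ∀ (p : P) (g : G), p <• (QuotientGroup.mk g : G ⧸ K) = p <• g) :
    IsSmoothAction E F (G ⧸ K) P := by
  rintro ⟨p, h⟩
  obtain ⟨g, rfl⟩ := QuotientGroup.mk_surjective h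
  have h1 : ContMDiffAt (𝓘(ℝ, E).prod 𝓘(ℝ, F)) (𝓘(ℝ, E).prod 𝓘(ℝ, F)) ∞
      (fun x : P × (G ⧸ K) => (x.1, (hmk g).localInverse x.2)) (p, QuotientGroup.mk g) :=
    contMDiffAt_fst.prodMk (ContMDiffAt.comp (p, (QuotientGroup.mk g : G ⧸ K))
      (hmk g).localInverse_contMDiffAt contMDiffAt_snd)
  have h2 := ContMDiffAt.comp (g := fun x : P × G => x.1 <• x.2)
    (p, (QuotientGroup.mk g : G ⧸ K)) (ContMDiff.contMDiffAt h_smooth) h1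
  refine h2.congr_of_eventuallyEq ?_
  filter_upwards [(hmk g).localInverse_eventuallyEq_right.prod_inr_nhds p] with x hx
  have h3 : (QuotientGroup.mk ((hmk g).localInverse x.2) : G ⧸ K) = x.2 := hx
  change x.1 <• x.2 = x.1 <• ((hmk g).localInverse x.2)
  rw [← hact, h3]

theorem orbitDeriv_lieQuotient (h_smooth : IsSmoothAction E F (G ⧸ K) P)
    (hmk : IsLocalDiffeomorph 𝓘(ℝ, F) 𝓘(ℝ, F) ∞ (QuotientGroup.mk : G → G ⧸ K))
    (hact : ∀ (p : P) (g : G), p <• (QuotientGroup.mk g : G ⧸ K) = p <• g) (p : P) :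
    (orbitDeriv E F (G ⧸ K) p).comp (lieQuotient F K) = orbitDeriv E F G p := by
  have h1 : HasMFDerivAt 𝓘(ℝ, F) 𝓘(ℝ, E) (fun h : G ⧸ K => p <• h) (QuotientGroup.mk (1 : G))
      (orbitDeriv E F (G ⧸ K) p) :=
    ((h_smooth.contMDiff_orbit p).mdifferentiableAt (x := (1 : G ⧸ K)) (by simp)).hasMFDerivAt
  have h2 : HasMFDerivAt 𝓘(ℝ, F) 𝓘(ℝ, F) (QuotientGroup.mk : G → G ⧸ K) 1 (lieQuotient F K) :=
    ((hmk 1).contMDiffAt.mdifferentiableAt (by simp)).hasMFDerivAt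
  have h3 := (HasMFDerivAt.comp (g := fun h : G ⧸ K => p <• h) (1 : G) h1 h2).mfderiv
  have h4 : (fun h : G ⧸ K => p <• h) ∘ (QuotientGroup.mk : G → G ⧸ K) = fun g : G => p <• g :=
    funext fun g => hact p g
  rw [h4] at h3
  exact h3.symm

/-- The projection intertwines the conjugations by `g` and by its class; differentiate this at `1`.
-/
theorem lieQuotient_Ad [LieGroup 𝓘(ℝ, F) ∞ G] [LieGroup 𝓘(ℝ, F) ∞ (G ⧸ K)]
    (hmk : IsLocalDiffeomorph 𝓘(ℝ, F) 𝓘(ℝ, F) ∞ (QuotientGroup.mk : G → G ⧸ K))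
    (g : G) (ξ : F) : lieQuotient F K (Ad (F := F) g ξ) =
      Ad (F := F) (QuotientGroup.mk g : G ⧸ K) (lieQuotient F K ξ) := by
  let A : F →L[ℝ] F := mfderiv 𝓘(ℝ, F) 𝓘(ℝ, F) (fun x : G => g * x * g⁻¹) 1
  let h : G ⧸ K := QuotientGroup.mk g
  let A' : F →L[ℝ] F := mfderiv 𝓘(ℝ, F) 𝓘(ℝ, F) (fun x : G ⧸ K => h * x * h⁻¹) 1
  have hq : HasMFDerivAt 𝓘(ℝ, F) 𝓘(ℝ, F) (QuotientGroup.mk : G → G ⧸ K) 1 (lieQuotient F K) :=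
    ((hmk 1).contMDiffAt.mdifferentiableAt (by simp)).hasMFDerivAt
  have hq' : HasMFDerivAt 𝓘(ℝ, F) 𝓘(ℝ, F) (QuotientGroup.mk : G → G ⧸ K) (g * 1 * g⁻¹)
      (lieQuotient F K) := by
    rw [mul_one, mul_inv_cancel]; exact hq
  have hA : HasMFDerivAt 𝓘(ℝ, F) 𝓘(ℝ, F) (fun x : G => g * x * g⁻¹) 1 A :=
    ((contMDiff_conj g).mdifferentiableAt (by simp)).hasMFDerivAt
  have hA' : HasMFDerivAt 𝓘(ℝ, F) 𝓘(ℝ, F) (fun x : G ⧸ K => h * x * h⁻¹)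
      (QuotientGroup.mk (1 : G)) A' :=
    ((contMDiff_conj h).mdifferentiableAt (x := 1) (by simp)).hasMFDerivAt
  have h1 := HasMFDerivAt.comp (g := (QuotientGroup.mk : G → G ⧸ K)) (1 : G) hq' hA
  have h2 := HasMFDerivAt.comp (g := fun x : G ⧸ K => h * x * h⁻¹) (1 : G) hA' hq
  exact congrArg (fun A : F →L[ℝ] F => A ξ) (hasMFDerivAt_unique h1 h2)

end SmoothQuotient

/-! ### The components of a generalised Cartan connection -/

theorem IsSmoothForm.clm_comp {E : Type*} [NormedAddCommGroup E]
    [NormedSpace ℝ E] {P : Type*} [TopologicalSpace P] [ChartedSpace E P]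
    [IsManifold 𝓘(ℝ, E) ∞ P] {W W' : Type*} [NormedAddCommGroup W] [NormedSpace ℝ W]
    [NormedAddCommGroup W'] [NormedSpace ℝ W']
    {θ : ∀ p : P, TangentSpace 𝓘(ℝ, E) p →L[ℝ] W} (hθ : IsSmoothForm θ) (A : W →L[ℝ] W') :
    IsSmoothForm (fun p => A.comp (θ p)) :=
  A.contMDiff.comp hθ

section Components

variable {E : Type*} [NormedAddCommGroup E] [NormedSpace ℝ E] [FiniteDimensional ℝ E]
  {F : Type*} [NormedAddCommGroup F] [NormedSpace ℝ F] [FiniteDimensional ℝ F]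
  {G : Type*} [TopologicalSpace G] [ChartedSpace F G] [Group G] [LieGroup 𝓘(ℝ, F) ∞ G]
  {P : Type*} [TopologicalSpace P] [ChartedSpace E P] [IsManifold 𝓘(ℝ, E) ∞ P]
  [MulAction Gᵐᵒᵖ P] {n : ℕ}
  [LieRingModule (GroupLieAlgebra 𝓘(ℝ, F) G) (EuclideanSpace ℝ (Fin n))]
  {ϖ : ∀ p : P, TangentSpace 𝓘(ℝ, E) p →L[ℝ] (F × EuclideanSpace ℝ (Fin n))}

/-- The vectors annihilated by the connection part, parametrised by `ℝⁿ`. -/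
def IsGeneralisedCartanConnection.horizontal (hϖ : IsGeneralisedCartanConnection G ϖ) (p : P) :
    EuclideanSpace ℝ (Fin n) →L[ℝ] E :=
  ((hϖ.equiv p).symm : (F × EuclideanSpace ℝ (Fin n)) →L[ℝ] E).comp
    (ContinuousLinearMap.inr ℝ F (EuclideanSpace ℝ (Fin n)))

theorem IsGeneralisedCartanConnection.equiv_orbitDeriv
    (hϖ : IsGeneralisedCartanConnection G ϖ) (p : P) (ξ : F) :
    hϖ.equiv p (orbitDeriv E F G p ξ) = (ξ, 0) :=
  hϖ.normalised ξ p

theorem IsGeneralisedCartanConnection.equiv_horizontal_add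
    (hϖ : IsGeneralisedCartanConnection G ϖ) (p : P) (b : EuclideanSpace ℝ (Fin n)) (ξ : F) :
    hϖ.equiv p (hϖ.horizontal p b + orbitDeriv E F G p ξ) = (ξ, b) := by
  rw [map_add, hϖ.equiv_orbitDeriv]
  change hϖ.equiv p ((hϖ.equiv p).symm (0, b)) + _ = _
  rw [ContinuousLinearEquiv.apply_symm_apply]
  simp

/-- Read in the coframe `ϖ`, the map is the swap `(b, ξ) ↦ (ξ, b)`. This is the infinitesimal
freeness needed for slices. -/
theorem IsGeneralisedCartanConnection.bijective_coprod
    (hϖ : IsGeneralisedCartanConnection G ϖ) (p : P) :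
    Function.Bijective ((hϖ.horizontal p).coprod (orbitDeriv E F G p)) := by
  have h1 : (hϖ.equiv p) ∘ ((hϖ.horizontal p).coprod (orbitDeriv E F G p)) = Prod.swap := by
    funext x
    exact hϖ.equiv_horizontal_add p x.1 x.2
  refine (Function.Bijective.of_comp_iff' (hϖ.equiv p).bijective _).1 ?_
  rw [h1]
  exact Prod.swap_bijective

/-- The kernel of the translational part is the vertical bundle of an invariant submersion onto a
manifold of dimension `n`. -/
theorem IsGeneralisedCartanConnection.solderPart_eq_zero_iff
    {M : Type*} [TopologicalSpace M] [ChartedSpace (EuclideanSpace ℝ (Fin n)) M] {π : P → M}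
    (h_smooth : IsSmoothAction E F G P) (hϖ : IsGeneralisedCartanConnection G ϖ)
    (hπ : ContMDiff 𝓘(ℝ, E) 𝓘(ℝ, EuclideanSpace ℝ (Fin n)) ∞ π)
    (hinv : ∀ (p : P) (g : G), π (p <• g) = π p)
    (hsurj : ∀ p, Function.Surjective (mfderiv 𝓘(ℝ, E) 𝓘(ℝ, EuclideanSpace ℝ (Fin n)) π p))
    (p : P) (v : TangentSpace 𝓘(ℝ, E) p) :
    solderPart ϖ p v = 0 ↔ mfderiv 𝓘(ℝ, E) 𝓘(ℝ, EuclideanSpace ℝ (Fin n)) π p v = 0 := by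
  let D : E →L[ℝ] EuclideanSpace ℝ (Fin n) :=
    mfderiv 𝓘(ℝ, E) 𝓘(ℝ, EuclideanSpace ℝ (Fin n)) π p
  have hvert : ∀ ξ : F, D (orbitDeriv E F G p ξ) = 0 := by
    intro ξ
    have h1 : HasMFDerivAt 𝓘(ℝ, E) 𝓘(ℝ, EuclideanSpace ℝ (Fin n)) π (p <• (1 : G)) D := by
      have e : p <• (1 : G) = p := by simp
      rw [e]
      exact (hπ.mdifferentiableAt (by simp)).hasMFDerivAt
    have h2 : HasMFDerivAt 𝓘(ℝ, F) 𝓘(ℝ, E) (fun g : G => p <• g) 1 (orbitDeriv E F G p) :=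
      ((h_smooth.contMDiff_orbit p).mdifferentiableAt (by simp)).hasMFDerivAt
    have h3 := HasMFDerivAt.comp (g := π) (1 : G) h1 h2
    have h4 : π ∘ (fun g : G => p <• g) = fun _ => π p := funext fun g => hinv p g
    rw [h4] at h3
    exact congrArg (fun A : F →L[ℝ] EuclideanSpace ℝ (Fin n) => A ξ)
      (hasMFDerivAt_unique h3 (hasMFDerivAt_const (π p) (1 : G)))
  have hdec : ∀ v : E, v = hϖ.horizontal p (hϖ.equiv p v).2 +
      orbitDeriv E F G p (hϖ.equiv p v).1 := fun v =>
    (hϖ.equiv p).injective (hϖ.equiv_horizontal_add p _ _).symm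
  have hD : ∀ v : E, D v = D (hϖ.horizontal p (hϖ.equiv p v).2) := by
    intro v
    conv_lhs => rw [hdec v, map_add, hvert, add_zero]
  have hs : Function.Surjective (D.comp (hϖ.horizontal p)) := by
    intro b
    obtain ⟨v, hv⟩ := hsurj p b
    exact ⟨(hϖ.equiv p v).2, (hD v).symm.trans hv⟩
  -- The horizontal space and the base both have dimension `n`, so surjectivity of the projection on
  -- horizontal vectors forces injectivity.
  have hi : Function.Injective ((D.comp (hϖ.horizontal p) :
      EuclideanSpace ℝ (Fin n) →L[ℝ] EuclideanSpace ℝ (Fin n)) :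
      EuclideanSpace ℝ (Fin n) →ₗ[ℝ] EuclideanSpace ℝ (Fin n)) :=
    LinearMap.injective_iff_surjective.2 hs
  have key : ∀ v : E, (hϖ.equiv p v).2 = 0 ↔ D v = 0 := fun v => by
    rw [hD]
    exact (map_eq_zero_iff _ hi).symm
  exact key v

variable {K : Subgroup G} [K.Normal] [ChartedSpace F (G ⧸ K)]
  [MulAction (G ⧸ K)ᵐᵒᵖ P]

/-- The orbit derivatives of `G` and `G ⧸ K` differ by the isomorphism of Lie algebras
`lieQuotient`, so bijectivity passes to the quotient action. -/
theorem IsGeneralisedCartanConnection.bijective_coprod_quotient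
    (h_smooth : IsSmoothAction E F G P) (hϖ : IsGeneralisedCartanConnection G ϖ)
    (hmk : IsLocalDiffeomorph 𝓘(ℝ, F) 𝓘(ℝ, F) ∞ (QuotientGroup.mk : G → G ⧸ K))
    (hact : ∀ (p : P) (g : G), p <• (QuotientGroup.mk g : G ⧸ K) = p <• g) (p : P) :
    Function.Bijective ((hϖ.horizontal p).coprod (orbitDeriv E F (G ⧸ K) p)) := by
  have h1 : ((hϖ.horizontal p).coprod (orbitDeriv E F (G ⧸ K) p)) ∘
      (Prod.map id (lieQuotient F K)) = (hϖ.horizontal p).coprod (orbitDeriv E F G p) := by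
    funext x
    rw [← orbitDeriv_lieQuotient (h_smooth.quotient hmk hact) hmk hact p]
    rfl
  refine (Function.Bijective.of_comp_iff _
    (Function.bijective_id.prodMap (bijective_lieQuotient hmk))).1 ?_
  rw [h1]
  exact hϖ.bijective_coprod p

/-- The transport is block diagonal with `𝔤`-block `Ad_{g⁻¹}`, and `lieQuotient` intertwines the
adjoint actions of `G` and `G ⧸ K`. -/
theorem IsGeneralisedCartanConnection.isPrincipalConnection [ConnectedSpace G]
    [LieGroup 𝓘(ℝ, F) ∞ (G ⧸ K)]
    (h_smooth : IsSmoothAction E F G P) (hϖ : IsGeneralisedCartanConnection G ϖ)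
    (hmk : IsLocalDiffeomorph 𝓘(ℝ, F) 𝓘(ℝ, F) ∞ (QuotientGroup.mk : G → G ⧸ K))
    (hact : ∀ (p : P) (g : G), p <• (QuotientGroup.mk g : G ⧸ K) = p <• g) :
    IsPrincipalConnection (G ⧸ K) (fun p => (lieQuotient F K).comp (connectionPart ϖ p)) where
  smooth := (hϖ.smooth.clm_comp (ContinuousLinearMap.fst ℝ F _)).clm_comp (lieQuotient F K)
  normalised η p := by
    obtain ⟨ξ, rfl⟩ := (bijective_lieQuotient hmk).2 η
    have h1 := congrArg (fun A : F →L[ℝ] E => lieQuotient F K (hϖ.equiv p (A ξ)).1)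
      (orbitDeriv_lieQuotient (h_smooth.quotient hmk hact) hmk hact p)
    refine h1.trans ?_
    rw [hϖ.equiv_orbitDeriv]
  equivariant h p v := by
    obtain ⟨g, rfl⟩ := QuotientGroup.mk_surjective h
    let ϖ' : P → E →L[ℝ] (F × EuclideanSpace ℝ (Fin n)) := ϖ
    refine (rightTranslate_quotientMk hact p g
      (fun q w => lieQuotient F K (ϖ' q w).1) v).trans ?_
    have h1 : ϖ (p <• g) (rightTranslate E g p v) =
        (Ad (F := F) g⁻¹ (ϖ p v).1, hϖ.translationPart p g (ϖ p v).2) :=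
      (hϖ.apply_rightTranslate p g v).trans (hϖ.transport_apply h_smooth p g (ϖ p v))
    exact (congrArg (fun w : F × EuclideanSpace ℝ (Fin n) => lieQuotient F K w.1) h1).trans
      (lieQuotient_Ad hmk g⁻¹ (ϖ p v).1)

theorem IsGeneralisedCartanConnection.exists_isSolderForm [ConnectedSpace G] [Nonempty P]
    {M : Type*} [TopologicalSpace M] [ChartedSpace (EuclideanSpace ℝ (Fin n)) M] {π : P → M}
    (h_smooth : IsSmoothAction E F G P) (hϖ : IsGeneralisedCartanConnection G ϖ)
    (hmk : IsLocalDiffeomorph 𝓘(ℝ, F) 𝓘(ℝ, F) ∞ (QuotientGroup.mk : G → G ⧸ K))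
    (hact : ∀ (p : P) (g : G), p <• (QuotientGroup.mk g : G ⧸ K) = p <• g)
    (hπ : IsPrincipalBundle E F (EuclideanSpace ℝ (Fin n)) (G ⧸ K) π)
    (hsurj : ∀ p, Function.Surjective (mfderiv 𝓘(ℝ, E) 𝓘(ℝ, EuclideanSpace ℝ (Fin n)) π p)) :
    ∃ σ : (G ⧸ K) →* (EuclideanSpace ℝ (Fin n) →L[ℝ] EuclideanSpace ℝ (Fin n)),
      ContMDiff 𝓘(ℝ, F) 𝓘(ℝ, EuclideanSpace ℝ (Fin n) →L[ℝ] EuclideanSpace ℝ (Fin n)) ∞ σ ∧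
      (∀ (ξ : GroupLieAlgebra 𝓘(ℝ, F) G) (v : EuclideanSpace ℝ (Fin n)),
        infinitesimalRep (fun g : G => σ (QuotientGroup.mk g)) ξ v = ⁅ξ, v⁆) ∧
      IsSolderForm (B := EuclideanSpace ℝ (Fin n)) π σ (solderPart ϖ) := by
  obtain ⟨p₀⟩ := ‹Nonempty P›
  -- `K` acts trivially on all of `P`, so its right translations have identity differential and the
  -- representation descends.
  have hK : K ≤ (hϖ.representation h_smooth p₀).ker := by
    intro k hk
    refine hϖ.representation_of_forall_smul_eq h_smooth p₀ fun q => ?_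
    rw [← hact, (QuotientGroup.eq_one_iff k).2 hk, MulOpposite.op_one, one_smul]
  let σ := QuotientGroup.lift K (hϖ.representation h_smooth p₀) hK
  have hσ : ∀ g : G, σ (QuotientGroup.mk g) = hϖ.representation h_smooth p₀ g := fun _ => rfl
  refine ⟨σ, contMDiff_of_comp_quotientMk hmk (hϖ.contMDiff_representation h_smooth p₀),
    hϖ.infinitesimalRep_representation h_smooth p₀, ⟨?_, ?_, ?_⟩⟩
  · exact hϖ.smooth.clm_comp (ContinuousLinearMap.snd ℝ F _)
  · refine hϖ.solderPart_eq_zero_iff h_smooth hπ.smooth_proj (fun p g => ?_) hsurj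
    rw [← hact, hπ.invariant]
  · intro h p v
    obtain ⟨g, rfl⟩ := QuotientGroup.mk_surjective h
    let ϖ' : P → E →L[ℝ] (F × EuclideanSpace ℝ (Fin n)) := ϖ
    refine (rightTranslate_quotientMk hact p g (fun q w => (ϖ' q w).2) v).trans ?_
    have h1 : ϖ (p <• g) (rightTranslate E g p v) =
        (Ad (F := F) g⁻¹ (ϖ p v).1, hϖ.translationPart p₀ g (ϖ p v).2) := by
      -- Independence of the base point lets the single representation built at `p₀` serve at every
      -- `p`.
      rw [hϖ.apply_rightTranslate, hϖ.transport_eq h_smooth p p₀]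
      exact hϖ.transport_apply h_smooth p₀ g (ϖ p v)
    have h2 : σ (QuotientGroup.mk g)⁻¹ = hϖ.translationPart p₀ g :=
      congrArg (hϖ.translationPart p₀) (inv_inv g)
    rw [h2]
    have h3 := congrArg Prod.snd h1
    exact h3

end Components

end GenCartan

end

/-! ### Assembly: isotropy, quotient group, orbit space and components of `ϖ`. -/

theorem mainTheorem2
    {E : Type*} [NormedAddCommGroup E] [NormedSpace ℝ E] [FiniteDimensional ℝ E]
    {F : Type*} [NormedAddCommGroup F] [NormedSpace ℝ F] [FiniteDimensional ℝ F]
    {G : Type*} [TopologicalSpace G] [ChartedSpace F G] [Group G] [LieGroup 𝓘(ℝ, F) ∞ G]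
    {P : Type*} [TopologicalSpace P] [ChartedSpace E P] [IsManifold 𝓘(ℝ, E) ∞ P]
    [T2Space P] [ConnectedSpace P] [MulAction Gᵐᵒᵖ P]
    (h_smooth : GenCartan.IsSmoothAction E F G P)
    {n : ℕ}
    [LieRingModule (GroupLieAlgebra 𝓘(ℝ, F) G) (EuclideanSpace ℝ (Fin n))]
    [LieModule ℝ (GroupLieAlgebra 𝓘(ℝ, F) G) (EuclideanSpace ℝ (Fin n))]
    (ϖ : ∀ p : P, TangentSpace 𝓘(ℝ, E) p →L[ℝ] (F × EuclideanSpace ℝ (Fin n)))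
    (hϖ : GenCartan.IsGeneralisedCartanConnection G ϖ)
    (h_proper : GenCartan.IsProperAction G P)
    (h_type : GenCartan.HasSingleOrbitType G P) :
    (∀ p : P, Finite (GenCartan.isotropy G p)) ∧
    ((∀ p : P, (GenCartan.isotropy G p).Normal) →
      ∃ (K : Subgroup G) (_ : K.Normal),
        (∀ p : P, GenCartan.isotropy G p = K) ∧
        -- the quotient Lie group `K \ G`
        ∃ (_ : ChartedSpace F (G ⧸ K)),
          LieGroup 𝓘(ℝ, F) ∞ (G ⧸ K) ∧
          IsLocalDiffeomorph 𝓘(ℝ, F) 𝓘(ℝ, F) ∞ (QuotientGroup.mk : G → G ⧸ K) ∧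
          -- its action on `P`
          ∃ (_ : MulAction (G ⧸ K)ᵐᵒᵖ P),
            (∀ (p : P) (g : G), p <• (QuotientGroup.mk g : G ⧸ K) = p <• g) ∧
            GenCartan.IsFreeAction (G ⧸ K) P ∧
            FaithfulSMul (G ⧸ K)ᵐᵒᵖ P ∧
            -- the manifold structure of the orbit space, with its quotient topology
            ∃ (_ : ChartedSpace (EuclideanSpace ℝ (Fin n))
                (Quotient (MulAction.orbitRel (G ⧸ K)ᵐᵒᵖ P))),
              IsManifold 𝓘(ℝ, EuclideanSpace ℝ (Fin n)) ∞
                (Quotient (MulAction.orbitRel (G ⧸ K)ᵐᵒᵖ P)) ∧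
              T2Space (Quotient (MulAction.orbitRel (G ⧸ K)ᵐᵒᵖ P)) ∧
              (SecondCountableTopology P →
                SecondCountableTopology (Quotient (MulAction.orbitRel (G ⧸ K)ᵐᵒᵖ P))) ∧
              (∀ p : P, Function.Surjective
                (mfderiv 𝓘(ℝ, E) 𝓘(ℝ, EuclideanSpace ℝ (Fin n))
                  (Quotient.mk (MulAction.orbitRel (G ⧸ K)ᵐᵒᵖ P)) p)) ∧
              GenCartan.IsPrincipalBundle E F (EuclideanSpace ℝ (Fin n)) (G ⧸ K)
                (Quotient.mk (MulAction.orbitRel (G ⧸ K)ᵐᵒᵖ P)) ∧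
              -- the components of `ϖ`
              (ConnectedSpace G →
                GenCartan.IsPrincipalConnection (G ⧸ K)
                  (fun p => (GenCartan.lieQuotient F K).comp (GenCartan.connectionPart ϖ p)) ∧
                ∃ σ : (G ⧸ K) →*
                    (EuclideanSpace ℝ (Fin n) →L[ℝ] EuclideanSpace ℝ (Fin n)),
                  ContMDiff 𝓘(ℝ, F)
                    𝓘(ℝ, EuclideanSpace ℝ (Fin n) →L[ℝ] EuclideanSpace ℝ (Fin n)) ∞ σ ∧
                  (∀ (ξ : GroupLieAlgebra 𝓘(ℝ, F) G) (v : EuclideanSpace ℝ (Fin n)),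
                    GenCartan.infinitesimalRep (fun g : G => σ (QuotientGroup.mk g)) ξ v
                      = ⁅ξ, v⁆) ∧
                  GenCartan.IsSolderForm (B := EuclideanSpace ℝ (Fin n))
                    (Quotient.mk (MulAction.orbitRel (G ⧸ K)ᵐᵒᵖ P)) σ
                    (GenCartan.solderPart ϖ))) := by
  have : CompleteSpace E := FiniteDimensional.complete ℝ E
  have : CompleteSpace F := FiniteDimensional.complete ℝ F
  have : IsTopologicalGroup G := topologicalGroup_of_lieGroup 𝓘(ℝ, F) ∞
  have : LocallyCompactSpace P := ChartedSpace.locallyCompactSpace E P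
  -- Discreteness of isotropy serves twice: with compactness for finiteness, and for the Lie group
  -- structure on the quotient.
  have hdisc : ∀ p : P, ∃ U ∈ 𝓝 (1 : G), ∀ k ∈ GenCartan.isotropy G p, k ∈ U → k = 1 := fun p =>
    GenCartan.exists_nhds_one_isotropy_trivial h_smooth p _ (hϖ.bijective_coprod p)
  refine ⟨fun p => GenCartan.finite_of_isCompact_of_discrete
    (h_proper.isCompact_isotropy p) (hdisc p), fun hn => ?_⟩
  obtain ⟨p₀⟩ : Nonempty P := inferInstance
  have hK : ∀ p : P, GenCartan.isotropy G p = GenCartan.isotropy G p₀ := h_type.isotropy_eq hn p₀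
  have := hn p₀
  obtain ⟨cs, hlie, hmk⟩ := GenCartan.exists_lieGroup_quotient (F := F) (hdisc p₀)
  let act : MulAction (G ⧸ GenCartan.isotropy G p₀)ᵐᵒᵖ P := GenCartan.quotientAction fun k hk p =>
    GenCartan.mem_isotropy.1 ((hK p).symm ▸ hk)
  have hact : ∀ (p : P) (g : G), p <• (QuotientGroup.mk g : G ⧸ GenCartan.isotropy G p₀) = p <• g :=
    fun _ _ => rfl
  have hfree := GenCartan.isFreeAction_quotient hact hK
  obtain ⟨cM, hM, hT2, hsc, hsurj, hπ⟩ := GenCartan.exists_isPrincipalBundle_orbitSpace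
    (h_smooth.quotient hmk hact) (h_proper.quotient hact) hfree
    fun p => ⟨_, hϖ.bijective_coprod_quotient h_smooth hmk hact p⟩
  refine ⟨GenCartan.isotropy G p₀, hn p₀, hK, cs, hlie, hmk, act, hact, hfree,
    GenCartan.faithfulSMul_of_isFreeAction hfree, cM, hM, hT2, hsc, hsurj, hπ, fun hG => ⟨?_, ?_⟩⟩
  · exact hϖ.isPrincipalConnection h_smooth hmk hact
  · exact hϖ.exists_isSolderForm h_smooth hmk hact hπ hsurj
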